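/- **Setting.** Let $\mathcal Q$ be a finite non-empty set of $N$ queries; each $q\in\mathcal Q$ has a finite list $\mathcal S_q=\{\mathbf x^q_1,\dots,\mathbf x^q_{N_q}\}$ of items with relevance scores $y^q_i\in\mathbb R$, and disjoint non-empty groups $\mathcal S^q_a,\mathcal S^q_b\subset\mathcal S_q$. Let $\mathcal S$ be the set of all query-item pairs. Let $h_q(\mathbf x;\mathbf w)$ be the scores, $\mathbf w\in\mathbb R^d$. Let $L_q$ be either the NDCG loss $$L_q(\mathbf w)=-\frac1{Z_q}\sum_{i}\frac{2^{y^q_i}-1}{\log_2(1+N_q\,g_{q,i}(\mathbf w))},\qquad g_{q,i}(\mathbf w)=\frac1{N_q}\sum_{j}\ell\big(h_q(\mathbf x^q_j;\mathbf w)-h_q(\mathbf x^q_i;\mathbf w)\big),$$ with $Z_q>0$ and $\ell$ a non-decreasing, non-negative, differentiable surrogate of $\mathbb I(\cdot\ge 0)$ with $\ell(0)>0$ and locally Lipschitz derivative (e.g. the squared hinge $(x+c)_+^2$, $c>0$), or the ListNet loss $L_q(\mathbf w)=\sum_i\frac{\exp(y^q_i)}{\sum_j\exp(y^q_j)}\log(N_q\,g_{q,i}(\mathbf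 w))$ with $\ell=\exp$. Accordingly $L_q=\sum_i f_{q,i}(g_{q,i})$, where $f_{q,i}(g)=\frac1{Z_q}\frac{1-2^{y^q_i}}{\log_2(N_qg+1)}$, respectively $f_{q,i}(g)=\frac{\exp(y_i^q)}{\sum_j\exp(y_j^q)}\log(N_qg)$. Let $\psi:\mathbb R\to\mathbb R$ be differentiable with locally Lipschitz derivative (a smooth surrogate of the top-$K$ selector), $K\in\mathbb N$, $\kappa\in(0,1)$, $\tau_1,\tau_2>0$, $C\ge0$, and put $$e_{q,i}(\mathbf w)=\frac{\exp h_q(\mathbf x_i^q;\mathbf w)}{\sum_j\exp h_q(\mathbf x_j^q;\mathbf w)},\qquad U_q(\mathbf w,\lambda)=\frac12\Big[\frac1{|\mathcal S_a^q|}\sum_{\mathbf x^q_i\in\mathcal S_a^q}\psi(h_q(\mathbf x_i^q;\mathbf w)-\lambda)e_{q,i}(\mathbf w)-\frac1{|\mathcal S_b^q|}\sum_{\mathbf x^q_i\in\mathcal S_b^q}\psi(h_q(\mathbf x_i^q;\mathbf w)-\lambda)e_{q,i}(\mathbf w)\Big]^2 .$$ For $\mathcal B\subset\mathcal S_q$ let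 $$G_q(\lambda,\mathbf w;\mathcal B)=\frac{K+\kappa}{N_q}\lambda+\frac{\tau_2}2\lambda^2+\frac1{|\mathcal B|}\sum_{\mathbf x\in\mathcal B}\tau_1\ln\!\big(1+e^{(h_q(\mathbf x;\mathbf w)-\lambda)/\tau_1}\big),\qquad \hat\lambda_q(\mathbf w)=\arg\min_\lambda G_q(\lambda,\mathbf w;\mathcal S_q),$$ $$F(\mathbf w)=\frac1{|\mathcal S|}\sum_q L_q(\mathbf w)+\frac CN\sum_qU_q(\mathbf w,\hat\lambda_q(\mathbf w)).$$ **Algorithm (KSO-RED).** The variables are $\mathbf w,\mathbf z\in\mathbb R^d$ and scalars $u_{q,i},u_{q,a},u_{q,b},u_q,s_q,v_q,\lambda_q$; the parameters are $\gamma_0,\dots,\gamma_4\in[0,1]$, $\gamma_5\in(0,1)$, $\eta_0\ge0$, $\eta_1>0$. Let $f_q(z_1,z_2,z_3)=\frac12\big(\frac{z_1-z_2}{N_qz_3}\big)^2$. In iteration $t$, draw a non-empty $\mathcal B\subset\mathcal S$, let $\mathcal B_Q$ be the set of queries occurring in $\mathcal B$, and draw non-empty $\mathcal B_q\subset\mathcal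 S_q$, $\mathcal B^q_a\subset\mathcal S^q_a$, $\mathcal B^q_b\subset\mathcal S^q_b$ for the queries in $\mathcal B_Q$. All draws are independent of each other and of the earlier iterations, their laws do not depend on $t$, and batch averages are unbiased: the average over $\mathcal B$, $\mathcal B_Q$, $\mathcal B_q$, $\mathcal B_a^q$, $\mathcal B_b^q$ of any fixed function has as expectation its average over $\mathcal S$, $\mathcal Q$, $\mathcal S_q$, $\mathcal S^q_a$, $\mathcal S^q_b$, respectively. With all quantities on the right at time $t$, write $h_i=h_q(\mathbf x_i^q;\mathbf w)$ and define the estimators $$\hat g_{q,i}=\tfrac1{|\mathcal B_q|}\sum_{\mathbf x_j^q\in\mathcal B_q}\ell(h_j-h_i),\quad \nabla\hat g_{q,i}=\tfrac1{|\mathcal B_q|}\sum_{\mathbf x_j^q\in\mathcal B_q}\nabla_{\mathbf w}\,\ell(h_j-h_i),\quad \hat g_q=\tfrac1{|\mathcal B_q|}\sum_{\mathbf x_i^q\in\mathcal B_q}e^{h_i},\quad \nabla\hat g_q=\tfrac1{|\mathcal B_q|}\sum_{\mathbf x_i^q\in\mathcal B_q}e^{h_i}\nabla h_i,$$ $$\nabla\lambda_q=-s_q^{-1}\nabla^2_{\lambda\mathbf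 w}G_q(\lambda_q,\mathbf w;\mathcal B_q),\qquad \hat g_{q,a}=\tfrac1{|\mathcal B_a^q|}\sum_{\mathbf x_i^q\in\mathcal B^q_a}\psi(h_i-\lambda_q)e^{h_i},$$ $$\nabla\hat g_{q,a}=\tfrac1{|\mathcal B_a^q|}\sum_{\mathbf x_i^q\in\mathcal B^q_a}\big[\psi'(h_i-\lambda_q)(\nabla h_i-\nabla\lambda_q)+\psi(h_i-\lambda_q)\nabla h_i\big]e^{h_i}$$ and likewise $\hat g_{q,b},\nabla\hat g_{q,b}$ with $\mathcal B_b^q$. Put $$G_1=\tfrac1{|\mathcal B|}\sum_{(q,\mathbf x^q_i)\in\mathcal B}f_{q,i}'(u_{q,i})\nabla\hat g_{q,i},\qquad G_2=\tfrac1{|\mathcal B_Q|}\sum_{q\in\mathcal B_Q}\big[\partial_1f_q\,\nabla\hat g_{q,a}+\partial_2f_q\,\nabla\hat g_{q,b}+\partial_3f_q\,\nabla\hat g_q\big]$$ with the $\partial_kf_q$ evaluated at $(u_{q,a},u_{q,b},u_q)$. Then update $u_{q,i}\leftarrow\gamma_0\hat g_{q,i}+(1-\gamma_0)u_{q,i}$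 for $(q,\mathbf x_i^q)\in\mathcal B$; for $q\in\mathcal B_Q$, $u_{q,a}\leftarrow\gamma_1\hat g_{q,a}+(1-\gamma_1)u_{q,a}$, $u_{q,b}\leftarrow\gamma_2\hat g_{q,b}+(1-\gamma_2)u_{q,b}$, $u_q\leftarrow\gamma_3\hat g_q+(1-\gamma_3)u_q$, $s_q\leftarrow(1-\gamma_4)s_q+\gamma_4\nabla^2_\lambda G_q(\lambda_q,\mathbf w;\mathcal B_q)$, $v_q^+=(1-\gamma_4)v_q+\gamma_4\nabla_\lambda G_q(\lambda_q,\mathbf w;\mathcal B_q)$, $v_q\leftarrow v_q^+$, $\lambda_q\leftarrow\lambda_q-\eta_0v_q^+$; and finally $\mathbf z^+=(1-\gamma_5)\mathbf z+\gamma_5(G_1+CG_2)$, $\mathbf z\leftarrow\mathbf z^+$, $\mathbf w\leftarrow\mathbf w-\eta_1\mathbf z^+$. The scalars of pairs and queries that are not sampled do not change. **Theorem.** Assume that, for all $q$ and all $\mathbf x\in\mathcal S_q$, $|h_q(\mathbf x;\cdot)|\le B_h$, and that $h_q(\mathbf x;\cdot)$, $\nabla h_q(\mathbf x;\cdot)$,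 $\nabla^2h_q(\mathbf x;\cdot)$ are Lipschitz with constants $C_h$, $L_h$, $P_h$. Assume that the initial $\mathbf z$ and scalars are bounded in absolute value by $R$, and that the initial $u_{q,i},u_q,s_q$ are at least $1/R$ (the initial $\mathbf w_0$ is arbitrary). (The mini-batch estimators then automatically have bounded variance.) Then $F$ is differentiable, and there is a constant $A>0$ such that for every $\epsilon>0$ there is a choice of $\gamma_0,\dots,\gamma_5,\eta_0,\eta_1$ with the following property: for every $T\ge A/\epsilon^4$, the iterates satisfy $$\mathbb E\big[\|\nabla F(\mathbf w_\tau)\|^2\big]\le\epsilon^2,$$ where $\tau$ is uniform on $\{1,\dots,T\}$ and independent of the batches. Thus $T=O(1/\epsilon^4)$ iterations suffice. Both $A$ and the parameters are chosen before the scores: they depend on $h$ only through $B_h,C_h,L_h,P_h$, and not on $d$ or $\mathbf w_0$; otherwise they depend on the finite data, $\ell$ or ListNet, $Z_q$, $\psi$, $K$, $\kappa$, $\tau_1$, $\tau_2$, $C$, the laws of the batches and $R$ (and the parameters on $\epsilon$). -/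

import Mathlib

open MeasureTheory ProbabilityTheory Filter Topology
open scoped NNReal

namespace KSORED

noncomputable section

/-- Continuously differentiable with locally Lipschitz derivative (for example the logistic
sigmoid, `exp`, or the squared hinge `x ↦ max (x + c) 0 ^ 2`). -/
structure IsC11 (φ : ℝ → ℝ) : Prop where
  differentiable : Differentiable ℝ φ
  deriv_locallyLipschitz : LocallyLipschitz (deriv φ)

/-- A differentiable increasing (in the weak sense) surrogate of the indicator `𝕀(· ≥ 0)`. The
squared hinge with a margin `c > 0` is one. -/
structure IsIndicatorSurrogate (ℓ : ℝ → ℝ) : Prop extends IsC11 ℓ where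
  monotone : Monotone ℓ
  nonneg : ∀ x, 0 ≤ ℓ x
  pos_zero : 0 < ℓ 0

/-- The two list-wise ranking losses: the NDCG loss with surrogate `ℓ` and normalizing
constants `Z q`, and the ListNet loss. -/
inductive RankingLoss (Q : Type*) where
  | ndcg (ℓ : ℝ → ℝ) (Z : Q → ℝ) : RankingLoss Q
  | listNet : RankingLoss Q

/-- Admissible ranking losses. -/
def RankingLoss.Valid {Q : Type*} : RankingLoss Q → Prop
  | .ndcg ℓ Z => IsIndicatorSurrogate ℓ ∧ ∀ q, 0 < Z q
  | .listNet => True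

/-- The pairwise surrogate that a ranking loss is built on. -/
def RankingLoss.surrogate {Q : Type*} : RankingLoss Q → ℝ → ℝ
  | .ndcg ℓ _ => ℓ
  | .listNet => Real.exp

/-- The data of a learning-to-rank problem with top-`K` exposure fairness: `Q` is the set of
queries and `I q` indexes the list of items of the query `q`. -/
structure Problem (Q : Type*) (I : Q → Type*) where
  /-- relevance scores -/
  y : (q : Q) → I q → ℝ
  /-- minority group -/
  Sa : (q : Q) → Finset (I q)
  /-- majority group -/
  Sb : (q : Q) → Finset (I q)
  Sa_nonempty : ∀ q, (Sa q).Nonempty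
  Sb_nonempty : ∀ q, (Sb q).Nonempty
  disjoint : ∀ q, Disjoint (Sa q) (Sb q)
  /-- the ranking loss -/
  loss : RankingLoss Q
  loss_valid : loss.Valid
  /-- smooth surrogate of the top-`K` selector -/
  ψ : ℝ → ℝ
  ψ_smooth : IsC11 ψ
  /-- length of the top list -/
  K : ℕ
  /-- the offset added to `K` in the lower-level problem -/
  κ : ℝ
  κ_mem : κ ∈ Set.Ioo (0 : ℝ) 1
  /-- smoothing parameter of the lower-level problem -/
  τ₁ : ℝ
  τ₁_pos : 0 < τ₁
  /-- strong convexity parameter of the lower-level problem -/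
  τ₂ : ℝ
  τ₂_pos : 0 < τ₂
  /-- weight of the fairness regularization -/
  C : ℝ
  C_nonneg : 0 ≤ C

/-- The parameter space. -/
abbrev Param (d : ℕ) := EuclideanSpace ℝ (Fin d)

/-- Score functions: `h q i w` is the score of the item `i` of the query `q` at `w`. -/
abbrev Score {Q : Type*} (I : Q → Type*) (d : ℕ) := (q : Q) → I q → Param d → ℝ

/-- Scores are bounded, and Lipschitz with Lipschitz gradient and Lipschitz Hessian. -/
structure ScoreAssumption {Q : Type*} {I : Q → Type*} {d : ℕ} (h : Score I d)
    (Bh : ℝ) (Ch Lh Ph : ℝ≥0) : Prop where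
  bounded : ∀ q i w, |h q i w| ≤ Bh
  differentiable : ∀ q i, Differentiable ℝ (h q i)
  lipschitz : ∀ q i, LipschitzWith Ch (h q i)
  gradient_differentiable : ∀ q i, Differentiable ℝ (gradient (h q i))
  gradient_lipschitz : ∀ q i, LipschitzWith Lh (gradient (h q i))
  hessian_lipschitz : ∀ q i, LipschitzWith Ph (fderiv ℝ (gradient (h q i)))

section Objective

variable {Q : Type*} {I : Q → Type*} [∀ q, Fintype (I q)] {d : ℕ}

/-- The surrogate rank `∑ x', ℓ (h x' - h x)` of an item. -/
def surrogateRank (D : Problem Q I) (h : Score I d) (q : Q) (i : I q) (w : Param d) : ℝ :=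
  ∑ j, D.loss.surrogate (h q j w - h q i w)

/-- The ranking loss `L_q(w)` of a query. -/
def rankingLoss (D : Problem Q I) (h : Score I d) (q : Q) (w : Param d) : ℝ :=
  match D.loss with
  | .ndcg _ Z =>
      -((1 / Z q) * ∑ i, ((2 : ℝ) ^ D.y q i - 1) / Real.logb 2 (1 + surrogateRank D h q i w))
  | .listNet =>
      ∑ i, (Real.exp (D.y q i) / ∑ j, Real.exp (D.y q j)) * Real.log (surrogateRank D h q i w)

/-- The exposure of an item. -/
def exposure (h : Score I d) (q : Q) (i : I q) (w : Param d) : ℝ :=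
  Real.exp (h q i w) / ∑ j, Real.exp (h q j w)

/-- The smoothed top-`K` exposure disparity `U_q^K(w, l)` with threshold `l`. -/
def fairnessLoss (D : Problem Q I) (h : Score I d) (q : Q) (w : Param d) (l : ℝ) : ℝ :=
  (1 / 2) *
    ((1 / ((D.Sa q).card : ℝ)) * ∑ i ∈ D.Sa q, D.ψ (h q i w - l) * exposure h q i w -
      (1 / ((D.Sb q).card : ℝ)) * ∑ i ∈ D.Sb q, D.ψ (h q i w - l) * exposure h q i w) ^ 2

/-- The smoothed strongly convex lower-level objective with the average over the items of `q`
replaced by the average over the mini-batch `B`. -/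
def lowerBatch (D : Problem Q I) (h : Score I d) (q : Q) (B : Finset (I q)) (w : Param d)
    (l : ℝ) : ℝ :=
  (D.K + D.κ) / (Fintype.card (I q) : ℝ) * l + D.τ₂ / 2 * l ^ 2 +
    (1 / (B.card : ℝ)) * ∑ i ∈ B, D.τ₁ * Real.log (1 + Real.exp ((h q i w - l) / D.τ₁))

/-- The lower-level objective `G_q(w, l)`. -/
def lower (D : Problem Q I) (h : Score I d) (q : Q) (w : Param d) (l : ℝ) : ℝ :=
  lowerBatch D h q Finset.univ w l

/-- The lower-level problem has a solution. -/
theorem exists_isMinOn_lower (D : Problem Q I) (h : Score I d) (q : Q) (w : Param d) :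
    ∃ l, IsMinOn (lower D h q w) Set.univ l := by
  set a : ℝ := (D.K + D.κ) / (Fintype.card (I q) : ℝ) with ha
  have h1 : Continuous (lower D h q w) := by
    unfold lower lowerBatch
    refine Continuous.add (by fun_prop) (continuous_const.mul ?_)
    refine continuous_finsetSum _ fun i _ => continuous_const.mul (Continuous.log (by fun_prop) ?_)
    intro l
    positivity
  have hpos := D.τ₂_pos
  have h2 : ∀ l, a * l + D.τ₂ / 2 * l ^ 2 ≤ lower D h q w l := by
    intro l
    unfold lower lowerBatch
    refine le_add_of_nonneg_right (mul_nonneg (by positivity) (Finset.sum_nonneg fun i _ => ?_))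
    refine mul_nonneg D.τ₁_pos.le (Real.log_nonneg ?_)
    linarith [Real.exp_pos ((h q i w - l) / D.τ₁)]
  have h3 : ∀ᶠ l in cocompact ℝ, lower D h q w 0 ≤ lower D h q w l := by
    set M : ℝ := max 1 ((|a| + |lower D h q w 0|) * (2 / D.τ₂)) with hM
    have h4 : ∀ᶠ l : ℝ in cocompact ℝ, M ≤ ‖l‖ :=
      (tendsto_norm_cocompact_atTop (E := ℝ)).eventually (eventually_ge_atTop M)
    filter_upwards [h4] with l hl
    rw [Real.norm_eq_abs] at hl
    have h5 : 1 ≤ |l| := (le_max_left _ _).trans hl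
    have h6 : (|a| + |lower D h q w 0|) * (2 / D.τ₂) ≤ |l| := (le_max_right _ _).trans hl
    have h7 : |a| + |lower D h q w 0| ≤ D.τ₂ / 2 * |l| := by
      rw [mul_div_assoc', div_le_iff₀ hpos] at h6
      linarith
    have h8 : -(|a| * |l|) ≤ a * l := by
      rw [← abs_mul]
      exact neg_abs_le _
    have h9 : l ^ 2 = |l| * |l| := by rw [← sq, sq_abs]
    have h10 := mul_le_mul_of_nonneg_right h7 (abs_nonneg l)
    have h11 := le_mul_of_one_le_right (abs_nonneg (lower D h q w 0)) h5
    have h12 := le_abs_self (lower D h q w 0)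
    have h13 := h2 l
    rw [h9] at h13
    nlinarith
  obtain ⟨l, hl⟩ := h1.exists_forall_le' 0 h3
  exact ⟨l, fun x _ => hl x⟩

/-- The solution `λ̂_q(w)` of the lower-level problem. -/
def lamHat (D : Problem Q I) (h : Score I d) (q : Q) (w : Param d) : ℝ :=
  (exists_isMinOn_lower D h q w).choose

/-- The smoothed bilevel objective `F`. -/
def objective [Fintype Q] (D : Problem Q I) (h : Score I d) (w : Param d) : ℝ :=
  (1 / (Fintype.card (Σ q, I q) : ℝ)) * ∑ q, rankingLoss D h q w +
    D.C / (Fintype.card Q : ℝ) * ∑ q, fairnessLoss D h q w (lamHat D h q w)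

end Objective

section Algorithm

/-- The batches drawn in one iteration: a batch of query-item pairs and, for each query, a batch
of its items, a batch of its minority items and a batch of its majority items. -/
abbrev Batch (Q : Type*) (I : Q → Type*) :=
  Finset (Σ q, I q) × ((q : Q) → Finset (I q) × Finset (I q) × Finset (I q))

variable {Q : Type*} {I : Q → Type*} {d : ℕ}

/-- The queries that occur in a batch of query-item pairs. -/
def queriesOf [DecidableEq Q] (B : Finset (Σ q, I q)) : Finset Q := B.image Sigma.fst

/-- The parameters of the algorithm. -/
structure StepParams where
  γ₀ : ℝ
  γ₁ : ℝ
  γ₂ : ℝ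
  γ₃ : ℝ
  γ₄ : ℝ
  γ₅ : ℝ
  η₀ : ℝ
  η₁ : ℝ
  γ₀_mem : γ₀ ∈ Set.Icc (0 : ℝ) 1
  γ₁_mem : γ₁ ∈ Set.Icc (0 : ℝ) 1
  γ₂_mem : γ₂ ∈ Set.Icc (0 : ℝ) 1
  γ₃_mem : γ₃ ∈ Set.Icc (0 : ℝ) 1
  γ₄_mem : γ₄ ∈ Set.Icc (0 : ℝ) 1
  γ₅_mem : γ₅ ∈ Set.Ioo (0 : ℝ) 1
  η₀_nonneg : 0 ≤ η₀
  η₁_pos : 0 < η₁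

/-- The variables that the algorithm maintains. -/
structure State (I : Q → Type*) (d : ℕ) where
  w : Param d
  z : Param d
  /-- estimates of `g(w; x_i^q, S_q)` -/
  u : (q : Q) → I q → ℝ
  /-- estimates of `g_{q,a}(w)` -/
  ua : Q → ℝ
  /-- estimates of `g_{q,b}(w)` -/
  ub : Q → ℝ
  /-- estimates of `g_q(w)` -/
  uq : Q → ℝ
  /-- estimates of the second derivative of the lower-level objective -/
  s : Q → ℝ
  /-- estimates of the first derivative of the lower-level objective -/
  v : Q → ℝ
  /-- estimates of the lower-level solution -/
  lam : Q → ℝ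

/-- Initial values: the momentum and the scalar estimates are bounded by `R`, and those that serve
as denominators are at least `1 / R`; the initial `w` is arbitrary. -/
structure State.InitBounded (σ : State I d) (R : ℝ) : Prop where
  z : ‖σ.z‖ ≤ R
  u : ∀ q i, σ.u q i ∈ Set.Icc (1 / R) R
  ua : ∀ q, |σ.ua q| ≤ R
  ub : ∀ q, |σ.ub q| ≤ R
  uq : ∀ q, σ.uq q ∈ Set.Icc (1 / R) R
  s : ∀ q, σ.s q ∈ Set.Icc (1 / R) R
  v : ∀ q, |σ.v q| ≤ R
  lam : ∀ q, |σ.lam q| ≤ R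

/-- The mini-batch value `ĝ_{q,i}(w)`. -/
def gHat (D : Problem Q I) (h : Score I d) (q : Q) (i : I q) (B : Finset (I q))
    (w : Param d) : ℝ :=
  (1 / (B.card : ℝ)) * ∑ j ∈ B, D.loss.surrogate (h q j w - h q i w)

/-- The mini-batch gradient `∇ĝ_{q,i}(w)`. -/
def gradGHat (D : Problem Q I) (h : Score I d) (q : Q) (i : I q) (B : Finset (I q))
    (w : Param d) : Param d :=
  (1 / (B.card : ℝ)) • ∑ j ∈ B, gradient (fun w' => D.loss.surrogate (h q j w' - h q i w')) w

/-- The mini-batch value of `g_{q,a}` or `g_{q,b}` with threshold `l`; the group is the one that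
`B` is drawn from. -/
def groupHat (D : Problem Q I) (h : Score I d) (q : Q) (B : Finset (I q)) (w : Param d)
    (l : ℝ) : ℝ :=
  (1 / (B.card : ℝ)) * ∑ i ∈ B, D.ψ (h q i w - l) * Real.exp (h q i w)

/-- The mini-batch gradient of `g_{q,a}` or `g_{q,b}`, with an estimate `l` of `λ̂_q(w)` and an
estimate `dl` of its gradient. -/
def gradGroupHat (D : Problem Q I) (h : Score I d) (q : Q) (B : Finset (I q)) (w : Param d)
    (l : ℝ) (dl : Param d) : Param d :=
  (1 / (B.card : ℝ)) • ∑ i ∈ B,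
      (deriv D.ψ (h q i w - l) * Real.exp (h q i w)) • (gradient (h q i) w - dl) +
    (1 / (B.card : ℝ)) • ∑ i ∈ B,
      (D.ψ (h q i w - l) * Real.exp (h q i w)) • gradient (h q i) w

/-- The mini-batch value `ĝ_q(w)`. -/
def expHat (h : Score I d) (q : Q) (B : Finset (I q)) (w : Param d) : ℝ :=
  (1 / (B.card : ℝ)) * ∑ i ∈ B, Real.exp (h q i w)

/-- The mini-batch gradient `∇ĝ_q(w)`. -/
def gradExpHat (h : Score I d) (q : Q) (B : Finset (I q)) (w : Param d) : Param d :=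
  (1 / (B.card : ℝ)) • ∑ i ∈ B, Real.exp (h q i w) • gradient (h q i) w

variable [Fintype Q] [∀ q, Fintype (I q)]

/-- The outer function `f_{q,i}` of the ranking loss:
`L(w) = (1/|S|) ∑_{(q,i)} f_{q,i}(g(w; x_i^q, S_q))` with `g` the surrogate rank divided by the
number of items. -/
def fPair (D : Problem Q I) (q : Q) (i : I q) (g : ℝ) : ℝ :=
  match D.loss with
  | .ndcg _ Z =>
      (1 / Z q) * ((1 - (2 : ℝ) ^ D.y q i) / Real.logb 2 ((Fintype.card (I q) : ℝ) * g + 1))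
  | .listNet =>
      (Real.exp (D.y q i) / ∑ j, Real.exp (D.y q j)) * Real.log ((Fintype.card (I q) : ℝ) * g)

/-- The outer function `f_q` of the fairness regularization. -/
def fQuery (I : Q → Type*) [∀ q, Fintype (I q)] (q : Q) (z₁ z₂ z₃ : ℝ) : ℝ :=
  (1 / 2) * ((z₁ - z₂) / ((Fintype.card (I q) : ℝ) * z₃)) ^ 2

/-- The estimate `∇λ_{q,t}` of the gradient of `λ̂_q`, by the implicit function theorem. -/
def gradLam (D : Problem Q I) (h : Score I d) (q : Q) (B : Finset (I q)) (w : Param d)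
    (l s : ℝ) : Param d :=
  -(s⁻¹ • gradient (fun w' => deriv (lowerBatch D h q B w') l) w)

variable [DecidableEq Q]

/-- The stochastic gradient `G₁` of the ranking loss. -/
def G₁ (D : Problem Q I) (h : Score I d) (b : Batch Q I) (σ : State I d) : Param d :=
  (1 / (b.1.card : ℝ)) • ∑ p ∈ b.1,
    deriv (fPair D p.1 p.2) (σ.u p.1 p.2) • gradGHat D h p.1 p.2 (b.2 p.1).1 σ.w

/-- The stochastic gradient `G₂` of the fairness regularization. -/
def G₂ (D : Problem Q I) (h : Score I d) (b : Batch Q I) (σ : State I d) : Param d :=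
  (1 / ((queriesOf b.1).card : ℝ)) • ∑ q ∈ queriesOf b.1,
    let dl := gradLam D h q (b.2 q).1 σ.w (σ.lam q) (σ.s q)
    (deriv (fun x => fQuery I q x (σ.ub q) (σ.uq q)) (σ.ua q) •
        gradGroupHat D h q (b.2 q).2.1 σ.w (σ.lam q) dl +
      deriv (fun x => fQuery I q (σ.ua q) x (σ.uq q)) (σ.ub q) •
        gradGroupHat D h q (b.2 q).2.2 σ.w (σ.lam q) dl +
      deriv (fun x => fQuery I q (σ.ua q) (σ.ub q) x) (σ.uq q) •
        gradExpHat h q (b.2 q).1 σ.w)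

variable [∀ q, DecidableEq (I q)]

/-- One iteration of the algorithm. Only the estimates of sampled pairs and queries change. -/
def step (D : Problem Q I) (h : Score I d) (θ : StepParams) (b : Batch Q I)
    (σ : State I d) : State I d :=
  let z' := (1 - θ.γ₅) • σ.z + θ.γ₅ • (G₁ D h b σ + D.C • G₂ D h b σ)
  let v' := fun q => (1 - θ.γ₄) * σ.v q + θ.γ₄ * deriv (lowerBatch D h q (b.2 q).1 σ.w) (σ.lam q)
  { w := σ.w - θ.η₁ • z'
    z := z'
    u := fun q i =>
      if (⟨q, i⟩ : Σ q, I q) ∈ b.1 then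
        θ.γ₀ * gHat D h q i (b.2 q).1 σ.w + (1 - θ.γ₀) * σ.u q i
      else σ.u q i
    ua := fun q =>
      if q ∈ queriesOf b.1 then
        θ.γ₁ * groupHat D h q (b.2 q).2.1 σ.w (σ.lam q) + (1 - θ.γ₁) * σ.ua q
      else σ.ua q
    ub := fun q =>
      if q ∈ queriesOf b.1 then
        θ.γ₂ * groupHat D h q (b.2 q).2.2 σ.w (σ.lam q) + (1 - θ.γ₂) * σ.ub q
      else σ.ub q
    uq := fun q =>
      if q ∈ queriesOf b.1 then
        θ.γ₃ * expHat h q (b.2 q).1 σ.w + (1 - θ.γ₃) * σ.uq q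
      else σ.uq q
    s := fun q =>
      if q ∈ queriesOf b.1 then
        (1 - θ.γ₄) * σ.s q + θ.γ₄ * deriv (deriv (lowerBatch D h q (b.2 q).1 σ.w)) (σ.lam q)
      else σ.s q
    v := fun q => if q ∈ queriesOf b.1 then v' q else σ.v q
    lam := fun q => if q ∈ queriesOf b.1 then σ.lam q - θ.η₀ * v' q else σ.lam q }

/-- The state after `t` iterations with the batches `b 0, b 1, …`. -/
def run (D : Problem Q I) (h : Score I d) (θ : StepParams) (σ₀ : State I d) (b : ℕ → Batch Q I) :
    ℕ → State I d
  | 0 => σ₀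
  | t + 1 => step D h θ (b t) (run D h θ σ₀ b t)

end Algorithm

section Sampling

variable {Q : Type*} {I : Q → Type*}

/-- A law of random nonempty batches from a finite set `S` for which the batch average
`(1/|B|) ∑_{x ∈ B} φ x` is an unbiased estimator of the average of `φ` over `S`, for every `φ`
(for example, uniformly random subsets of `S` of a fixed positive size). -/
structure IsUnbiasedSampling {α : Type*} [Fintype α] [DecidableEq α] (p : PMF (Finset α))
    (S : Finset α) : Prop where
  support : ∀ B ∈ p.support, B.Nonempty ∧ B ⊆ S
  unbiased : ∀ x ∈ S,
    ∑ B : Finset α, (p B).toReal * (if x ∈ B then 1 / (B.card : ℝ) else 0) = 1 / (S.card : ℝ)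

/-- The laws of the batches. -/
structure SamplingLaws (Q : Type*) (I : Q → Type*) where
  pairs : PMF (Finset (Σ q, I q))
  items : (q : Q) → PMF (Finset (I q))
  minority : (q : Q) → PMF (Finset (I q))
  majority : (q : Q) → PMF (Finset (I q))

/-- Batch averages are unbiased: over the pairs of the batch for the average over all pairs, over
the queries that occur in that batch for the average over all queries, over a batch of items of a
query for the average over its items, and likewise for its two groups. -/
structure SamplingLaws.Unbiased [Fintype Q] [DecidableEq Q] [∀ q, Fintype (I q)]
    [∀ q, DecidableEq (I q)] (p : SamplingLaws Q I) (D : Problem Q I) : Prop where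
  pairs : IsUnbiasedSampling p.pairs Finset.univ
  queries : ∀ q, ∑ B : Finset (Σ q, I q), (p.pairs B).toReal *
    (if q ∈ queriesOf B then 1 / ((queriesOf B).card : ℝ) else 0) = 1 / (Fintype.card Q : ℝ)
  items : ∀ q, IsUnbiasedSampling (p.items q) Finset.univ
  minority : ∀ q, IsUnbiasedSampling (p.minority q) (D.Sa q)
  majority : ∀ q, IsUnbiasedSampling (p.majority q) (D.Sb q)

/-- The law of the batches of one iteration: all of them are drawn independently. -/
def SamplingLaws.law [Fintype Q] (p : SamplingLaws Q I) : Measure (Batch Q I) :=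
  p.pairs.toMeasure.prod (Measure.pi fun q =>
    (p.items q).toMeasure.prod ((p.minority q).toMeasure.prod (p.majority q).toMeasure))

end Sampling

end

end KSORED

/-!
With the momentum rate fixed at `1 / 2` and all other rates equal to a small `γ`, the algorithm is a
stochastic gradient method with biased directions. The point `w - η₁ z` moves by exactly `-η₁` times
the stochastic direction (`shadow_step`), so all errors are measured at this shadow point. The mean
of the direction, given the state, is the gradient of the objective with the estimates in place of
the quantities they track (`gradient_objective`, `SamplingLaws.Unbiased.integral_dir`); the implicit
function theorem for the lower-level problem enters here. Hence the squared bias is bounded by the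
squared errors of the estimates (`exists_norm_bias_sq_le`).

* The estimates are moving averages with rate `γ`. In the mean their squared errors contract at a
  rate proportional to `γ`, with noise of order `γ²`. The motion of a target enters through its
  first-order expansion, which brings in the mean of the direction and so a multiple of `c γ` times
  the squared gradient, where `c = η₁ / γ` can be chosen small (`integral_tracking_le`).
* The lower-level iteration is of heavy-ball type, whose step length `η₀` and momentum rate are both
  of order `γ`. In the coordinates `λ - (η₀ / γ) (1 - γ) v` and `v` its error contracts as well
  (`lower_drift_le`).
* For the NDCG loss a surrogate that may vanish on a batch, such as the squared hinge, leaves no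
  positive lower bound for the rank estimates `u`, whereas the derivatives of the outer functions
  blow up at `0` like `u⁻²`. However, the mean of the batch averages has a positive lower bound,
  since every item is compared with itself and the surrogate is positive at `0`. Thus the excess of
  `u⁻⁴` over a threshold contracts in the mean, up to the squared error of `u`
  (`integral_excess_le`), and it bounds the second moment of the direction.

The objective at the shadow point plus a weighted sum of all these errors is therefore a Lyapunov
function: in each iteration it decreases in the mean by a multiple of `γ ‖∇F‖²`, up to a multiple
of `γ²` (`exists_lyapunov`, `exists_potential_descent`). Apart from the lower bound of `u`, the
estimates and the lower-level variables obey deterministic bounds (`exists_region`). All bounds are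
uniform over the admissible scores, for which the predicates `BddLip` and `Tame` keep track of one
constant per function. Summation over the iterations (`sum_integral_run_le`) and `γ` of order `ε²`
bound the mean of `‖∇F‖²` by `ε²` as soon as `T` is of order `ε⁻⁴`.
-/

set_option linter.unusedSectionVars false

namespace KSORED

/-! ### Bounded Lipschitz functions -/

/-- `f` is bounded by `C` and `C`-Lipschitz on `s`. One constant serves both purposes, so that it
can be propagated through sums, products and compositions without depending on the domain. -/
structure BddLip {X E : Type*} [PseudoMetricSpace X] [NormedAddCommGroup E] (s : Set X) (C : ℝ)
    (f : X → E) : Prop where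
  nonneg : 0 ≤ C
  norm_le : ∀ x ∈ s, ‖f x‖ ≤ C
  lip : ∀ x ∈ s, ∀ y ∈ s, ‖f x - f y‖ ≤ C * dist x y

namespace BddLip

variable {X E : Type*} [PseudoMetricSpace X] [NormedAddCommGroup E] [NormedSpace ℝ E]
  {s : Set X} {C C' : ℝ} {f g : X → E}

theorem mono (hf : BddLip s C f) (h : C ≤ C') : BddLip s C' f where
  nonneg := hf.nonneg.trans h
  norm_le x hx := (hf.norm_le x hx).trans h
  lip x hx y hy := (hf.lip x hx y hy).trans (mul_le_mul_of_nonneg_right h dist_nonneg)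

theorem congr (hf : BddLip s C f) (h : ∀ x ∈ s, f x = g x) : BddLip s C g where
  nonneg := hf.nonneg
  norm_le x hx := h x hx ▸ hf.norm_le x hx
  lip x hx y hy := by
    rw [← h x hx, ← h y hy]
    exact hf.lip x hx y hy

theorem const {c : E} (h : ‖c‖ ≤ C) : BddLip s C (fun _ => c) where
  nonneg := (norm_nonneg _).trans h
  norm_le _ _ := h
  lip x _ y _ := by
    simpa using mul_nonneg ((norm_nonneg _).trans h) dist_nonneg

theorem add (hf : BddLip s C f) (hg : BddLip s C' g) :
    BddLip s (C + C') (fun x => f x + g x) where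
  nonneg := add_nonneg hf.nonneg hg.nonneg
  norm_le x hx := (norm_add_le _ _).trans (add_le_add (hf.norm_le x hx) (hg.norm_le x hx))
  lip x hx y hy := by
    rw [add_sub_add_comm, add_mul]
    exact (norm_add_le _ _).trans (add_le_add (hf.lip x hx y hy) (hg.lip x hx y hy))

theorem neg (hf : BddLip s C f) : BddLip s C (fun x => -f x) where
  nonneg := hf.nonneg
  norm_le x hx := by rw [norm_neg]; exact hf.norm_le x hx
  lip x hx y hy := by
    rw [neg_sub_neg, norm_sub_rev]
    exact hf.lip x hx y hy

theorem sub (hf : BddLip s C f) (hg : BddLip s C' g) :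
    BddLip s (C + C') (fun x => f x - g x) := by
  simpa only [sub_eq_add_neg] using hf.add hg.neg

theorem smul {a : X → ℝ} (ha : BddLip s C a) (hf : BddLip s C' f) :
    BddLip s (2 * (C * C')) (fun x => a x • f x) where
  nonneg := by have := ha.nonneg; have := hf.nonneg; positivity
  norm_le x hx := by
    have h0 := ha.nonneg
    have h1 := hf.nonneg
    rw [norm_smul]
    have := mul_le_mul (ha.norm_le x hx) (hf.norm_le x hx) (norm_nonneg _) h0
    nlinarith [mul_nonneg h0 h1]
  lip x hx y hy := by
    have e : a x • f x - a y • f y = a x • (f x - f y) + (a x - a y) • f y := by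
      module
    rw [e]
    refine (norm_add_le _ _).trans ?_
    rw [norm_smul, norm_smul]
    have h1 := mul_le_mul (ha.norm_le x hx) (hf.lip x hx y hy) (norm_nonneg _) ha.nonneg
    have h2 := mul_le_mul (ha.lip x hx y hy) (hf.norm_le y hy) (norm_nonneg _)
      (mul_nonneg ha.nonneg dist_nonneg)
    linarith

theorem mul {a b : X → ℝ} (ha : BddLip s C a) (hb : BddLip s C' b) :
    BddLip s (2 * (C * C')) (fun x => a x * b x) := ha.smul hb

theorem const_mul {a : X → ℝ} (c : ℝ) (ha : BddLip s C a) :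
    BddLip s (2 * (|c| * C)) (fun x => c * a x) :=
  (const (C := |c|) le_rfl).mul ha

theorem const_smul (c : ℝ) (hf : BddLip s C f) : BddLip s (2 * (|c| * C)) (fun x => c • f x) :=
  (const (C := |c|) le_rfl).smul hf

theorem sum {ι : Type*} {t : Finset ι} {F : ι → X → E} {M : ι → ℝ}
    (h : ∀ i ∈ t, BddLip s (M i) (F i)) : BddLip s (∑ i ∈ t, M i) (fun x => ∑ i ∈ t, F i x) where
  nonneg := Finset.sum_nonneg fun i hi => (h i hi).nonneg
  norm_le x hx := (norm_sum_le _ _).trans (Finset.sum_le_sum fun i hi => (h i hi).norm_le x hx)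
  lip x hx y hy := by
    rw [← Finset.sum_sub_distrib, Finset.sum_mul]
    exact (norm_sum_le _ _).trans (Finset.sum_le_sum fun i hi => (h i hi).lip x hx y hy)

/-- Averages over a batch keep the constant, also for the empty batch, whose average is `0`. -/
theorem average {ι : Type*} {B : Finset ι} {F : ι → X → E} (hC : 0 ≤ C)
    (h : ∀ i ∈ B, BddLip s C (F i)) :
    BddLip s C (fun x => (1 / (B.card : ℝ)) • ∑ i ∈ B, F i x) := by
  have hle : (1 / (B.card : ℝ)) * (B.card * C) ≤ C := by
    rcases Nat.eq_zero_or_pos B.card with h0 | h0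
    · simp [h0, hC]
    · have : (0 : ℝ) < B.card := by exact_mod_cast h0
      rw [← mul_assoc, one_div_mul_cancel this.ne', one_mul]
  have hB := BddLip.sum h
  simp only [Finset.sum_const, nsmul_eq_mul] at hB
  have hn : ‖(1 / (B.card : ℝ))‖ = 1 / (B.card : ℝ) := Real.norm_of_nonneg (by positivity)
  refine ⟨hC, fun x hx => ?_, fun x hx y hy => ?_⟩
  · rw [norm_smul, hn]
    exact (mul_le_mul_of_nonneg_left (hB.norm_le x hx) (by positivity)).trans hle
  · rw [← smul_sub, norm_smul, hn]
    refine (mul_le_mul_of_nonneg_left (hB.lip x hx y hy) (by positivity)).trans ?_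
    rw [← mul_assoc]
    exact mul_le_mul_of_nonneg_right hle dist_nonneg

theorem comp {φ : ℝ → E} {t : Set ℝ} {a : X → ℝ} (hφ : BddLip t C' φ) (ha : BddLip s C a)
    (hst : ∀ x ∈ s, a x ∈ t) : BddLip s (C' * (1 + C)) (fun x => φ (a x)) where
  nonneg := mul_nonneg hφ.nonneg (by linarith [ha.nonneg])
  norm_le x hx := (hφ.norm_le _ (hst x hx)).trans (by nlinarith [hφ.nonneg, ha.nonneg])
  lip x hx y hy := by
    refine (hφ.lip _ (hst x hx) _ (hst y hy)).trans ?_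
    rw [mul_assoc]
    refine mul_le_mul_of_nonneg_left ?_ hφ.nonneg
    have := ha.lip x hx y hy
    rw [← dist_eq_norm] at this
    nlinarith [ha.nonneg, dist_nonneg (x := x) (y := y)]

theorem comp_param {Y : Type*} [PseudoMetricSpace Y] {t : Set Y} {u : Y → X}
    (hf : BddLip s C f) (hu : ∀ x ∈ t, u x ∈ s)
    (hl : ∀ x ∈ t, ∀ y ∈ t, dist (u x) (u y) ≤ dist x y) : BddLip t C (fun x => f (u x)) where
  nonneg := hf.nonneg
  norm_le x hx := hf.norm_le _ (hu x hx)
  lip x hx y hy := (hf.lip _ (hu x hx) _ (hu y hy)).trans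
    (mul_le_mul_of_nonneg_left (hl x hx y hy) hf.nonneg)

theorem abs_le {a : X → ℝ} (ha : BddLip s C a) {x : X} (hx : x ∈ s) : |a x| ≤ C :=
  ha.norm_le x hx

theorem abs_sub_le {a : X → ℝ} (ha : BddLip s C a) {x y : X} (hx : x ∈ s) (hy : y ∈ s) :
    |a x - a y| ≤ C * dist x y :=
  ha.lip x hx y hy

end BddLip

/-- A Lipschitz function on a bounded set is bounded Lipschitz for some constant. -/
theorem _root_.LipschitzOnWith.exists_bddLip {E : Type*} [NormedAddCommGroup E] {φ : ℝ → E}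
    {K : ℝ≥0} {a b : ℝ} (h : LipschitzOnWith K φ (Set.Icc a b)) :
    ∃ C, BddLip (Set.Icc a b) C φ := by
  refine ⟨K + (K * (b - a) + ‖φ a‖) ⊔ 0, by positivity, fun x hx => ?_, fun x hx y hy => ?_⟩
  · have ha : a ∈ Set.Icc a b := ⟨le_rfl, hx.1.trans hx.2⟩
    have h1 := h.dist_le_mul x hx a ha
    rw [dist_eq_norm, Real.dist_eq, abs_of_nonneg (by linarith [hx.1])] at h1
    have h2 := norm_sub_norm_le (φ x) (φ a)
    have h3 : (K : ℝ) * (x - a) ≤ K * (b - a) :=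
      mul_le_mul_of_nonneg_left (by linarith [hx.2]) K.2
    have h4 := le_max_left (K * (b - a) + ‖φ a‖) 0
    have h5 : (0 : ℝ) ≤ K := K.2
    linarith
  · rw [← dist_eq_norm]
    refine (h.dist_le_mul x hx y hy).trans (mul_le_mul_of_nonneg_right ?_ dist_nonneg)
    exact le_add_of_nonneg_right (le_max_right _ _)

theorem _root_.LocallyLipschitz.exists_bddLip {E : Type*} [NormedAddCommGroup E] {φ : ℝ → E}
    (h : LocallyLipschitz φ) (a b : ℝ) : ∃ C, BddLip (Set.Icc a b) C φ := by
  obtain ⟨K, hK⟩ := (h.locallyLipschitzOn (s := Set.Icc a b)).exists_lipschitzOnWith_of_compact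
    isCompact_Icc
  exact hK.exists_bddLip

theorem _root_.ContDiffOn.exists_bddLip {φ : ℝ → ℝ} {a b : ℝ} (h : ContDiffOn ℝ 1 φ (Set.Icc a b)) :
    ∃ C, BddLip (Set.Icc a b) C φ := by
  obtain ⟨K, hK⟩ := h.exists_lipschitzOnWith one_ne_zero (convex_Icc a b) isCompact_Icc
  exact hK.exists_bddLip

theorem IsC11.locallyLipschitz {φ : ℝ → ℝ} (h : IsC11 φ) : LocallyLipschitz φ :=
  ContDiff.locallyLipschitz (𝕂 := ℝ)
    (contDiff_one_iff_deriv.2 ⟨h.differentiable, h.deriv_locallyLipschitz.continuous⟩)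

/-- Constants for which a monotone family of properties holds can be chosen uniformly over a
finite index type. -/
theorem exists_forall_of_mono {ι : Type*} [Finite ι] {P : ι → ℝ → Prop}
    (hm : ∀ i a b, a ≤ b → P i a → P i b) (h : ∀ i, ∃ a, P i a) : ∃ a, ∀ i, P i a := by
  choose a ha using h
  obtain ⟨b, hb⟩ := (Set.finite_range a).bddAbove
  exact ⟨b, fun i => hm i _ _ (hb ⟨i, rfl⟩) (ha i)⟩

/-! ### Gradients -/

section Gradient

variable {E : Type*} [NormedAddCommGroup E] [InnerProductSpace ℝ E] [CompleteSpace E]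
  {f g : E → ℝ} {f' g' : E} {x : E}

theorem _root_.HasGradientAt.add (hf : HasGradientAt f f' x) (hg : HasGradientAt g g' x) :
    HasGradientAt (fun y => f y + g y) (f' + g') x := by
  rw [hasGradientAt_iff_hasFDerivAt] at *
  simpa only [map_add] using HasFDerivAt.fun_add hf hg

theorem _root_.HasGradientAt.sub (hf : HasGradientAt f f' x) (hg : HasGradientAt g g' x) :
    HasGradientAt (fun y => f y - g y) (f' - g') x := by
  rw [hasGradientAt_iff_hasFDerivAt] at *
  simpa only [map_sub] using HasFDerivAt.fun_sub hf hg

theorem _root_.HasGradientAt.sum {ι : Type*} {t : Finset ι} {F : ι → E → ℝ} {F' : ι → E}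
    (h : ∀ i ∈ t, HasGradientAt (F i) (F' i) x) :
    HasGradientAt (fun y => ∑ i ∈ t, F i y) (∑ i ∈ t, F' i) x := by
  rw [hasGradientAt_iff_hasFDerivAt, map_sum]
  exact HasFDerivAt.fun_sum fun i hi => (h i hi).hasFDerivAt

theorem _root_.HasGradientAt.const_mul (c : ℝ) (hf : HasGradientAt f f' x) :
    HasGradientAt (fun y => c * f y) (c • f') x := by
  rw [hasGradientAt_iff_hasFDerivAt] at *
  rw [map_smulₛₗ]
  exact HasFDerivAt.const_mul hf c

theorem _root_.HasGradientAt.mul (hf : HasGradientAt f f' x) (hg : HasGradientAt g g' x) :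
    HasGradientAt (fun y => f y * g y) (f x • g' + g x • f') x := by
  rw [hasGradientAt_iff_hasFDerivAt] at *
  simpa only [map_add, map_smul] using HasFDerivAt.fun_mul hf hg

theorem _root_.HasDerivAt.comp_hasGradientAt {φ : ℝ → ℝ} {φ' : ℝ} (hφ : HasDerivAt φ φ' (f x))
    (hf : HasGradientAt f f' x) : HasGradientAt (fun y => φ (f y)) (φ' • f') x := by
  rw [hasGradientAt_iff_hasFDerivAt] at *
  rw [map_smul]
  exact hφ.comp_hasFDerivAt x hf

/-- The second order estimate for a function with Lipschitz gradient. -/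
theorem abs_sub_sub_inner_gradient_le {M : ℝ} (hf : Differentiable ℝ f)
    (hM : ∀ y, ‖gradient f y - gradient f x‖ ≤ M * ‖y - x‖) (hM0 : 0 ≤ M) (y : E) :
    |f y - f x - inner ℝ (gradient f x) (y - x)| ≤ M * ‖y - x‖ ^ 2 := by
  have h := (convex_closedBall x ‖y - x‖).norm_image_sub_le_of_norm_hasFDerivWithin_le'
    (f := f) (f' := fun z => fderiv ℝ f z) (φ := fderiv ℝ f x) (C := M * ‖y - x‖)
    (x := x) (y := y) (fun z _ => (hf z).hasFDerivAt.hasFDerivWithinAt) (fun z hz => ?_)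
    (Metric.mem_closedBall_self (norm_nonneg _)) (by simp [dist_eq_norm])
  · rw [inner_gradient_left, ← Real.norm_eq_abs]
    exact h.trans (by rw [sq, mul_assoc])
  · rw [← toDual_gradient, ← toDual_gradient, ← map_sub, LinearIsometryEquiv.norm_map]
    refine (hM z).trans (mul_le_mul_of_nonneg_left ?_ hM0)
    rwa [Metric.mem_closedBall, dist_eq_norm] at hz

end Gradient

/-- A function on the parameter space that, together with its gradient, is bounded by `M` and
`M`-Lipschitz. -/
structure Tame {d : ℕ} (M : ℝ) (Φ : Param d → ℝ) : Prop where
  differentiable : Differentiable ℝ Φ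
  val : BddLip Set.univ M Φ
  grad : BddLip Set.univ M (gradient Φ)

namespace Tame

variable {d : ℕ} {M M' : ℝ} {Φ Ψ : Param d → ℝ}

theorem nonneg (h : Tame M Φ) : 0 ≤ M := h.val.nonneg

theorem mono (h : Tame M Φ) (hM : M ≤ M') : Tame M' Φ :=
  ⟨h.differentiable, h.val.mono hM, h.grad.mono hM⟩

theorem hasGradientAt (h : Tame M Φ) (w : Param d) : HasGradientAt Φ (gradient Φ w) w :=
  (h.differentiable w).hasGradientAt

theorem of_hasGradientAt {Φ' : Param d → Param d} (h : ∀ w, HasGradientAt Φ (Φ' w) w)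
    (hv : BddLip Set.univ M Φ) (hg : BddLip Set.univ M' Φ') : Tame (M + M') Φ where
  differentiable w := (h w).differentiableAt
  val := hv.mono (le_add_of_nonneg_right hg.nonneg)
  grad := by
    rw [gradient_eq h]
    exact hg.mono (le_add_of_nonneg_left hv.nonneg)

theorem const {c : ℝ} (h : |c| ≤ M) : Tame M (fun _ : Param d => c) where
  differentiable := differentiable_const c
  val := .const h
  grad := by
    rw [gradient_fun_const']
    exact .const (by simpa using (abs_nonneg c).trans h)

theorem add (h : Tame M Φ) (h' : Tame M' Ψ) : Tame (M + M') (fun w => Φ w + Ψ w) where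
  differentiable := h.differentiable.add h'.differentiable
  val := h.val.add h'.val
  grad := by
    rw [gradient_eq fun w => (h.hasGradientAt w).add (h'.hasGradientAt w)]
    exact h.grad.add h'.grad

theorem const_mul (c : ℝ) (h : Tame M Φ) : Tame (2 * (|c| * M)) (fun w => c * Φ w) where
  differentiable := h.differentiable.const_mul c
  val := h.val.const_mul c
  grad := by
    rw [gradient_eq fun w => (h.hasGradientAt w).const_mul c]
    exact h.grad.const_smul c

theorem sum {ι : Type*} {t : Finset ι} {F : ι → Param d → ℝ} {K : ι → ℝ}
    (h : ∀ i ∈ t, Tame (K i) (F i)) : Tame (∑ i ∈ t, K i) (fun w => ∑ i ∈ t, F i w) where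
  differentiable := Differentiable.fun_sum fun i hi => (h i hi).differentiable
  val := .sum fun i hi => (h i hi).val
  grad := by
    rw [gradient_eq fun w => HasGradientAt.sum fun i hi => (h i hi).hasGradientAt w]
    exact .sum fun i hi => (h i hi).grad

theorem abs_sub_le (h : Tame M Φ) (w w' : Param d) : |Φ w - Φ w'| ≤ M * ‖w - w'‖ := by
  rw [← dist_eq_norm]
  exact h.val.abs_sub_le (Set.mem_univ _) (Set.mem_univ _)

theorem abs_le (h : Tame M Φ) (w : Param d) : |Φ w| ≤ M := h.val.abs_le (Set.mem_univ w)

theorem norm_gradient_le (h : Tame M Φ) (w : Param d) : ‖gradient Φ w‖ ≤ M :=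
  h.grad.norm_le w (Set.mem_univ w)

theorem norm_gradient_sub_le (h : Tame M Φ) (w w' : Param d) :
    ‖gradient Φ w - gradient Φ w'‖ ≤ M * ‖w - w'‖ := by
  rw [← dist_eq_norm w]
  exact h.grad.lip w (Set.mem_univ _) w' (Set.mem_univ _)

theorem abs_sub_sub_inner_le (h : Tame M Φ) (w w' : Param d) :
    |Φ w' - Φ w - inner ℝ (gradient Φ w) (w' - w)| ≤ M * ‖w' - w‖ ^ 2 :=
  abs_sub_sub_inner_gradient_le h.differentiable (fun y => h.norm_gradient_sub_le y w) h.nonneg w'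

end Tame

/-! ### Scalar functions and scores -/

theorem bddLip_univ_of_deriv_le {φ : ℝ → ℝ} {C : ℝ} (hC : 0 ≤ C) (hd : Differentiable ℝ φ)
    (h0 : ∀ x, |φ x| ≤ C) (h1 : ∀ x, |deriv φ x| ≤ C) : BddLip Set.univ C φ where
  nonneg := hC
  norm_le x _ := h0 x
  lip x _ y _ := by
    rw [dist_eq_norm]
    exact convex_univ.norm_image_sub_le_of_norm_deriv_le (fun z _ => hd z) (fun z _ => h1 z)
      (Set.mem_univ y) (Set.mem_univ x)

theorem hasDerivAt_deriv_sigmoid (x : ℝ) : HasDerivAt (deriv Real.sigmoid)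
    (Real.sigmoid x * (1 - Real.sigmoid x) * (1 - 2 * Real.sigmoid x)) x := by
  rw [Real.deriv_sigmoid]
  have h := Real.hasDerivAt_sigmoid x
  exact (h.mul (h.const_sub 1)).congr_deriv (by ring)

theorem deriv_sigmoid_mem (x : ℝ) : deriv Real.sigmoid x ∈ Set.Icc (0 : ℝ) 1 := by
  rw [Real.deriv_sigmoid]
  have h0 := Real.sigmoid_pos x
  have h1 := Real.sigmoid_lt_one x
  constructor <;> nlinarith

theorem bddLip_deriv_sigmoid : BddLip Set.univ 1 (deriv Real.sigmoid) := by
  refine bddLip_univ_of_deriv_le zero_le_one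
    (fun x => (hasDerivAt_deriv_sigmoid x).differentiableAt)
    (fun x => ?_) (fun x => ?_)
  · rw [abs_of_nonneg (deriv_sigmoid_mem x).1]
    exact (deriv_sigmoid_mem x).2
  · rw [(hasDerivAt_deriv_sigmoid x).deriv, abs_mul]
    have h0 := Real.sigmoid_pos x
    have h1 := Real.sigmoid_lt_one x
    have h2 := deriv_sigmoid_mem x
    rw [Real.deriv_sigmoid] at h2
    rw [abs_of_nonneg h2.1]
    exact mul_le_one₀ h2.2 (abs_nonneg _) (abs_le.2 ⟨by linarith, by linarith⟩)

theorem bddLip_inv {ρ : ℝ} (hρ : 0 < ρ) : BddLip (Set.Ici ρ) (ρ⁻¹ + ρ⁻¹ ^ 2)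
    (fun x : ℝ => x⁻¹) where
  nonneg := by positivity
  norm_le x hx := by
    have hx0 : 0 < x := hρ.trans_le hx
    rw [Real.norm_of_nonneg (by positivity)]
    exact (inv_anti₀ hρ hx).trans (le_add_of_nonneg_right (by positivity))
  lip x hx y hy := by
    have hx0 : 0 < x := hρ.trans_le hx
    have hy0 : 0 < y := hρ.trans_le hy
    have e : x⁻¹ - y⁻¹ = -(x⁻¹ * y⁻¹ * (x - y)) := by field_simp; ring
    rw [e, norm_neg, norm_mul, Real.norm_of_nonneg (by positivity), dist_eq_norm]
    refine mul_le_mul_of_nonneg_right ?_ (norm_nonneg _)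
    have := mul_le_mul (inv_anti₀ hρ hx) (inv_anti₀ hρ hy) (by positivity) (by positivity)
    have h2 : 0 < ρ⁻¹ := by positivity
    nlinarith

variable {Q : Type*} {I : Q → Type*} {d : ℕ} {h : Score I d} {Bh : ℝ} {Ch Lh Ph : ℝ≥0}

theorem ScoreAssumption.norm_gradient_le (hA : ScoreAssumption h Bh Ch Lh Ph) (q : Q) (i : I q)
    (w : Param d) : ‖gradient (h q i) w‖ ≤ Ch := by
  rw [← LinearIsometryEquiv.norm_map (InnerProductSpace.toDual ℝ (Param d)), toDual_gradient]
  exact norm_fderiv_le_of_lipschitz ℝ (hA.lipschitz q i)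

theorem ScoreAssumption.tame (hA : ScoreAssumption h Bh Ch Lh Ph) (q : Q) (i : I q) :
    Tame (|Bh| + Ch + Lh) (h q i) := by
  have h1 : (0 : ℝ) ≤ Ch := Ch.2
  have h2 : (0 : ℝ) ≤ Lh := Lh.2
  have h3 := abs_nonneg Bh
  refine ⟨hA.differentiable q i, ⟨by positivity, fun w _ => ?_, fun w _ w' _ => ?_⟩,
    ⟨by positivity, fun w _ => ?_, fun w _ w' _ => ?_⟩⟩
  · have := (hA.bounded q i w).trans (le_abs_self Bh)
    rw [Real.norm_eq_abs]
    linarith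
  · rw [← dist_eq_norm]
    exact ((hA.lipschitz q i).dist_le_mul w w').trans
      (mul_le_mul_of_nonneg_right (by linarith) dist_nonneg)
  · exact (hA.norm_gradient_le q i w).trans (by linarith)
  · rw [← dist_eq_norm]
    exact ((hA.gradient_lipschitz q i).dist_le_mul w w').trans
      (mul_le_mul_of_nonneg_right (by linarith) dist_nonneg)

theorem ScoreAssumption.hasGradientAt (hA : ScoreAssumption h Bh Ch Lh Ph) (q : Q) (i : I q)
    (w : Param d) : HasGradientAt (h q i) (gradient (h q i) w) w :=
  (hA.differentiable q i w).hasGradientAt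

theorem ScoreAssumption.abs_le (hA : ScoreAssumption h Bh Ch Lh Ph) (q : Q) (i : I q)
    (w : Param d) : |h q i w| ≤ |Bh| :=
  (hA.bounded q i w).trans (le_abs_self Bh)

/-- Maps that do not increase distances on `S`. -/
def NonExp {X : Type} [PseudoMetricSpace X] {d : ℕ} (S : Set X) (W : X → Param d) : Prop :=
  ∀ x ∈ S, ∀ y ∈ S, dist (W x) (W y) ≤ dist x y

variable {X : Type} [PseudoMetricSpace X] {S : Set X} {W : X → Param d}

theorem NonExp.id : NonExp (Set.univ : Set (Param d)) fun w => w := fun _ _ _ _ => le_rfl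

theorem NonExp.const (w : Param d) : NonExp S fun _ => w := fun _ _ _ _ => by simp

theorem Tame.bddLip_comp {M : ℝ} {Φ : Param d → ℝ} (hΦ : Tame M Φ) (hW : NonExp S W) :
    BddLip S M (fun x => Φ (W x)) := hΦ.val.comp_param (fun _ _ => Set.mem_univ _) hW

theorem Tame.bddLip_gradient_comp {M : ℝ} {Φ : Param d → ℝ} (hΦ : Tame M Φ) (hW : NonExp S W) :
    BddLip S M (fun x => gradient Φ (W x)) := hΦ.grad.comp_param (fun _ _ => Set.mem_univ _) hW

/-! ### The lower-level problem -/

variable [∀ q, Fintype (I q)] (D : Problem Q I)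

theorem hasDerivAt_lowerBatch (q : Q) (B : Finset (I q)) (w : Param d) (l : ℝ) :
    HasDerivAt (lowerBatch D h q B w) ((D.K + D.κ) / (Fintype.card (I q) : ℝ) + D.τ₂ * l -
      (1 / (B.card : ℝ)) * ∑ i ∈ B, Real.sigmoid ((h q i w - l) / D.τ₁)) l := by
  have hτ := D.τ₁_pos
  have h1 : ∀ i ∈ B, HasDerivAt
      (fun l => D.τ₁ * Real.log (1 + Real.exp ((h q i w - l) / D.τ₁)))
      (-Real.sigmoid ((h q i w - l) / D.τ₁)) l := by
    intro i _
    have h2 : HasDerivAt (fun l => (h q i w - l) / D.τ₁) (-1 / D.τ₁) l :=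
      ((hasDerivAt_id l).const_sub (h q i w)).div_const D.τ₁
    have h3 := ((h2.exp.const_add 1).log (by positivity)).const_mul D.τ₁
    refine h3.congr_deriv ?_
    rw [Real.sigmoid_def, Real.exp_neg]
    have := Real.exp_pos ((h q i w - l) / D.τ₁)
    field_simp
    ring
  have h4 := (((hasDerivAt_id l).const_mul ((D.K + D.κ) / (Fintype.card (I q) : ℝ))).add
    ((hasDerivAt_pow 2 l).const_mul (D.τ₂ / 2))).add
    ((HasDerivAt.fun_sum h1).const_mul (1 / (B.card : ℝ)))
  refine h4.congr_deriv ?_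
  rw [Finset.sum_neg_distrib]
  norm_num
  ring

theorem deriv_lowerBatch (q : Q) (B : Finset (I q)) (w : Param d) :
    deriv (lowerBatch D h q B w) = fun l => (D.K + D.κ) / (Fintype.card (I q) : ℝ) + D.τ₂ * l -
      (1 / (B.card : ℝ)) * ∑ i ∈ B, Real.sigmoid ((h q i w - l) / D.τ₁) :=
  funext fun l => (hasDerivAt_lowerBatch D q B w l).deriv

theorem hasDerivAt_deriv_lowerBatch (q : Q) (B : Finset (I q)) (w : Param d) (l : ℝ) :
    HasDerivAt (deriv (lowerBatch D h q B w)) (D.τ₂ + (1 / (B.card : ℝ)) * ∑ i ∈ B,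
      D.τ₁⁻¹ * deriv Real.sigmoid ((h q i w - l) / D.τ₁)) l := by
  rw [deriv_lowerBatch]
  have h1 : ∀ i ∈ B, HasDerivAt (fun l => Real.sigmoid ((h q i w - l) / D.τ₁))
      (deriv Real.sigmoid ((h q i w - l) / D.τ₁) * (-1 / D.τ₁)) l := by
    intro i _
    have h2 : HasDerivAt (fun l => (h q i w - l) / D.τ₁) (-1 / D.τ₁) l :=
      ((hasDerivAt_id l).const_sub (h q i w)).div_const D.τ₁
    exact (Real.hasDerivAt_sigmoid _).differentiableAt.hasDerivAt.comp l h2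
  have h4 := (((hasDerivAt_id l).const_mul D.τ₂).const_add
    ((D.K + D.κ) / (Fintype.card (I q) : ℝ))).sub
    ((HasDerivAt.fun_sum h1).const_mul (1 / (B.card : ℝ)))
  refine h4.congr_deriv ?_
  rw [mul_one, sub_eq_add_neg, ← mul_neg, ← Finset.sum_neg_distrib]
  congr 2
  exact Finset.sum_congr rfl fun i _ => by ring

theorem deriv_deriv_lowerBatch (q : Q) (B : Finset (I q)) (w : Param d) :
    deriv (deriv (lowerBatch D h q B w)) = fun l => D.τ₂ + (1 / (B.card : ℝ)) * ∑ i ∈ B,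
      D.τ₁⁻¹ * deriv Real.sigmoid ((h q i w - l) / D.τ₁) :=
  funext fun l => (hasDerivAt_deriv_lowerBatch D q B w l).deriv

theorem hasGradientAt_deriv_lowerBatch (hA : ScoreAssumption h Bh Ch Lh Ph) (q : Q)
    (B : Finset (I q)) (w : Param d) (l : ℝ) :
    HasGradientAt (fun w' => deriv (lowerBatch D h q B w') l) (-((1 / (B.card : ℝ)) • ∑ i ∈ B,
      (D.τ₁⁻¹ * deriv Real.sigmoid ((h q i w - l) / D.τ₁)) • gradient (h q i) w)) w := by
  simp only [deriv_lowerBatch]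
  have h1 : ∀ i ∈ B, HasGradientAt (fun w' => Real.sigmoid ((h q i w' - l) / D.τ₁))
      ((D.τ₁⁻¹ * deriv Real.sigmoid ((h q i w - l) / D.τ₁)) • gradient (h q i) w) w := by
    intro i _
    have h2 : HasDerivAt (fun y => Real.sigmoid ((y - l) / D.τ₁))
        (deriv Real.sigmoid ((h q i w - l) / D.τ₁) * (1 / D.τ₁)) (h q i w) :=
      (Real.hasDerivAt_sigmoid _).differentiableAt.hasDerivAt.comp (h q i w)
        (((hasDerivAt_id _).sub_const l).div_const D.τ₁)
    have h3 := h2.comp_hasGradientAt (hA.hasGradientAt q i w)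
    rwa [mul_comm, one_div] at h3
  have h4 := (hasGradientAt_const w
    ((D.K + D.κ) / (Fintype.card (I q) : ℝ) + D.τ₂ * l)).sub
    ((HasGradientAt.sum h1).const_mul (1 / (B.card : ℝ)))
  rwa [zero_sub] at h4

theorem average_mem_Icc {ι : Type*} {B : Finset ι} {f : ι → ℝ} {b : ℝ} (hb : 0 ≤ b)
    (hf : ∀ i ∈ B, f i ∈ Set.Icc 0 b) :
    (1 / (B.card : ℝ)) * ∑ i ∈ B, f i ∈ Set.Icc 0 b := by
  refine ⟨mul_nonneg (by positivity) (Finset.sum_nonneg fun i hi => (hf i hi).1), ?_⟩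
  have h1 : ∑ i ∈ B, f i ≤ B.card * b := by
    simpa using Finset.sum_le_sum fun i hi => (hf i hi).2
  rcases Nat.eq_zero_or_pos B.card with h0 | h0
  · simp [h0, hb]
  · have : (0 : ℝ) < B.card := by exact_mod_cast h0
    rw [one_div, inv_mul_le_iff₀ this]
    exact h1

theorem deriv_deriv_lowerBatch_mem (q : Q) (B : Finset (I q)) (w : Param d) (l : ℝ) :
    deriv (deriv (lowerBatch D h q B w)) l ∈ Set.Icc D.τ₂ (D.τ₂ + D.τ₁⁻¹) := by
  rw [deriv_deriv_lowerBatch]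
  have hτ := D.τ₁_pos
  have := average_mem_Icc (B := B)
    (f := fun i => D.τ₁⁻¹ * deriv Real.sigmoid ((h q i w - l) / D.τ₁)) (b := D.τ₁⁻¹)
    (by positivity) (fun i _ => ⟨mul_nonneg (by positivity) (deriv_sigmoid_mem _).1,
      mul_le_of_le_one_right (by positivity) (deriv_sigmoid_mem _).2⟩)
  exact ⟨by linarith [this.1], by linarith [this.2]⟩

/-- The mean value theorem, without an order of the points. -/
theorem exists_sub_eq_deriv_mul {φ : ℝ → ℝ} (hφ : Differentiable ℝ φ) (x y : ℝ) :
    ∃ z, |z - y| ≤ |x - y| ∧ φ x - φ y = deriv φ z * (x - y) := by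
  rcases lt_trichotomy x y with hxy | rfl | hxy
  · obtain ⟨z, hz, e⟩ := exists_deriv_eq_slope φ hxy hφ.continuous.continuousOn
      hφ.differentiableOn
    refine ⟨z, ?_, ?_⟩
    · rw [abs_of_neg (by linarith [hz.2]), abs_of_neg (by linarith)]
      linarith [hz.1]
    · have : y - x ≠ 0 := by linarith
      rw [e]
      field_simp
      ring
  · exact ⟨x, by simp, by simp⟩
  · obtain ⟨z, hz, e⟩ := exists_deriv_eq_slope φ hxy hφ.continuous.continuousOn
      hφ.differentiableOn
    refine ⟨z, ?_, ?_⟩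
    · rw [abs_of_pos (by linarith [hz.1]), abs_of_pos (by linarith)]
      linarith [hz.2]
    · have : x - y ≠ 0 := by linarith
      rw [e]
      field_simp

theorem differentiable_deriv_lowerBatch (q : Q) (B : Finset (I q)) (w : Param d) :
    Differentiable ℝ (deriv (lowerBatch D h q B w)) := fun l =>
  (hasDerivAt_deriv_lowerBatch D q B w l).differentiableAt

theorem deriv_lower_lamHat (q : Q) (w : Param d) :
    deriv (lowerBatch D h q Finset.univ w) (lamHat D h q w) = 0 := by
  have h1 : IsMinOn (lower D h q w) Set.univ (lamHat D h q w) :=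
    (exists_isMinOn_lower D h q w).choose_spec
  exact (h1.isLocalMin Filter.univ_mem).deriv_eq_zero

/-- The derivative of the lower-level objective is that of its quadratic term up to a bounded error,
whatever the batch. -/
theorem abs_deriv_lowerBatch_sub_le (q : Q) (B : Finset (I q)) (w : Param d) (l : ℝ) :
    |deriv (lowerBatch D h q B w) l - D.τ₂ * l| ≤ D.K + 2 := by
  rw [deriv_lowerBatch]
  have h1 := average_mem_Icc (B := B)
    (f := fun i => Real.sigmoid ((h q i w - l) / D.τ₁)) zero_le_one
    (fun i _ => ⟨Real.sigmoid_nonneg _, Real.sigmoid_le_one _⟩)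
  have h2 : (D.K + D.κ) / (Fintype.card (I q) : ℝ) ∈ Set.Icc (0 : ℝ) (D.K + 1) := by
    have hκ := D.κ_mem
    have hK : (0 : ℝ) ≤ D.K := by positivity
    refine ⟨div_nonneg (by linarith [hκ.1]) (by positivity), ?_⟩
    obtain ⟨i, -⟩ := D.Sa_nonempty q
    have : (1 : ℝ) ≤ Fintype.card (I q) := by
      exact_mod_cast Fintype.card_pos_iff.2 ⟨i⟩
    exact (div_le_self (by linarith [hκ.1]) this).trans (by linarith [hκ.2])
  rw [abs_le]
  constructor <;> linarith [h1.1, h1.2, h2.1, h2.2]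

theorem abs_lamHat_le (q : Q) (w : Param d) : |lamHat D h q w| ≤ (D.K + 2) / D.τ₂ := by
  have h1 := abs_deriv_lowerBatch_sub_le D (h := h) q Finset.univ w (lamHat D h q w)
  rw [deriv_lower_lamHat, zero_sub, abs_neg, abs_mul, abs_of_pos D.τ₂_pos] at h1
  rwa [le_div_iff₀ D.τ₂_pos, mul_comm]

/-- The derivative of the lower-level objective at a point is comparable with the distance to the
minimizer. -/
theorem exists_deriv_lower_eq (q : Q) (w : Param d) (l : ℝ) :
    ∃ m ∈ Set.Icc D.τ₂ (D.τ₂ + D.τ₁⁻¹),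
      deriv (lowerBatch D h q Finset.univ w) l = m * (l - lamHat D h q w) := by
  obtain ⟨z, -, e⟩ := exists_sub_eq_deriv_mul
    (differentiable_deriv_lowerBatch D (h := h) q Finset.univ w) l (lamHat D h q w)
  rw [deriv_lower_lamHat, sub_zero] at e
  exact ⟨_, deriv_deriv_lowerBatch_mem D q Finset.univ w z, e⟩

theorem abs_deriv_lowerBatch_sub_le_norm (hA : ScoreAssumption h Bh Ch Lh Ph) (q : Q)
    (B : Finset (I q)) (w w' : Param d) (l : ℝ) :
    |deriv (lowerBatch D h q B w) l - deriv (lowerBatch D h q B w') l| ≤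
      D.τ₁⁻¹ * Ch * ‖w - w'‖ := by
  have hτ := D.τ₁_pos
  have hd : Differentiable ℝ (fun w' => deriv (lowerBatch D h q B w') l) := fun w =>
    (hasGradientAt_deriv_lowerBatch D hA q B w l).differentiableAt
  have := convex_univ.norm_image_sub_le_of_norm_fderiv_le (𝕜 := ℝ)
    (f := fun w' => deriv (lowerBatch D h q B w') l) (C := D.τ₁⁻¹ * Ch)
    (fun x _ => hd x) (fun x _ => ?_) (Set.mem_univ w') (Set.mem_univ w)
  · exact this
  · rw [← toDual_gradient, LinearIsometryEquiv.norm_map,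
      (hasGradientAt_deriv_lowerBatch D hA q B x l).gradient, norm_neg]
    refine (BddLip.average (X := ℝ) (s := Set.univ) (C := D.τ₁⁻¹ * Ch)
      (F := fun i _ => (D.τ₁⁻¹ * deriv Real.sigmoid ((h q i x - l) / D.τ₁)) • gradient (h q i) x)
      (by positivity) (fun i _ => .const ?_)).norm_le 0 (Set.mem_univ _)
    have h2 := deriv_sigmoid_mem ((h q i x - l) / D.τ₁)
    rw [norm_smul, norm_mul, Real.norm_of_nonneg h2.1, Real.norm_of_nonneg (by positivity)]
    exact mul_le_mul (mul_le_of_le_one_right (by positivity) h2.2) (hA.norm_gradient_le q i x)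
      (norm_nonneg _) (by positivity)

/-- The lower-level solution is Lipschitz, by strong convexity. -/
theorem abs_lamHat_sub_le (hA : ScoreAssumption h Bh Ch Lh Ph) (q : Q) (w w' : Param d) :
    |lamHat D h q w - lamHat D h q w'| ≤ D.τ₂⁻¹ * (D.τ₁⁻¹ * Ch) * ‖w - w'‖ := by
  obtain ⟨m, hm, e⟩ := exists_deriv_lower_eq D (h := h) q w (lamHat D h q w')
  have h1 := abs_deriv_lowerBatch_sub_le_norm D hA q Finset.univ w w' (lamHat D h q w')
  have hτ := D.τ₂_pos
  rw [deriv_lower_lamHat, sub_zero, e, abs_mul, abs_of_pos (hτ.trans_le hm.1),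
    abs_sub_comm] at h1
  have h2 := mul_le_mul_of_nonneg_right hm.1 (abs_nonneg (lamHat D h q w - lamHat D h q w'))
  rw [mul_assoc, ← div_eq_inv_mul, le_div_iff₀ hτ]
  linarith

/-- A product is differentiable where one factor is merely continuous if the other factor is
differentiable and vanishes. -/
theorem _root_.HasGradientAt.mul_of_continuousAt {E : Type*} [NormedAddCommGroup E]
    [InnerProductSpace ℝ E] [CompleteSpace E] {f k : E → ℝ} {f' x : E}
    (hf : HasGradientAt f f' x) (h0 : f x = 0) (hk : ContinuousAt k x) :
    HasGradientAt (fun y => k y * f y) (k x • f') x := by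
  have h1 : HasGradientAt (fun y => (k y - k x) * f y) 0 x := by
    rw [hasGradientAt_iff_hasFDerivAt, map_zero, hasFDerivAt_iff_isLittleO]
    have h2 : (fun y => k y - k x) =o[𝓝 x] (fun _ => (1 : ℝ)) := by
      rw [Asymptotics.isLittleO_one_iff]
      have := Tendsto.sub_const hk (k x)
      rwa [sub_self] at this
    have h3 : f =O[𝓝 x] fun y => y - x := by
      simpa [h0] using hf.hasFDerivAt.isBigO_sub
    simpa [h0] using (h2.mul_isBigO h3.norm_right)
  have h2 := h1.add (hf.const_mul (k x))
  rw [zero_add] at h2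
  refine h2.congr_of_eventuallyEq (Eventually.of_forall fun y => ?_)
  simp only
  ring

/-- The implicit function theorem for the lower-level solution. -/
theorem hasGradientAt_lamHat (hA : ScoreAssumption h Bh Ch Lh Ph) (q : Q) (w : Param d) :
    HasGradientAt (lamHat D h q) (gradLam D h q Finset.univ w (lamHat D h q w)
      (deriv (deriv (lowerBatch D h q Finset.univ w)) (lamHat D h q w))) w := by
  set l₀ := lamHat D h q w with hl₀
  choose ξ hξ e using fun w' => exists_sub_eq_deriv_mul
    (differentiable_deriv_lowerBatch D (h := h) q Finset.univ w') (lamHat D h q w') l₀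
  simp only [deriv_lower_lamHat, zero_sub] at e
  have hpos : ∀ w', 0 < deriv (deriv (lowerBatch D h q Finset.univ w')) (ξ w') := fun w' =>
    D.τ₂_pos.trans_le (deriv_deriv_lowerBatch_mem D q Finset.univ w' _).1
  have hlc : ContinuousAt (lamHat D h q) w := by
    refine (LipschitzWith.of_dist_le_mul (K := ⟨D.τ₂⁻¹ * (D.τ₁⁻¹ * Ch), ?_⟩)
      fun a b => ?_).continuous.continuousAt
    · have := D.τ₁_pos
      have := D.τ₂_pos
      positivity
    · rw [Real.dist_eq, dist_eq_norm]
      exact abs_lamHat_sub_le D hA q a b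
  have hξw : ξ w = l₀ := by
    have := hξ w
    rw [← hl₀, sub_self, abs_zero] at this
    linarith [abs_nonpos_iff.1 this]
  have hξc : ContinuousAt ξ w := by
    rw [ContinuousAt, hξw, tendsto_iff_dist_tendsto_zero]
    have h1 : Tendsto (fun w' => |lamHat D h q w' - l₀|) (𝓝 w) (𝓝 0) := by
      have := (Tendsto.sub_const hlc l₀).abs
      rwa [← hl₀, sub_self, abs_zero] at this
    exact squeeze_zero (fun _ => dist_nonneg) (fun w' => hξ w') h1
  have hkc : ContinuousAt
      (fun w' => -(deriv (deriv (lowerBatch D h q Finset.univ w')) (ξ w'))⁻¹) w := by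
    suffices hc : ContinuousAt
        (fun w' => deriv (deriv (lowerBatch D h q Finset.univ w')) (ξ w')) w from
      (hc.inv₀ (hpos w).ne').neg
    simp only [deriv_deriv_lowerBatch]
    refine continuousAt_const.add (continuousAt_const.mul ?_)
    refine tendsto_finsetSum _ fun i _ => ?_
    refine continuousAt_const.mul ?_
    have hs : Continuous (deriv Real.sigmoid) := continuous_iff_continuousAt.2 fun x =>
      (hasDerivAt_deriv_sigmoid x).continuousAt
    exact hs.continuousAt.comp
      (((hA.lipschitz q i).continuous.continuousAt.sub hξc).div_const _)
  have h1 := (hasGradientAt_deriv_lowerBatch D hA q Finset.univ w l₀).mul_of_continuousAt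
    (deriv_lower_lamHat D q w) hkc
  have h2 : HasGradientAt (fun w' => lamHat D h q w' - l₀) _ w :=
    h1.congr_of_eventuallyEq (Eventually.of_forall fun w' => by
      have h3 := e w'
      have h4 := (hpos w').ne'
      simp only
      field_simp
      linarith)
  have h3 := h2.add (hasGradientAt_const w l₀)
  simp only [sub_add_cancel, add_zero] at h3
  rw [gradLam, (hasGradientAt_deriv_lowerBatch D hA q Finset.univ w l₀).gradient, ← neg_smul]
  rwa [hξw] at h3

/-! ### Uniform bounds for the mini-batch estimators -/

theorem BddLip.average_all {X E : Type*} [PseudoMetricSpace X] [NormedAddCommGroup E]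
    [NormedSpace ℝ E] {s : Set X} {C : ℝ} {ι : Type*} [Nonempty ι] (B : Finset ι) {F : ι → X → E}
    (h : ∀ i, BddLip s C (F i)) : BddLip s C (fun x => (1 / (B.card : ℝ)) • ∑ i ∈ B, F i x) :=
  .average (h (Classical.arbitrary ι)).nonneg fun i _ => h i

/-- The constant does not depend on the metric space `X`, so that it serves for functions of `w`, of
the estimates, or of both. -/
theorem exists_bddLip_comp {φ : ℝ → ℝ} (hφ : LocallyLipschitz φ) (M : ℝ) :
    ∃ C, ∀ {X : Type} [PseudoMetricSpace X] {S : Set X} {a : X → ℝ},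
      BddLip S M a → BddLip S C (fun x => φ (a x)) := by
  obtain ⟨C, hC⟩ := hφ.exists_bddLip (-M) M
  exact ⟨C * (1 + M), fun ha => hC.comp ha fun x hx => abs_le.1 (ha.abs_le hx)⟩

theorem exists_bddLip_inv {ρ : ℝ} (hρ : 0 < ρ) (M : ℝ) :
    ∃ C, ∀ {X : Type} [PseudoMetricSpace X] {S : Set X} {a : X → ℝ},
      BddLip S M a → (∀ x ∈ S, ρ ≤ a x) → BddLip S C (fun x => (a x)⁻¹) :=
  ⟨_, fun ha h => (bddLip_inv hρ).comp ha h⟩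

theorem locallyLipschitz_exp : LocallyLipschitz Real.exp :=
  ContDiff.locallyLipschitz (𝕂 := ℝ) Real.contDiff_exp

theorem RankingLoss.Valid.isC11 {Q : Type*} {L : RankingLoss Q} (hL : L.Valid) :
    IsC11 L.surrogate := by
  cases L with
  | ndcg ℓ Z => exact hL.1.toIsC11
  | listNet =>
    refine ⟨Real.differentiable_exp, ?_⟩
    simp only [RankingLoss.surrogate, Real.deriv_exp]
    exact locallyLipschitz_exp

theorem RankingLoss.Valid.surrogate_nonneg {Q : Type*} {L : RankingLoss Q} (hL : L.Valid) (x : ℝ) :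
    0 ≤ L.surrogate x := by
  cases L with
  | ndcg ℓ Z => exact hL.1.nonneg x
  | listNet => exact (Real.exp_pos x).le

theorem RankingLoss.Valid.surrogate_zero_pos {Q : Type*} {L : RankingLoss Q} (hL : L.Valid) :
    0 < L.surrogate 0 := by
  cases L with
  | ndcg ℓ Z => exact hL.1.pos_zero
  | listNet => exact Real.exp_pos 0

variable {Q : Type*} {I : Q → Type*} [∀ q, Fintype (I q)] (D : Problem Q I)
  (Bh : ℝ) (Ch Lh Ph : ℝ≥0)

theorem Problem.nonempty_items (D : Problem Q I) (q : Q) : Nonempty (I q) :=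
  ⟨(D.Sa_nonempty q).choose⟩

theorem Problem.card_pos (D : Problem Q I) (q : Q) : (0 : ℝ) < Fintype.card (I q) := by
  have := D.nonempty_items q
  exact_mod_cast Fintype.card_pos

theorem exists_bddLip_comp_sub {φ : ℝ → ℝ} (hφ : LocallyLipschitz φ) (L : ℝ) :
    ∃ C, ∀ {d : ℕ} {h : Score I d}, ScoreAssumption h Bh Ch Lh Ph →
      ∀ {X : Type} [PseudoMetricSpace X] {S : Set X} {W : X → Param d} {l : X → ℝ}, NonExp S W →
        BddLip S L l → ∀ q i, BddLip S C (fun x => φ (h q i (W x) - l x)) := by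
  obtain ⟨C, hC⟩ := exists_bddLip_comp hφ (|Bh| + Ch + Lh + L)
  exact ⟨C, fun hA X _ S W l hW hl q i => hC (((hA.tame q i).bddLip_comp hW).sub hl)⟩

theorem exists_bddLip_exp :
    ∃ C, ∀ {d : ℕ} {h : Score I d}, ScoreAssumption h Bh Ch Lh Ph →
      ∀ {X : Type} [PseudoMetricSpace X] {S : Set X} {W : X → Param d}, NonExp S W →
        ∀ q i, BddLip S C (fun x => Real.exp (h q i (W x))) := by
  obtain ⟨C, hC⟩ := exists_bddLip_comp locallyLipschitz_exp (|Bh| + Ch + Lh)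
  exact ⟨C, fun hA X _ S W hW q i => hC ((hA.tame q i).bddLip_comp hW)⟩

theorem exists_bddLip_groupHat (L : ℝ) :
    ∃ C, ∀ {d : ℕ} {h : Score I d}, ScoreAssumption h Bh Ch Lh Ph →
      ∀ {X : Type} [PseudoMetricSpace X] {S : Set X} {W : X → Param d} {l : X → ℝ}, NonExp S W →
        BddLip S L l → ∀ q B, BddLip S C (fun x => groupHat D h q B (W x) (l x)) := by
  obtain ⟨C₁, h₁⟩ := exists_bddLip_comp_sub (I := I) Bh Ch Lh Ph D.ψ_smooth.locallyLipschitz L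
  obtain ⟨C₂, h₂⟩ := exists_bddLip_exp (I := I) Bh Ch Lh Ph
  apply Exists.intro
  intro d h hA X _ S W l hW hl q B
  have := D.nonempty_items q
  exact .average_all B fun i => (h₁ hA hW hl q i).mul (h₂ hA hW q i)

theorem exists_bddLip_gradGroupHat (L : ℝ) :
    ∃ C, ∀ {d : ℕ} {h : Score I d}, ScoreAssumption h Bh Ch Lh Ph →
      ∀ {X : Type} [PseudoMetricSpace X] {S : Set X} {W : X → Param d} {l : X → ℝ}
        {dl : X → Param d}, NonExp S W → BddLip S L l → BddLip S L dl → ∀ q B,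
          BddLip S C (fun x => gradGroupHat D h q B (W x) (l x) (dl x)) := by
  obtain ⟨C₁, h₁⟩ := exists_bddLip_comp_sub (I := I) Bh Ch Lh Ph D.ψ_smooth.locallyLipschitz L
  obtain ⟨C₂, h₂⟩ := exists_bddLip_exp (I := I) Bh Ch Lh Ph
  obtain ⟨C₃, h₃⟩ := exists_bddLip_comp_sub (I := I) Bh Ch Lh Ph
    D.ψ_smooth.deriv_locallyLipschitz L
  apply Exists.intro
  intro d h hA X _ S W l dl hW hl hdl q B
  have := D.nonempty_items q
  exact .add
    (.average_all B fun i => ((h₃ hA hW hl q i).mul (h₂ hA hW q i)).smul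
      (((hA.tame q i).bddLip_gradient_comp hW).sub hdl))
    (.average_all B fun i => ((h₁ hA hW hl q i).mul (h₂ hA hW q i)).smul
      ((hA.tame q i).bddLip_gradient_comp hW))

theorem exists_bddLip_expHat (D : Problem Q I) :
    ∃ C, ∀ {d : ℕ} {h : Score I d}, ScoreAssumption h Bh Ch Lh Ph →
      ∀ {X : Type} [PseudoMetricSpace X] {S : Set X} {W : X → Param d}, NonExp S W →
        ∀ q B, BddLip S C (fun x => expHat h q B (W x)) := by
  obtain ⟨C₂, h₂⟩ := exists_bddLip_exp (I := I) Bh Ch Lh Ph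
  apply Exists.intro
  intro d h hA X _ S W hW q B
  have := D.nonempty_items q
  exact .average_all B fun i => h₂ hA hW q i

theorem exists_bddLip_gradExpHat (D : Problem Q I) :
    ∃ C, ∀ {d : ℕ} {h : Score I d}, ScoreAssumption h Bh Ch Lh Ph →
      ∀ {X : Type} [PseudoMetricSpace X] {S : Set X} {W : X → Param d}, NonExp S W →
        ∀ q B, BddLip S C (fun x => gradExpHat h q B (W x)) := by
  obtain ⟨C₂, h₂⟩ := exists_bddLip_exp (I := I) Bh Ch Lh Ph
  apply Exists.intro
  intro d h hA X _ S W hW q B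
  have := D.nonempty_items q
  exact .average_all B fun i => (h₂ hA hW q i).smul ((hA.tame q i).bddLip_gradient_comp hW)

theorem exists_bddLip_gHat :
    ∃ C, ∀ {d : ℕ} {h : Score I d}, ScoreAssumption h Bh Ch Lh Ph →
      ∀ {X : Type} [PseudoMetricSpace X] {S : Set X} {W : X → Param d}, NonExp S W →
        ∀ q i B, BddLip S C (fun x => gHat D h q i B (W x)) := by
  obtain ⟨C₁, h₁⟩ := exists_bddLip_comp D.loss_valid.isC11.locallyLipschitz
    ((|Bh| + Ch + Lh) + (|Bh| + Ch + Lh))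
  apply Exists.intro
  intro d h hA X _ S W hW q i B
  have := D.nonempty_items q
  exact .average_all B fun j => h₁
    (((hA.tame q j).bddLip_comp hW).sub ((hA.tame q i).bddLip_comp hW))

variable {D Bh Ch Lh Ph} in
theorem hasGradientAt_surrogate_sub {d : ℕ} {h : Score I d} (hA : ScoreAssumption h Bh Ch Lh Ph)
    (q : Q) (i j : I q) (w : Param d) :
    HasGradientAt (fun w' => D.loss.surrogate (h q j w' - h q i w'))
      (deriv D.loss.surrogate (h q j w - h q i w) • (gradient (h q j) w - gradient (h q i) w)) w :=
  (D.loss_valid.isC11.differentiable _).hasDerivAt.comp_hasGradientAt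
    ((hA.hasGradientAt q j w).sub (hA.hasGradientAt q i w))

theorem exists_bddLip_gradGHat :
    ∃ C, ∀ {d : ℕ} {h : Score I d}, ScoreAssumption h Bh Ch Lh Ph →
      ∀ {X : Type} [PseudoMetricSpace X] {S : Set X} {W : X → Param d}, NonExp S W →
        ∀ q i B, BddLip S C (fun x => gradGHat D h q i B (W x)) := by
  obtain ⟨C₁, h₁⟩ := exists_bddLip_comp D.loss_valid.isC11.deriv_locallyLipschitz
    ((|Bh| + Ch + Lh) + (|Bh| + Ch + Lh))
  apply Exists.intro
  intro d h hA X _ S W hW q i B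
  have := D.nonempty_items q
  simp only [gradGHat, (hasGradientAt_surrogate_sub hA q i _ _).gradient]
  exact .average_all B fun j => (h₁
    (((hA.tame q j).bddLip_comp hW).sub ((hA.tame q i).bddLip_comp hW))).smul
    (((hA.tame q j).bddLip_gradient_comp hW).sub ((hA.tame q i).bddLip_gradient_comp hW))

theorem exists_bddLip_deriv_sigmoid (L : ℝ) :
    ∃ C, ∀ {d : ℕ} {h : Score I d}, ScoreAssumption h Bh Ch Lh Ph →
      ∀ {X : Type} [PseudoMetricSpace X] {S : Set X} {W : X → Param d} {l : X → ℝ}, NonExp S W →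
        BddLip S L l → ∀ q i, BddLip S C
          (fun x => D.τ₁⁻¹ * deriv Real.sigmoid ((h q i (W x) - l x) / D.τ₁)) := by
  apply Exists.intro
  intro d h hA X _ S W l hW hl q i
  have h1 := ((((hA.tame q i).bddLip_comp hW).sub hl).const_mul D.τ₁⁻¹)
  simp only [← div_eq_inv_mul] at h1
  exact (bddLip_deriv_sigmoid.comp h1 fun _ _ => Set.mem_univ _).const_mul D.τ₁⁻¹

theorem exists_bddLip_deriv_deriv_lowerBatch (L : ℝ) :
    ∃ C, ∀ {d : ℕ} {h : Score I d}, ScoreAssumption h Bh Ch Lh Ph →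
      ∀ {X : Type} [PseudoMetricSpace X] {S : Set X} {W : X → Param d} {l : X → ℝ}, NonExp S W →
        BddLip S L l → ∀ q B, BddLip S C
          (fun x => deriv (deriv (lowerBatch D h q B (W x))) (l x)) := by
  obtain ⟨C, hC⟩ := exists_bddLip_deriv_sigmoid D Bh Ch Lh Ph L
  apply Exists.intro
  intro d h hA X _ S W l hW hl q B
  have := D.nonempty_items q
  simp only [deriv_deriv_lowerBatch]
  exact (BddLip.const le_rfl).add (.average_all B fun i => hC hA hW hl q i)

theorem exists_bddLip_gradLam (L : ℝ) {ρ : ℝ} (hρ : 0 < ρ) :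
    ∃ C, ∀ {d : ℕ} {h : Score I d}, ScoreAssumption h Bh Ch Lh Ph →
      ∀ {X : Type} [PseudoMetricSpace X] {S : Set X} {W : X → Param d} {l s : X → ℝ}, NonExp S W →
        BddLip S L l → BddLip S L s → (∀ x ∈ S, ρ ≤ s x) → ∀ q B, BddLip S C
          (fun x => gradLam D h q B (W x) (l x) (s x)) := by
  obtain ⟨C, hC⟩ := exists_bddLip_deriv_sigmoid D Bh Ch Lh Ph L
  obtain ⟨C₁, h₁⟩ := exists_bddLip_inv hρ L
  apply Exists.intro
  intro d h hA X _ S W l s hW hl hs hsρ q B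
  have := D.nonempty_items q
  simp only [gradLam, (hasGradientAt_deriv_lowerBatch D hA q B _ _).gradient]
  exact ((h₁ hs hsρ).smul (BddLip.average_all B fun i => (hC hA hW hl q i).smul
    ((hA.tame q i).bddLip_gradient_comp hW)).neg).neg

/-! ### The outer function of the fairness regularization -/

noncomputable section

theorem deriv_fQuery_fst (q : Q) (a b c : ℝ) : deriv (fun x => fQuery I q x b c) a =
    (a - b) * ((Fintype.card (I q) : ℝ)⁻¹ * c⁻¹) ^ 2 := by
  have h : HasDerivAt (fun x => fQuery I q x b c) _ a :=
    ((((hasDerivAt_id a).sub_const b).div_const ((Fintype.card (I q) : ℝ) * c)).pow 2).const_mul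
      (1 / 2)
  rw [h.deriv]
  simp only [id, div_eq_mul_inv, mul_inv]
  push_cast
  ring

theorem deriv_fQuery_snd (q : Q) (a b c : ℝ) : deriv (fun x => fQuery I q a x c) b =
    -((a - b) * ((Fintype.card (I q) : ℝ)⁻¹ * c⁻¹) ^ 2) := by
  have h : HasDerivAt (fun x => fQuery I q a x c) _ b :=
    ((((hasDerivAt_id b).const_sub a).div_const ((Fintype.card (I q) : ℝ) * c)).pow 2).const_mul
      (1 / 2)
  rw [h.deriv]
  simp only [id, div_eq_mul_inv, mul_inv]
  push_cast
  ring

theorem deriv_fQuery_thd (q : Q) (a b : ℝ) {c : ℝ} (hc : c ≠ 0) :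
    deriv (fun x => fQuery I q a b x) c =
      -(((a - b) * ((Fintype.card (I q) : ℝ)⁻¹ * c⁻¹)) ^ 2 * c⁻¹) := by
  have e : (fun x => fQuery I q a b x) =
      fun x => (1 / 2) * ((a - b) * (Fintype.card (I q) : ℝ)⁻¹ * x⁻¹) ^ 2 := by
    funext x
    simp only [fQuery, div_eq_mul_inv, mul_inv]
    ring
  have h := ((((hasDerivAt_inv hc).const_mul ((a - b) * (Fintype.card (I q) : ℝ)⁻¹)).fun_pow
    2).const_mul (1 / 2))
  rw [e, h.deriv]
  push_cast
  field_simp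

/-- The contribution of the query `q` to the stochastic gradient of the fairness regularization,
for the batches `β` of items, minority items and majority items and for given estimates. -/
def queryDir {d : ℕ} (D : Problem Q I) (h : Score I d) (q : Q)
    (β : Finset (I q) × Finset (I q) × Finset (I q)) (w : Param d) (ua ub uq s l : ℝ) : Param d :=
  let dl := gradLam D h q β.1 w l s
  deriv (fun x => fQuery I q x ub uq) ua • gradGroupHat D h q β.2.1 w l dl +
    deriv (fun x => fQuery I q ua x uq) ub • gradGroupHat D h q β.2.2 w l dl +
    deriv (fun x => fQuery I q ua ub x) uq • gradExpHat h q β.1 w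

theorem exists_bddLip_queryDir (L : ℝ) {ρ : ℝ} (hρ : 0 < ρ) :
    ∃ C, ∀ {d : ℕ} {h : Score I d}, ScoreAssumption h Bh Ch Lh Ph →
      ∀ {X : Type} [PseudoMetricSpace X] {S : Set X} {W : X → Param d} {ua ub uq s l : X → ℝ},
        NonExp S W → BddLip S L ua → BddLip S L ub → BddLip S L uq → BddLip S L s →
        BddLip S L l → (∀ x ∈ S, ρ ≤ uq x) → (∀ x ∈ S, ρ ≤ s x) → ∀ q β, BddLip S C
          (fun x => queryDir D h q β (W x) (ua x) (ub x) (uq x) (s x) (l x)) := by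
  obtain ⟨C₁, h₁⟩ := exists_bddLip_inv hρ L
  obtain ⟨C₂, h₂⟩ := exists_bddLip_gradLam D Bh Ch Lh Ph L hρ
  obtain ⟨C₃, h₃⟩ := exists_bddLip_gradGroupHat D Bh Ch Lh Ph (max L C₂)
  obtain ⟨C₄, h₄⟩ := exists_bddLip_gradExpHat Bh Ch Lh Ph D
  apply Exists.intro
  intro d h hA X _ S W ua ub uq s l hW hua hub huq hs hl huqρ hsρ q β
  have hN : ‖(Fintype.card (I q) : ℝ)⁻¹‖ ≤ 1 := by
    rw [norm_inv, Real.norm_of_nonneg (D.card_pos q).le]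
    have := D.nonempty_items q
    exact inv_le_one_of_one_le₀ (by exact_mod_cast Fintype.card_pos (α := I q))
  have hr := (BddLip.const (s := S) hN).mul (h₁ huq huqρ)
  have hdl := (h₂ hA hW hl hs hsρ q β.1).mono (le_max_right L C₂)
  have hl' := hl.mono (le_max_left L C₂)
  have c1 := (hua.sub hub).mul (hr.mul hr)
  have c3 := ((((hua.sub hub).mul hr).mul ((hua.sub hub).mul hr)).mul (h₁ huq huqρ)).neg
  have key := ((c1.smul (h₃ hA hW hl' hdl q β.2.1)).add
    (c1.neg.smul (h₃ hA hW hl' hdl q β.2.2))).add (c3.smul (h₄ hA hW q β.1))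
  refine ⟨key.nonneg, fun x hx => ?_, fun x hx y hy => ?_⟩
  · have e := key.norm_le x hx
    have hx0 : uq x ≠ 0 := (hρ.trans_le (huqρ x hx)).ne'
    simpa only [queryDir, deriv_fQuery_fst, deriv_fQuery_snd, deriv_fQuery_thd q _ _ hx0, sq]
      using e
  · have e := key.lip x hx y hy
    have hx0 : uq x ≠ 0 := (hρ.trans_le (huqρ x hx)).ne'
    have hy0 : uq y ≠ 0 := (hρ.trans_le (huqρ y hy)).ne'
    simpa only [queryDir, deriv_fQuery_fst, deriv_fQuery_snd, deriv_fQuery_thd q _ _ hx0,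
      deriv_fQuery_thd q _ _ hy0, sq] using e

end

noncomputable section

/-! ### The quantities tracked by the algorithm -/

namespace Tame

variable {d : ℕ} {M M' : ℝ} {Φ Ψ : Param d → ℝ}

theorem sub (h : Tame M Φ) (h' : Tame M' Ψ) : Tame (M + M') (fun w => Φ w - Ψ w) where
  differentiable := h.differentiable.sub h'.differentiable
  val := h.val.sub h'.val
  grad := by
    rw [gradient_eq fun w => (h.hasGradientAt w).sub (h'.hasGradientAt w)]
    exact h.grad.sub h'.grad

theorem average {ι : Type*} [Nonempty ι] (B : Finset ι) {F : ι → Param d → ℝ}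
    (h : ∀ i, Tame M (F i)) : Tame M (fun w => (1 / (B.card : ℝ)) * ∑ i ∈ B, F i w) where
  differentiable := (Differentiable.fun_sum fun i _ => (h i).differentiable).const_mul _
  val := .average_all B fun i => (h i).val
  grad := by
    rw [gradient_eq fun w => (HasGradientAt.sum fun i _ => (h i).hasGradientAt w).const_mul _]
    exact .average_all B fun i => (h i).grad

theorem comp {φ : ℝ → ℝ} {t : Set ℝ} {C : ℝ} (hφ : ∀ x ∈ t, DifferentiableAt ℝ φ x)
    (h0 : BddLip t C φ) (h1 : BddLip t C (deriv φ)) (h : Tame M Φ) (ht : ∀ w, Φ w ∈ t) :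
    Tame (C * (1 + M) + 2 * (C * (1 + M) * M)) (fun w => φ (Φ w)) :=
  .of_hasGradientAt (fun w => (hφ _ (ht w)).hasDerivAt.comp_hasGradientAt (h.hasGradientAt w))
    (h0.comp h.val fun w _ => ht w) ((h1.comp h.val fun w _ => ht w).smul h.grad)

end Tame

theorem exists_tame_comp {φ : ℝ → ℝ} (hφ : IsC11 φ) (M : ℝ) :
    ∃ C, ∀ {d : ℕ} {Φ : Param d → ℝ}, Tame M Φ → Tame C (fun w => φ (Φ w)) := by
  obtain ⟨C₁, h₁⟩ := hφ.locallyLipschitz.exists_bddLip (-M) M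
  obtain ⟨C₂, h₂⟩ := hφ.deriv_locallyLipschitz.exists_bddLip (-M) M
  apply Exists.intro
  intro d Φ h
  exact .comp (fun x _ => hφ.differentiable x) (h₁.mono (le_max_left C₁ C₂))
    (h₂.mono (le_max_right C₁ C₂)) h fun w => abs_le.1 (h.abs_le w)

variable {Q : Type*} {I : Q → Type*} [∀ q, Fintype (I q)] {D : Problem Q I} {d : ℕ}
  {h : Score I d} {Bh : ℝ} {Ch Lh Ph : ℝ≥0}

theorem hasGradientAt_gHat (hA : ScoreAssumption h Bh Ch Lh Ph) (q : Q) (i : I q)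
    (B : Finset (I q)) (w : Param d) :
    HasGradientAt (gHat D h q i B) (gradGHat D h q i B w) w :=
  (HasGradientAt.sum fun j _ =>
    (hasGradientAt_surrogate_sub hA q i j w).differentiableAt.hasGradientAt).const_mul _

theorem hasGradientAt_expHat (hA : ScoreAssumption h Bh Ch Lh Ph) (q : Q)
    (B : Finset (I q)) (w : Param d) : HasGradientAt (expHat h q B) (gradExpHat h q B w) w :=
  (HasGradientAt.sum fun i _ =>
    (Real.hasDerivAt_exp _).comp_hasGradientAt (hA.hasGradientAt q i w)).const_mul _

theorem hasGradientAt_groupHat (hA : ScoreAssumption h Bh Ch Lh Ph) (q : Q)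
    (B : Finset (I q)) {l : Param d → ℝ} {dl w : Param d} (hl : HasGradientAt l dl w) :
    HasGradientAt (fun w => groupHat D h q B w (l w)) (gradGroupHat D h q B w (l w) dl) w := by
  have h1 : ∀ i ∈ B, HasGradientAt (fun w => D.ψ (h q i w - l w) * Real.exp (h q i w))
      ((deriv D.ψ (h q i w - l w) * Real.exp (h q i w)) • (gradient (h q i) w - dl) +
        (D.ψ (h q i w - l w) * Real.exp (h q i w)) • gradient (h q i) w) w := by
    intro i _
    have h2 := ((D.ψ_smooth.differentiable _).hasDerivAt.comp_hasGradientAt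
      ((hA.hasGradientAt q i w).sub hl)).mul
      ((Real.hasDerivAt_exp _).comp_hasGradientAt (hA.hasGradientAt q i w))
    convert h2 using 1
    module
  have h3 := (HasGradientAt.sum h1).const_mul (1 / (B.card : ℝ))
  rwa [Finset.sum_add_distrib, smul_add] at h3

/-- The quantity estimated by `ua` and `ub`. -/
def groupTarget (D : Problem Q I) (h : Score I d) (q : Q) (B : Finset (I q)) (w : Param d) : ℝ :=
  groupHat D h q B w (lamHat D h q w)

/-- The quantity estimated by `s`. -/
def curvTarget (D : Problem Q I) (h : Score I d) (q : Q) (w : Param d) : ℝ :=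
  deriv (deriv (lowerBatch D h q Finset.univ w)) (lamHat D h q w)

theorem isC11_deriv_sigmoid_div {τ : ℝ} : IsC11 fun x => τ⁻¹ * deriv Real.sigmoid (x / τ) := by
  have h1 : ∀ x, HasDerivAt (fun x => τ⁻¹ * deriv Real.sigmoid (x / τ)) (τ⁻¹ *
      (Real.sigmoid (x / τ) * (1 - Real.sigmoid (x / τ)) * (1 - 2 * Real.sigmoid (x / τ)) *
        (1 / τ))) x := fun x =>
    (HasDerivAt.comp x (h₂ := deriv Real.sigmoid) (h := fun x => x / τ)
      (hasDerivAt_deriv_sigmoid (x / τ)) ((hasDerivAt_id x).div_const τ)).const_mul τ⁻¹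
  refine ⟨fun x => (h1 x).differentiableAt, ?_⟩
  rw [funext fun x => (h1 x).deriv]
  refine ContDiff.locallyLipschitz (𝕂 := ℝ) ?_
  have h2 : ContDiff ℝ 1 Real.sigmoid := contDiff_sigmoid.of_le le_top
  fun_prop

variable (D : Problem Q I) (Bh : ℝ) (Ch Lh Ph : ℝ≥0)

theorem exists_tame_lamHat : ∃ M, ∀ {d : ℕ} {h : Score I d}, ScoreAssumption h Bh Ch Lh Ph →
    ∀ q, Tame M (lamHat D h q) := by
  have hτ₁ := D.τ₁_pos
  have hτ₂ := D.τ₂_pos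
  have hl : ∀ {d : ℕ} {h : Score I d}, ScoreAssumption h Bh Ch Lh Ph → ∀ q, BddLip Set.univ
      ((D.K + 2) / D.τ₂ + D.τ₂⁻¹ * (D.τ₁⁻¹ * Ch)) (lamHat D h q) := fun {d h} hA q =>
    ⟨by positivity, fun w _ => (abs_lamHat_le D q w).trans (le_add_of_nonneg_right (by positivity)),
      fun w _ w' _ => by
        rw [dist_eq_norm]
        exact (abs_lamHat_sub_le D hA q w w').trans
          (mul_le_mul_of_nonneg_right (le_add_of_nonneg_left (by positivity)) (norm_nonneg _))⟩
  obtain ⟨C₁, h₁⟩ := exists_bddLip_deriv_deriv_lowerBatch D Bh Ch Lh Ph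
    ((D.K + 2) / D.τ₂ + D.τ₂⁻¹ * (D.τ₁⁻¹ * Ch))
  obtain ⟨C₂, h₂⟩ := exists_bddLip_gradLam D Bh Ch Lh Ph
    (max ((D.K + 2) / D.τ₂ + D.τ₂⁻¹ * (D.τ₁⁻¹ * Ch)) C₁) hτ₂
  apply Exists.intro
  intro d h hA q
  exact .of_hasGradientAt (hasGradientAt_lamHat D hA q) (hl hA q)
    (h₂ hA .id ((hl hA q).mono (le_max_left _ _))
      ((h₁ hA .id (hl hA q) q Finset.univ).mono (le_max_right _ _))
      (fun w _ => (deriv_deriv_lowerBatch_mem D q _ w _).1) q Finset.univ)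

theorem exists_tame_groupTarget : ∃ M, ∀ {d : ℕ} {h : Score I d}, ScoreAssumption h Bh Ch Lh Ph →
    ∀ q B, Tame M (groupTarget D h q B) := by
  obtain ⟨M, hM⟩ := exists_tame_lamHat D Bh Ch Lh Ph
  obtain ⟨C₁, h₁⟩ := exists_bddLip_groupHat D Bh Ch Lh Ph M
  obtain ⟨C₂, h₂⟩ := exists_bddLip_gradGroupHat D Bh Ch Lh Ph M
  apply Exists.intro
  intro d h hA q B
  exact .of_hasGradientAt
    (fun w => hasGradientAt_groupHat hA q B ((hM hA q).hasGradientAt w))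
    (h₁ hA .id (hM hA q).val q B) (h₂ hA .id (hM hA q).val (hM hA q).grad q B)

theorem exists_tame_gHat : ∃ M, ∀ {d : ℕ} {h : Score I d}, ScoreAssumption h Bh Ch Lh Ph →
    ∀ q i B, Tame M (gHat D h q i B) := by
  obtain ⟨C₁, h₁⟩ := exists_bddLip_gHat D Bh Ch Lh Ph
  obtain ⟨C₂, h₂⟩ := exists_bddLip_gradGHat D Bh Ch Lh Ph
  apply Exists.intro
  intro d h hA q i B
  exact .of_hasGradientAt (fun w => hasGradientAt_gHat hA q i B w) (h₁ hA .id q i B)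
    (h₂ hA .id q i B)

theorem exists_tame_expHat (D : Problem Q I) :
    ∃ M, ∀ {d : ℕ} {h : Score I d}, ScoreAssumption h Bh Ch Lh Ph →
    ∀ q B, Tame M (expHat h q B) := by
  obtain ⟨C₁, h₁⟩ := exists_bddLip_expHat Bh Ch Lh Ph D
  obtain ⟨C₂, h₂⟩ := exists_bddLip_gradExpHat Bh Ch Lh Ph D
  apply Exists.intro
  intro d h hA q B
  exact .of_hasGradientAt (fun w => hasGradientAt_expHat hA q B w) (h₁ hA .id q B)
    (h₂ hA .id q B)

theorem exists_tame_curvTarget : ∃ M, ∀ {d : ℕ} {h : Score I d}, ScoreAssumption h Bh Ch Lh Ph →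
    ∀ q, Tame M (curvTarget D h q) := by
  obtain ⟨M, hM⟩ := exists_tame_lamHat D Bh Ch Lh Ph
  obtain ⟨C₁, h₁⟩ := exists_tame_comp (isC11_deriv_sigmoid_div (τ := D.τ₁)) (|Bh| + Ch + Lh + M)
  apply Exists.intro
  intro d h hA q
  have := D.nonempty_items q
  have e : curvTarget D h q = fun w => D.τ₂ + (1 / ((Finset.univ : Finset (I q)).card : ℝ)) *
      ∑ i, D.τ₁⁻¹ * deriv Real.sigmoid ((h q i w - lamHat D h q w) / D.τ₁) := by
    funext w
    rw [curvTarget, deriv_deriv_lowerBatch]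
  rw [e]
  exact (Tame.const le_rfl).add (.average _ fun i => h₁ ((hA.tame q i).sub (hM hA q)))

variable {D Bh Ch Lh Ph}

theorem curvTarget_mem (q : Q) (w : Param d) :
    curvTarget D h q w ∈ Set.Icc D.τ₂ (D.τ₂ + D.τ₁⁻¹) :=
  deriv_deriv_lowerBatch_mem D q _ w _

theorem expHat_ge (hA : ScoreAssumption h Bh Ch Lh Ph) (q : Q) {B : Finset (I q)}
    (hB : B.Nonempty) (w : Param d) : Real.exp (-|Bh|) ≤ expHat h q B w := by
  have hc : (0 : ℝ) < B.card := by exact_mod_cast hB.card_pos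
  have h1 : B.card * Real.exp (-|Bh|) ≤ ∑ i ∈ B, Real.exp (h q i w) := by
    simpa using Finset.sum_le_sum fun i (_ : i ∈ B) =>
      Real.exp_le_exp.2 (abs_le.1 (hA.abs_le q i w)).1
  rw [expHat, one_div, ← div_eq_inv_mul, le_div_iff₀ hc, mul_comm]
  exact h1

theorem gHat_nonneg (q : Q) (i : I q) (B : Finset (I q)) (w : Param d) :
    0 ≤ gHat D h q i B w :=
  mul_nonneg (by positivity) (Finset.sum_nonneg fun _ _ => D.loss_valid.surrogate_nonneg _)

variable [Fintype Q]

/-- A lower bound of the normalized surrogate ranks. -/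
def rankBound (D : Problem Q I) : ℝ := D.loss.surrogate 0 / Fintype.card (Σ q, I q)

theorem Problem.card_sigma_pos [Nonempty Q] (D : Problem Q I) :
    (0 : ℝ) < Fintype.card (Σ q, I q) := by
  have := D.nonempty_items (Classical.arbitrary Q)
  have : Nonempty (Σ q, I q) := ⟨⟨Classical.arbitrary Q, Classical.arbitrary _⟩⟩
  exact_mod_cast Fintype.card_pos

theorem rankBound_pos [Nonempty Q] : 0 < rankBound D :=
  div_pos D.loss_valid.surrogate_zero_pos D.card_sigma_pos

/-- Every item is compared with itself, which contributes the value of the surrogate at `0`. -/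
theorem rankBound_le (q : Q) (i : I q) (w : Param d) :
    rankBound D ≤ gHat D h q i Finset.univ w := by
  have h0 := D.loss_valid.surrogate_zero_pos
  have h1 : (Fintype.card (I q) : ℝ) ≤ Fintype.card (Σ q, I q) := by
    exact_mod_cast Fintype.card_le_of_injective (fun i => (⟨q, i⟩ : Σ q, I q))
      sigma_mk_injective
  have h2 : D.loss.surrogate 0 ≤ ∑ j, D.loss.surrogate (h q j w - h q i w) := by
    have := Finset.single_le_sum (f := fun j => D.loss.surrogate (h q j w - h q i w))
      (fun j _ => D.loss_valid.surrogate_nonneg _) (Finset.mem_univ i)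
    simpa using this
  rw [gHat, rankBound, Finset.card_univ, one_div, ← div_eq_inv_mul]
  exact (div_le_div_of_nonneg_left h0.le (D.card_pos q) h1).trans
    (div_le_div_of_nonneg_right h2 (D.card_pos q).le)

/-! ### The outer functions of the ranking loss -/

/-- A common form of the outer functions: a multiple of an inverse logarithm (NDCG) or of a
logarithm (ListNet). -/
theorem fPair_eq (D : Problem Q I) (q : Q) (i : I q) :
    ∃ k : ℝ,
      (fPair D q i = fun g => k * (Real.log (Fintype.card (I q) * g + 1))⁻¹) ∨
      (fPair D q i = fun g => k * Real.log (Fintype.card (I q) * g)) := by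
  cases hL : D.loss with
  | ndcg ℓ Z =>
    refine ⟨(1 / Z q) * ((1 - (2 : ℝ) ^ D.y q i) * Real.log 2), Or.inl (funext fun g => ?_)⟩
    simp only [fPair, hL, Real.logb, div_eq_mul_inv, mul_assoc, mul_inv, inv_inv]
    ring
  | listNet =>
    refine ⟨Real.exp (D.y q i) / ∑ j, Real.exp (D.y q j), Or.inr (funext fun g => ?_)⟩
    simp only [fPair, hL]

theorem contDiffOn_fPair (D : Problem Q I) (q : Q) (i : I q) :
    ContDiffOn ℝ 2 (fPair D q i) (Set.Ioi 0) := by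
  have hN := D.card_pos q
  obtain ⟨k, e | e⟩ := fPair_eq D q i
  · rw [e]
    refine contDiffOn_const.mul (ContDiffOn.inv (ContDiffOn.log (by fun_prop) ?_) ?_)
    · intro g hg
      have : 0 < (Fintype.card (I q) : ℝ) * g := mul_pos hN hg
      positivity
    · intro g hg
      have : 0 < (Fintype.card (I q) : ℝ) * g := mul_pos hN hg
      exact (Real.log_pos (by linarith)).ne'
  · rw [e]
    refine contDiffOn_const.mul (ContDiffOn.log (by fun_prop) ?_)
    intro g hg
    exact (mul_pos hN hg).ne'

theorem differentiableAt_fPair (D : Problem Q I) (q : Q) (i : I q) {g : ℝ} (hg : 0 < g) :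
    DifferentiableAt ℝ (fPair D q i) g :=
  ((contDiffOn_fPair D q i).differentiableOn (by norm_num)).differentiableAt (Ioi_mem_nhds hg)

theorem exists_bddLip_fPair (D : Problem Q I) {a : ℝ} (ha : 0 < a) (b : ℝ) :
    ∃ C, ∀ p : Σ q, I q, BddLip (Set.Icc a b) C (fPair D p.1 p.2) ∧
      BddLip (Set.Icc a b) C (deriv (fPair D p.1 p.2)) := by
  refine exists_forall_of_mono (fun p x y hxy hx => ⟨hx.1.mono hxy, hx.2.mono hxy⟩) fun p => ?_
  have hs : Set.Icc a b ⊆ Set.Ioi 0 := fun x hx => ha.trans_le hx.1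
  obtain ⟨C₁, h₁⟩ :=
    (((contDiffOn_fPair D p.1 p.2).of_le (by norm_num)).mono hs).exists_bddLip
  have h2 : ContDiffOn ℝ 1 (deriv (fPair D p.1 p.2)) (Set.Ioi 0) :=
    (contDiffOn_fPair D p.1 p.2).deriv_of_isOpen isOpen_Ioi (by norm_num)
  obtain ⟨C₂, h₂⟩ := (h2.mono hs).exists_bddLip
  exact ⟨max C₁ C₂, h₁.mono (le_max_left _ _), h₂.mono (le_max_right _ _)⟩

/-- The derivative of the outer function blows up at most quadratically at `0`. -/
theorem exists_abs_deriv_fPair_le (D : Problem Q I) (b : ℝ) :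
    ∃ C, ∀ p : Σ q, I q, ∀ g ∈ Set.Ioc 0 b, |deriv (fPair D p.1 p.2) g| ≤ C * (g⁻¹) ^ 2 := by
  refine exists_forall_of_mono (fun p x y hxy hx g hg => (hx g hg).trans
    (mul_le_mul_of_nonneg_right hxy (by positivity))) fun ⟨q, i⟩ => ?_
  have hN := D.card_pos q
  set N : ℝ := (Fintype.card (I q) : ℝ)
  obtain ⟨k, e | e⟩ := fPair_eq D q i
  · refine ⟨|k| * (N * ((N * b + 1) ^ 2 * (N⁻¹) ^ 2)), fun g hg => ?_⟩
    have hg0 : 0 < g := hg.1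
    have h1 : 0 < N * g := mul_pos hN hg0
    have hlog : N * g / (N * g + 1) ≤ Real.log (N * g + 1) := by
      have := Real.one_sub_inv_le_log_of_pos (x := N * g + 1) (by positivity)
      refine le_trans (le_of_eq ?_) this
      field_simp
      ring
    have hl0 : 0 < N * g / (N * g + 1) := by positivity
    have h2 : HasDerivAt (fun g => k * (Real.log (N * g + 1))⁻¹) _ g :=
      (((((hasDerivAt_id g).const_mul N).add_const 1).log (by simp only [id]; positivity)).inv
        (hl0.trans_le hlog).ne').const_mul k
    simp only [e]
    rw [h2.deriv, abs_mul, mul_assoc]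
    simp only [id, mul_one]
    refine mul_le_mul_of_nonneg_left ?_ (abs_nonneg k)
    rw [abs_div, abs_neg, abs_div, abs_of_pos hN, abs_of_pos (show 0 < N * g + 1 by positivity),
      abs_of_nonneg (sq_nonneg _), div_div]
    have h3 : N / ((N * g + 1) * Real.log (N * g + 1) ^ 2) ≤ N / (N * g / (N * g + 1)) ^ 2 := by
      refine div_le_div_of_nonneg_left hN.le (by positivity) ?_
      have := pow_le_pow_left₀ hl0.le hlog 2
      have h5 : 0 ≤ Real.log (N * g + 1) ^ 2 := by positivity
      nlinarith
    refine h3.trans ?_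
    have h4 : N / (N * g / (N * g + 1)) ^ 2 = N * ((N * g + 1) ^ 2 * (N⁻¹) ^ 2) * (g⁻¹) ^ 2 := by
      field_simp
    rw [h4]
    have h6 : N * g + 1 ≤ N * b + 1 := by
      have := mul_le_mul_of_nonneg_left hg.2 hN.le
      linarith
    gcongr
  · refine ⟨|k| * b, fun g hg => ?_⟩
    have hg0 : 0 < g := hg.1
    have h1 : 0 < N * g := mul_pos hN hg0
    have h2 : HasDerivAt (fun g => k * Real.log (N * g)) _ g :=
      (((hasDerivAt_id g).const_mul N).log h1.ne').const_mul k
    simp only [e]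
    rw [h2.deriv, abs_mul, mul_assoc]
    refine mul_le_mul_of_nonneg_left ?_ (abs_nonneg k)
    simp only [id, mul_one]
    have h3 : N / (N * g) = g⁻¹ := by field_simp
    rw [h3, abs_of_pos (by positivity), sq, ← mul_assoc]
    refine le_mul_of_one_le_left (by positivity) ?_
    rw [← div_eq_mul_inv, one_le_div hg0]
    exact hg.2

end

noncomputable section

variable {Q : Type*} {I : Q → Type*} [∀ q, Fintype (I q)] {D : Problem Q I} {d : ℕ}
  {h : Score I d} {Bh : ℝ} {Ch Lh Ph : ℝ≥0} [Fintype Q]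

/-! ### The objective and its gradient -/

theorem rankingLoss_eq (q : Q) (w : Param d) :
    rankingLoss D h q w = ∑ i, fPair D q i (gHat D h q i Finset.univ w) := by
  have hN := (D.card_pos q).ne'
  have h1 : ∀ i, (Fintype.card (I q) : ℝ) * gHat D h q i Finset.univ w =
      surrogateRank D h q i w := by
    intro i
    rw [gHat, surrogateRank, Finset.card_univ]
    field_simp
  unfold rankingLoss fPair
  simp only [h1]
  cases D.loss with
  | ndcg ℓ Z =>
    simp only
    rw [← mul_neg, ← Finset.sum_neg_distrib, Finset.mul_sum]
    refine Finset.sum_congr rfl fun i _ => ?_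
    rw [add_comm (1 : ℝ), ← neg_div, neg_sub]
  | listNet => rfl

theorem fairnessLoss_eq (q : Q) (w : Param d) (l : ℝ) :
    fairnessLoss D h q w l = fQuery I q (groupHat D h q (D.Sa q) w l)
      (groupHat D h q (D.Sb q) w l) (expHat h q Finset.univ w) := by
  have hN := (D.card_pos q).ne'
  have h1 : (Fintype.card (I q) : ℝ) * expHat h q Finset.univ w = ∑ i, Real.exp (h q i w) := by
    rw [expHat, Finset.card_univ]
    field_simp
  rw [fairnessLoss, fQuery, h1]
  simp only [exposure, groupHat, ← mul_div_assoc, ← Finset.sum_div]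
  rw [← sub_div]

/-- The batches that consist of all items and both groups. -/
def fullBatch (D : Problem Q I) (q : Q) : Finset (I q) × Finset (I q) × Finset (I q) :=
  (Finset.univ, D.Sa q, D.Sb q)

/-- The direction of the algorithm with batch averages replaced by full averages, for given
estimates `u`, `ua`, `ub`, `uq`, `s`, `lam`. -/
def fullDir (D : Problem Q I) (h : Score I d) (w : Param d) (u : (q : Q) → I q → ℝ)
    (ua ub uq s l : Q → ℝ) : Param d :=
  (1 / (Fintype.card (Σ q, I q) : ℝ)) • ∑ p : Σ q, I q,
      deriv (fPair D p.1 p.2) (u p.1 p.2) • gradGHat D h p.1 p.2 Finset.univ w +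
    D.C • ((1 / (Fintype.card Q : ℝ)) • ∑ q,
      queryDir D h q (fullBatch D q) w (ua q) (ub q) (uq q) (s q) (l q))

theorem hasGradientAt_fQuery {a b c : Param d → ℝ} {a' b' c' w : Param d} (q : Q)
    (ha : HasGradientAt a a' w) (hb : HasGradientAt b b' w) (hc : HasGradientAt c c' w)
    (hc0 : c w ≠ 0) : HasGradientAt (fun w => fQuery I q (a w) (b w) (c w))
      (deriv (fun x => fQuery I q x (b w) (c w)) (a w) • a' +
        deriv (fun x => fQuery I q (a w) x (c w)) (b w) • b' +
        deriv (fun x => fQuery I q (a w) (b w) x) (c w) • c') w := by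
  have h1 : HasGradientAt
      (fun w => (a w - b w) * ((Fintype.card (I q) : ℝ)⁻¹ * (c w)⁻¹)) _ w :=
    (ha.sub hb).mul (((hasDerivAt_inv hc0).comp_hasGradientAt hc).const_mul _)
  have h2 := (h1.mul h1).const_mul (1 / 2)
  have e : (fun w => fQuery I q (a w) (b w) (c w)) = fun w => (1 / 2) *
      ((a w - b w) * ((Fintype.card (I q) : ℝ)⁻¹ * (c w)⁻¹) *
        ((a w - b w) * ((Fintype.card (I q) : ℝ)⁻¹ * (c w)⁻¹))) := by
    funext w
    simp only [fQuery, div_eq_mul_inv, mul_inv]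
    ring
  rw [e]
  convert h2 using 1
  rw [deriv_fQuery_fst, deriv_fQuery_snd, deriv_fQuery_thd q _ _ hc0]
  rw [← inv_pow]
  module

theorem expHat_univ_ge (D : Problem Q I) (hA : ScoreAssumption h Bh Ch Lh Ph) (q : Q)
    (w : Param d) : Real.exp (-|Bh|) ≤ expHat h q Finset.univ w := by
  have := D.nonempty_items q
  exact expHat_ge hA q Finset.univ_nonempty w

/-- The full direction at the values that the estimates track. This is the gradient of the
objective. -/
def trueDir (D : Problem Q I) (h : Score I d) (w : Param d) : Param d :=
  fullDir D h w (fun q i => gHat D h q i Finset.univ w) (fun q => groupTarget D h q (D.Sa q) w)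
    (fun q => groupTarget D h q (D.Sb q) w) (fun q => expHat h q Finset.univ w)
    (fun q => curvTarget D h q w) (fun q => lamHat D h q w)

theorem hasGradientAt_fairnessLoss (hA : ScoreAssumption h Bh Ch Lh Ph) (q : Q) (w : Param d) :
    HasGradientAt (fun w => fairnessLoss D h q w (lamHat D h q w))
      (queryDir D h q (fullBatch D q) w (groupTarget D h q (D.Sa q) w)
        (groupTarget D h q (D.Sb q) w) (expHat h q Finset.univ w) (curvTarget D h q w)
        (lamHat D h q w)) w := by
  simp only [fairnessLoss_eq]
  have hl := hasGradientAt_lamHat D hA q w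
  exact hasGradientAt_fQuery q (hasGradientAt_groupHat hA q (D.Sa q) hl)
    (hasGradientAt_groupHat hA q (D.Sb q) hl) (hasGradientAt_expHat hA q Finset.univ w)
    ((Real.exp_pos _).trans_le (expHat_univ_ge D hA q w)).ne'

/-- The chain rule for the objective; the dependence of the lower-level solution on `w` enters
through `hasGradientAt_lamHat`. -/
theorem hasGradientAt_objective [Nonempty Q] (hA : ScoreAssumption h Bh Ch Lh Ph) (w : Param d) :
    HasGradientAt (objective D h) (trueDir D h w) w := by
  have h1 : ∀ p : Σ q, I q, HasGradientAt
      (fun w => fPair D p.1 p.2 (gHat D h p.1 p.2 Finset.univ w))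
      (deriv (fPair D p.1 p.2) (gHat D h p.1 p.2 Finset.univ w) •
        gradGHat D h p.1 p.2 Finset.univ w) w := fun p =>
    (differentiableAt_fPair D p.1 p.2
      (rankBound_pos.trans_le (rankBound_le p.1 p.2 w))).hasDerivAt.comp_hasGradientAt
      (hasGradientAt_gHat hA p.1 p.2 _ w)
  have h2 := ((HasGradientAt.sum fun p (_ : p ∈ Finset.univ) => h1 p).const_mul
    (1 / (Fintype.card (Σ q, I q) : ℝ))).add
    ((HasGradientAt.sum fun q (_ : q ∈ Finset.univ) =>
      hasGradientAt_fairnessLoss (D := D) hA q w).const_mul (D.C / (Fintype.card Q : ℝ)))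
  have e : objective D h = fun w => (1 / (Fintype.card (Σ q, I q) : ℝ)) *
      ∑ p : Σ q, I q, fPair D p.1 p.2 (gHat D h p.1 p.2 Finset.univ w) +
      D.C / (Fintype.card Q : ℝ) * ∑ q, fairnessLoss D h q w (lamHat D h q w) := by
    funext w
    simp only [objective, rankingLoss_eq, Fintype.sum_sigma]
  rw [e]
  convert h2 using 1
  rw [trueDir, fullDir, smul_smul, mul_one_div]

theorem gradient_objective [Nonempty Q] (hA : ScoreAssumption h Bh Ch Lh Ph) (w : Param d) :
    gradient (objective D h) w = trueDir D h w := (hasGradientAt_objective hA w).gradient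

theorem exists_tame_fairnessLoss (D : Problem Q I) (Bh : ℝ) (Ch Lh Ph : ℝ≥0) :
    ∃ M, ∀ {d : ℕ} {h : Score I d}, ScoreAssumption h Bh Ch Lh Ph →
      ∀ q, Tame M (fun w => fairnessLoss D h q w (lamHat D h q w)) := by
  obtain ⟨M₁, h₁⟩ := exists_tame_groupTarget D Bh Ch Lh Ph
  obtain ⟨M₂, h₂⟩ := exists_tame_expHat Bh Ch Lh Ph D
  obtain ⟨M₃, h₃⟩ := exists_tame_curvTarget D Bh Ch Lh Ph
  obtain ⟨M₄, h₄⟩ := exists_tame_lamHat D Bh Ch Lh Ph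
  set L := max (max M₁ M₂) (max M₃ M₄)
  have hρ : 0 < min (Real.exp (-|Bh|)) D.τ₂ := lt_min (Real.exp_pos _) D.τ₂_pos
  obtain ⟨C₁, hC₁⟩ := exists_bddLip_queryDir D Bh Ch Lh Ph L hρ
  obtain ⟨C₂, hC₂⟩ := exists_bddLip_inv (Real.exp_pos (-|Bh|)) M₂
  apply Exists.intro
  intro d h hA q
  have hN : ‖(Fintype.card (I q) : ℝ)⁻¹‖ ≤ 1 := by
    rw [norm_inv, Real.norm_of_nonneg (D.card_pos q).le]
    have := D.nonempty_items q
    exact inv_le_one_of_one_le₀ (by exact_mod_cast Fintype.card_pos (α := I q))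
  have ha := (h₁ hA q (D.Sa q))
  have hb := (h₁ hA q (D.Sb q))
  have hc := (h₂ hA q Finset.univ)
  have hr := ((ha.val.sub hb.val).mul ((BddLip.const hN).mul
    (hC₂ hc.val fun w _ => expHat_univ_ge D hA q w)))
  have hv := (hr.mul hr).const_mul (1 / 2)
  have hv' := hv.congr (g := fun w => fairnessLoss D h q w (lamHat D h q w)) fun w _ => by
    simp only [fairnessLoss_eq, fQuery, div_eq_mul_inv, mul_inv, groupTarget]
    ring
  refine .of_hasGradientAt (hasGradientAt_fairnessLoss hA q) hv' (hC₁ hA .id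
    (ha.val.mono ?_) (hb.val.mono ?_) (hc.val.mono ?_) ((h₃ hA q).val.mono ?_)
    ((h₄ hA q).val.mono ?_) (fun w _ => (min_le_left _ _).trans (expHat_univ_ge D hA q w))
    (fun w _ => (min_le_right _ _).trans (curvTarget_mem q w).1) q (fullBatch D q))
  all_goals simp [L]

theorem exists_tame_objective [Nonempty Q] (D : Problem Q I) (Bh : ℝ) (Ch Lh Ph : ℝ≥0) :
    ∃ M, ∀ {d : ℕ} {h : Score I d}, ScoreAssumption h Bh Ch Lh Ph →
      Tame M (objective D h) := by
  obtain ⟨M₁, h₁⟩ := exists_tame_gHat D Bh Ch Lh Ph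
  obtain ⟨M₂, h₂⟩ := exists_tame_fairnessLoss D Bh Ch Lh Ph
  obtain ⟨C, hC⟩ := exists_bddLip_fPair D (rankBound_pos (D := D)) M₁
  apply Exists.intro
  intro d h hA
  unfold objective
  simp only [rankingLoss_eq]
  exact .add (.const_mul _ (.sum fun q _ => .sum fun i _ => .comp
    (fun x hx => differentiableAt_fPair D q i (rankBound_pos.trans_le hx.1)) (hC ⟨q, i⟩).1
    (hC ⟨q, i⟩).2 (h₁ hA q i Finset.univ) fun w => ⟨rankBound_le q i w,
      (le_abs_self _).trans ((h₁ hA q i Finset.univ).abs_le w)⟩))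
    (.const_mul _ (.sum fun q _ => h₂ hA q))

end

noncomputable section

/-! ### Expectations over the batches of one iteration -/

theorem integral_average_of_isUnbiasedSampling {α E : Type*} [Fintype α] [DecidableEq α]
    [NormedAddCommGroup E] [NormedSpace ℝ E] [CompleteSpace E] {p : PMF (Finset α)} {S : Finset α}
    (hp : IsUnbiasedSampling p S) (f : α → E) :
    ∫ B, (1 / (B.card : ℝ)) • ∑ i ∈ B, f i ∂p.toMeasure = (1 / (S.card : ℝ)) • ∑ i ∈ S, f i := by
  rw [PMF.integral_eq_sum]
  have h1 : ∀ B : Finset α, (p B).toReal • ((1 / (B.card : ℝ)) • ∑ i ∈ B, f i) =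
      ∑ i ∈ S, ((p B).toReal * (if i ∈ B then 1 / (B.card : ℝ) else 0)) • f i := by
    intro B
    by_cases hB : B ∈ p.support
    · have h2 : ∑ i ∈ B, f i = ∑ i ∈ S, if i ∈ B then f i else 0 := by
        rw [← Finset.sum_filter, Finset.filter_mem_eq_inter,
          Finset.inter_eq_right.2 (hp.support B hB).2]
      rw [h2, Finset.smul_sum, Finset.smul_sum]
      refine Finset.sum_congr rfl fun i _ => ?_
      split_ifs <;> simp [smul_smul]
    · rw [PMF.mem_support_iff, not_not] at hB
      simp [hB]
  simp only [h1]
  rw [Finset.sum_comm, Finset.smul_sum]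
  refine Finset.sum_congr rfl fun i hi => ?_
  rw [← Finset.sum_smul, hp.unbiased i hi]

variable {Q : Type*} {I : Q → Type*} [Fintype Q] [∀ q, Fintype (I q)]

instance (p : SamplingLaws Q I) : IsProbabilityMeasure p.law := by
  unfold SamplingLaws.law
  infer_instance

theorem SamplingLaws.integrable_law {E : Type*} [NormedAddCommGroup E] (p : SamplingLaws Q I)
    (f : Batch Q I → E) : Integrable f p.law := Integrable.of_finite

/-- The law of the batches of items, of minority items and of majority items of a query. -/
def SamplingLaws.queryLaw (p : SamplingLaws Q I) (q : Q) :
    Measure (Finset (I q) × Finset (I q) × Finset (I q)) :=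
  (p.items q).toMeasure.prod ((p.minority q).toMeasure.prod (p.majority q).toMeasure)

instance (p : SamplingLaws Q I) (q : Q) : IsProbabilityMeasure (p.queryLaw q) := by
  unfold SamplingLaws.queryLaw
  infer_instance

variable {E : Type*} [NormedAddCommGroup E] [NormedSpace ℝ E] [CompleteSpace E]

theorem SamplingLaws.integral_law_smul (p : SamplingLaws Q I) (q : Q) (f : Finset (Σ q, I q) → ℝ)
    (g : Finset (I q) × Finset (I q) × Finset (I q) → E) :
    ∫ b, f b.1 • g (b.2 q) ∂p.law =
      (∫ B, f B ∂p.pairs.toMeasure) • ∫ β, g β ∂p.queryLaw q := by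
  have h1 := integral_prod_smul (μ := p.pairs.toMeasure)
    (ν := Measure.pi fun q => p.queryLaw q) f
    (fun x : (q : Q) → Finset (I q) × Finset (I q) × Finset (I q) => g (x q))
  have h2 := integral_comp_eval (μ := fun q => p.queryLaw q) (i := q) (f := g)
    (Integrable.of_finite.aestronglyMeasurable)
  rw [h2] at h1
  exact h1

theorem SamplingLaws.integral_queryLaw_items (p : SamplingLaws Q I) (q : Q)
    (f : Finset (I q) → E) :
    ∫ β, f β.1 ∂p.queryLaw q = ∫ B, f B ∂(p.items q).toMeasure := by
  unfold SamplingLaws.queryLaw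
  rw [integral_fun_fst]
  simp

theorem SamplingLaws.integral_queryLaw_smul_minority (p : SamplingLaws Q I) (q : Q)
    (f : Finset (I q) → ℝ) (g : Finset (I q) → E) :
    ∫ β, f β.2.1 • g β.1 ∂p.queryLaw q =
      (∫ B, f B ∂(p.minority q).toMeasure) • ∫ B, g B ∂(p.items q).toMeasure := by
  unfold SamplingLaws.queryLaw
  rw [integral_prod _ Integrable.of_finite]
  simp only [integral_smul_const]
  have : ∀ x : Finset (I q), ∫ a, f a.1 ∂((p.minority q).toMeasure.prod
    (p.majority q).toMeasure) = ∫ B, f B ∂(p.minority q).toMeasure := fun x => by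
    rw [integral_fun_fst]
    simp
  rw [this ∅, integral_smul]

theorem SamplingLaws.integral_queryLaw_smul_majority (p : SamplingLaws Q I) (q : Q)
    (f : Finset (I q) → ℝ) (g : Finset (I q) → E) :
    ∫ β, f β.2.2 • g β.1 ∂p.queryLaw q =
      (∫ B, f B ∂(p.majority q).toMeasure) • ∫ B, g B ∂(p.items q).toMeasure := by
  unfold SamplingLaws.queryLaw
  rw [integral_prod _ Integrable.of_finite]
  simp only [integral_smul_const]
  have : ∀ x : Finset (I q), ∫ a, f a.2 ∂((p.minority q).toMeasure.prod
    (p.majority q).toMeasure) = ∫ B, f B ∂(p.majority q).toMeasure := fun x => by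
    rw [integral_fun_snd]
    simp
  rw [this ∅, integral_smul]

theorem SamplingLaws.integral_queryLaw_minority (p : SamplingLaws Q I) (q : Q)
    (f : Finset (I q) → E) :
    ∫ β, f β.2.1 ∂p.queryLaw q = ∫ B, f B ∂(p.minority q).toMeasure := by
  unfold SamplingLaws.queryLaw
  rw [integral_fun_snd (f := fun x : Finset (I q) × Finset (I q) => f x.1), integral_fun_fst]
  simp

theorem SamplingLaws.integral_queryLaw_majority (p : SamplingLaws Q I) (q : Q)
    (f : Finset (I q) → E) :
    ∫ β, f β.2.2 ∂p.queryLaw q = ∫ B, f B ∂(p.majority q).toMeasure := by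
  unfold SamplingLaws.queryLaw
  rw [integral_fun_snd (f := fun x : Finset (I q) × Finset (I q) => f x.2), integral_fun_snd]
  simp

variable [DecidableEq Q] [∀ q, DecidableEq (I q)] {D : Problem Q I} {p : SamplingLaws Q I}

/-- The probability that a pair is sampled. -/
def SamplingLaws.pairProb (p : SamplingLaws Q I) (x : Σ q, I q) : ℝ :=
  ∫ B, (if x ∈ B then 1 else 0) ∂p.pairs.toMeasure

/-- The probability that a query is sampled. -/
def SamplingLaws.queryProb (p : SamplingLaws Q I) (q : Q) : ℝ :=
  ∫ B, (if q ∈ queriesOf B then 1 else 0) ∂p.pairs.toMeasure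

theorem inv_le_integral_indicator {α : Type*} [Fintype α] [DecidableEq α] (p : PMF (Finset α))
    {P : Finset α → Prop} [DecidablePred P] {c : Finset α → ℕ} {r : ℝ}
    (h : ∑ B, (p B).toReal * (if P B then 1 / (c B : ℝ) else 0) = r) :
    r ≤ ∫ B, (if P B then 1 else 0) ∂p.toMeasure := by
  rw [PMF.integral_eq_sum, ← h]
  refine Finset.sum_le_sum fun B _ => ?_
  rw [smul_eq_mul]
  refine mul_le_mul_of_nonneg_left ?_ ENNReal.toReal_nonneg
  split_ifs
  · rcases Nat.eq_zero_or_pos (c B) with h0 | h0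
    · simp [h0]
    · rw [div_le_one (by exact_mod_cast h0)]
      exact_mod_cast h0
  · exact le_rfl

theorem integral_indicator_le_one {α : Type*} [Finite α] (p : PMF (Finset α))
    {P : Finset α → Prop} [DecidablePred P] :
    ∫ B, (if P B then (1 : ℝ) else 0) ∂p.toMeasure ≤ 1 := by
  have h1 : ∫ B, (if P B then (1 : ℝ) else 0) ∂p.toMeasure ≤ ∫ _, (1 : ℝ) ∂p.toMeasure :=
    integral_mono Integrable.of_finite Integrable.of_finite fun B => by
      simp only
      split_ifs <;> simp
  simpa using h1

theorem SamplingLaws.Unbiased.pairProb_mem (hp : p.Unbiased D) (x : Σ q, I q) :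
    p.pairProb x ∈ Set.Icc (1 / (Fintype.card (Σ q, I q) : ℝ)) 1 :=
  ⟨inv_le_integral_indicator _ (hp.pairs.unbiased x (Finset.mem_univ x)),
    integral_indicator_le_one _⟩

theorem SamplingLaws.Unbiased.queryProb_mem (hp : p.Unbiased D) (q : Q) :
    p.queryProb q ∈ Set.Icc (1 / (Fintype.card Q : ℝ)) 1 :=
  ⟨inv_le_integral_indicator _ (hp.queries q), integral_indicator_le_one _⟩

theorem SamplingLaws.integral_law_pair (p : SamplingLaws Q I) (q : Q) (i : I q)
    (g : Finset (I q) × Finset (I q) × Finset (I q) → E) :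
    ∫ b, (if (⟨q, i⟩ : Σ q, I q) ∈ b.1 then g (b.2 q) else 0) ∂p.law =
      p.pairProb ⟨q, i⟩ • ∫ β, g β ∂p.queryLaw q := by
  rw [pairProb, ← p.integral_law_smul q]
  simp only [ite_smul, one_smul, zero_smul]

theorem SamplingLaws.integral_law_query (p : SamplingLaws Q I) (q : Q)
    (g : Finset (I q) × Finset (I q) × Finset (I q) → E) :
    ∫ b, (if q ∈ queriesOf b.1 then g (b.2 q) else 0) ∂p.law =
      p.queryProb q • ∫ β, g β ∂p.queryLaw q := by
  rw [queryProb, ← p.integral_law_smul q]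
  simp only [ite_smul, one_smul, zero_smul]

theorem SamplingLaws.Unbiased.integral_law_average_pairs (hp : p.Unbiased D)
    (g : (x : Σ q, I q) → Finset (I x.1) × Finset (I x.1) × Finset (I x.1) → E) :
    ∫ b, (1 / (b.1.card : ℝ)) • ∑ x ∈ b.1, g x (b.2 x.1) ∂p.law =
      (1 / (Fintype.card (Σ q, I q) : ℝ)) • ∑ x, ∫ β, g x β ∂p.queryLaw x.1 := by
  have h1 : ∀ b : Batch Q I, (1 / (b.1.card : ℝ)) • ∑ x ∈ b.1, g x (b.2 x.1) =
      ∑ x, (if x ∈ b.1 then 1 / (b.1.card : ℝ) else 0) • g x (b.2 x.1) := by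
    intro b
    simp only [ite_smul, zero_smul]
    rw [Finset.sum_ite_mem, Finset.univ_inter, Finset.smul_sum]
  simp only [h1]
  rw [integral_finsetSum _ fun x _ => p.integrable_law _, Finset.smul_sum]
  refine Finset.sum_congr rfl fun x _ => ?_
  rw [p.integral_law_smul x.1 (fun B => if x ∈ B then 1 / (B.card : ℝ) else 0),
    PMF.integral_eq_sum]
  congr 1
  exact hp.pairs.unbiased x (Finset.mem_univ x)

theorem SamplingLaws.Unbiased.integral_law_average_queries (hp : p.Unbiased D)
    (g : (q : Q) → Finset (I q) × Finset (I q) × Finset (I q) → E) :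
    ∫ b, (1 / ((queriesOf b.1).card : ℝ)) • ∑ q ∈ queriesOf b.1, g q (b.2 q) ∂p.law =
      (1 / (Fintype.card Q : ℝ)) • ∑ q, ∫ β, g q β ∂p.queryLaw q := by
  have h1 : ∀ b : Batch Q I,
      (1 / ((queriesOf b.1).card : ℝ)) • ∑ q ∈ queriesOf b.1, g q (b.2 q) =
      ∑ q, (if q ∈ queriesOf b.1 then 1 / ((queriesOf b.1).card : ℝ) else 0) • g q (b.2 q) := by
    intro b
    simp only [ite_smul, zero_smul]
    rw [Finset.sum_ite_mem, Finset.univ_inter, Finset.smul_sum]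
  simp only [h1]
  rw [integral_finsetSum _ fun x _ => p.integrable_law _, Finset.smul_sum]
  refine Finset.sum_congr rfl fun q _ => ?_
  rw [p.integral_law_smul q
    (fun B => if q ∈ queriesOf B then 1 / ((queriesOf B).card : ℝ) else 0), PMF.integral_eq_sum]
  congr 1
  exact hp.queries q

/-! ### The mini-batch estimators are unbiased -/

variable {d : ℕ} {h : Score I d}

theorem SamplingLaws.Unbiased.integral_gHat (hp : p.Unbiased D) (q : Q) (i : I q) (w : Param d) :
    ∫ β, gHat D h q i β.1 w ∂p.queryLaw q = gHat D h q i Finset.univ w := by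
  rw [p.integral_queryLaw_items q fun B => gHat D h q i B w]
  exact integral_average_of_isUnbiasedSampling (hp.items q) _

theorem SamplingLaws.Unbiased.integral_gradGHat (hp : p.Unbiased D) (q : Q) (i : I q)
    (w : Param d) :
    ∫ β, gradGHat D h q i β.1 w ∂p.queryLaw q = gradGHat D h q i Finset.univ w := by
  rw [p.integral_queryLaw_items q fun B => gradGHat D h q i B w]
  exact integral_average_of_isUnbiasedSampling (hp.items q) _

theorem SamplingLaws.Unbiased.integral_expHat (hp : p.Unbiased D) (q : Q) (w : Param d) :
    ∫ β, expHat h q β.1 w ∂p.queryLaw q = expHat h q Finset.univ w := by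
  rw [p.integral_queryLaw_items q fun B => expHat h q B w]
  exact integral_average_of_isUnbiasedSampling (hp.items q) _

theorem SamplingLaws.Unbiased.integral_gradExpHat (hp : p.Unbiased D) (q : Q) (w : Param d) :
    ∫ β, gradExpHat h q β.1 w ∂p.queryLaw q = gradExpHat h q Finset.univ w := by
  rw [p.integral_queryLaw_items q fun B => gradExpHat h q B w]
  exact integral_average_of_isUnbiasedSampling (hp.items q) _

theorem SamplingLaws.Unbiased.integral_groupHat_minority (hp : p.Unbiased D) (q : Q) (w : Param d)
    (l : ℝ) : ∫ β, groupHat D h q β.2.1 w l ∂p.queryLaw q = groupHat D h q (D.Sa q) w l := by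
  rw [p.integral_queryLaw_minority q fun B => groupHat D h q B w l]
  exact integral_average_of_isUnbiasedSampling (hp.minority q) _

theorem SamplingLaws.Unbiased.integral_groupHat_majority (hp : p.Unbiased D) (q : Q) (w : Param d)
    (l : ℝ) : ∫ β, groupHat D h q β.2.2 w l ∂p.queryLaw q = groupHat D h q (D.Sb q) w l := by
  rw [p.integral_queryLaw_majority q fun B => groupHat D h q B w l]
  exact integral_average_of_isUnbiasedSampling (hp.majority q) _

theorem SamplingLaws.Unbiased.integral_deriv_lowerBatch (hp : p.Unbiased D) (q : Q) (w : Param d)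
    (l : ℝ) : ∫ β, deriv (lowerBatch D h q β.1 w) l ∂p.queryLaw q =
      deriv (lowerBatch D h q Finset.univ w) l := by
  rw [p.integral_queryLaw_items q fun B => deriv (lowerBatch D h q B w) l]
  simp only [deriv_lowerBatch]
  rw [integral_sub Integrable.of_finite Integrable.of_finite]
  simp only [← smul_eq_mul (1 / ((Finset.card _ : ℕ) : ℝ))]
  rw [integral_average_of_isUnbiasedSampling (hp.items q)]
  simp

theorem SamplingLaws.Unbiased.integral_deriv_deriv_lowerBatch (hp : p.Unbiased D) (q : Q)
    (w : Param d) (l : ℝ) : ∫ β, deriv (deriv (lowerBatch D h q β.1 w)) l ∂p.queryLaw q =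
      deriv (deriv (lowerBatch D h q Finset.univ w)) l := by
  rw [p.integral_queryLaw_items q fun B => deriv (deriv (lowerBatch D h q B w)) l]
  simp only [deriv_deriv_lowerBatch]
  rw [integral_add Integrable.of_finite Integrable.of_finite]
  simp only [← smul_eq_mul (1 / ((Finset.card _ : ℕ) : ℝ))]
  rw [integral_average_of_isUnbiasedSampling (hp.items q)]
  simp

variable {Bh : ℝ} {Ch Lh Ph : ℝ≥0}

theorem SamplingLaws.Unbiased.integral_gradLam (hp : p.Unbiased D)
    (hA : ScoreAssumption h Bh Ch Lh Ph) (q : Q) (w : Param d) (l s : ℝ) :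
    ∫ B, gradLam D h q B w l s ∂(p.items q).toMeasure = gradLam D h q Finset.univ w l s := by
  simp only [gradLam, (hasGradientAt_deriv_lowerBatch D hA q _ w l).gradient]
  rw [integral_neg, integral_smul, integral_neg,
    integral_average_of_isUnbiasedSampling (hp.items q)]

theorem gradGroupHat_eq (q : Q) (B : Finset (I q)) (w : Param d) (l : ℝ) (dl : Param d) :
    gradGroupHat D h q B w l dl = gradGroupHat D h q B w l 0 -
      ((1 / (B.card : ℝ)) • ∑ i ∈ B, deriv D.ψ (h q i w - l) * Real.exp (h q i w)) • dl := by
  simp only [gradGroupHat, sub_zero, smul_sub, Finset.sum_sub_distrib, smul_assoc,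
    Finset.sum_smul]
  abel

theorem integral_gradGroupHat_zero {q : Q} {pr : PMF (Finset (I q))} {S : Finset (I q)}
    (hp : IsUnbiasedSampling pr S) (w : Param d) (l : ℝ) :
    ∫ B, gradGroupHat D h q B w l 0 ∂pr.toMeasure = gradGroupHat D h q S w l 0 := by
  unfold gradGroupHat
  rw [integral_add Integrable.of_finite Integrable.of_finite,
    integral_average_of_isUnbiasedSampling hp, integral_average_of_isUnbiasedSampling hp]

theorem SamplingLaws.Unbiased.integral_queryDir (hp : p.Unbiased D)
    (hA : ScoreAssumption h Bh Ch Lh Ph) (q : Q) (w : Param d) (ua ub uq s l : ℝ) :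
    ∫ β, queryDir D h q β w ua ub uq s l ∂p.queryLaw q =
      queryDir D h q (fullBatch D q) w ua ub uq s l := by
  have ha : ∫ β, gradGroupHat D h q β.2.1 w l (gradLam D h q β.1 w l s) ∂p.queryLaw q =
      gradGroupHat D h q (D.Sa q) w l (gradLam D h q Finset.univ w l s) := by
    have e : ∀ B B', gradGroupHat D h q B w l (gradLam D h q B' w l s) = _ :=
      fun B B' => gradGroupHat_eq q B w l (gradLam D h q B' w l s)
    simp only [e]
    rw [integral_sub Integrable.of_finite Integrable.of_finite,
      p.integral_queryLaw_minority q fun B => gradGroupHat D h q B w l 0,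
      integral_gradGroupHat_zero (hp.minority q),
      p.integral_queryLaw_smul_minority q
        (fun B => (1 / (B.card : ℝ)) • ∑ i ∈ B, deriv D.ψ (h q i w - l) * Real.exp (h q i w))
        (fun B => gradLam D h q B w l s), hp.integral_gradLam hA,
      integral_average_of_isUnbiasedSampling (hp.minority q)]
  have hb : ∫ β, gradGroupHat D h q β.2.2 w l (gradLam D h q β.1 w l s) ∂p.queryLaw q =
      gradGroupHat D h q (D.Sb q) w l (gradLam D h q Finset.univ w l s) := by
    have e : ∀ B B', gradGroupHat D h q B w l (gradLam D h q B' w l s) = _ :=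
      fun B B' => gradGroupHat_eq q B w l (gradLam D h q B' w l s)
    simp only [e]
    rw [integral_sub Integrable.of_finite Integrable.of_finite,
      p.integral_queryLaw_majority q fun B => gradGroupHat D h q B w l 0,
      integral_gradGroupHat_zero (hp.majority q),
      p.integral_queryLaw_smul_majority q
        (fun B => (1 / (B.card : ℝ)) • ∑ i ∈ B, deriv D.ψ (h q i w - l) * Real.exp (h q i w))
        (fun B => gradLam D h q B w l s), hp.integral_gradLam hA,
      integral_average_of_isUnbiasedSampling (hp.majority q)]
  simp only [queryDir, fullBatch]
  rw [integral_add Integrable.of_finite Integrable.of_finite,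
    integral_add Integrable.of_finite Integrable.of_finite, integral_smul, integral_smul,
    integral_smul, ha, hb, hp.integral_gradExpHat]

/-- The stochastic direction of the algorithm. -/
def dir (D : Problem Q I) (h : Score I d) (b : Batch Q I) (σ : State I d) : Param d :=
  G₁ D h b σ + D.C • G₂ D h b σ

/-- The stochastic direction is unbiased for the full direction at the same estimates. It need not
be unbiased for the gradient of the objective. -/
theorem SamplingLaws.Unbiased.integral_dir (hp : p.Unbiased D)
    (hA : ScoreAssumption h Bh Ch Lh Ph) (σ : State I d) :
    ∫ b, dir D h b σ ∂p.law = fullDir D h σ.w σ.u σ.ua σ.ub σ.uq σ.s σ.lam := by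
  unfold dir fullDir
  rw [integral_add (p.integrable_law _) (p.integrable_law _), integral_smul]
  congr 1
  · unfold G₁
    rw [hp.integral_law_average_pairs fun x β =>
      deriv (fPair D x.1 x.2) (σ.u x.1 x.2) • gradGHat D h x.1 x.2 β.1 σ.w]
    simp only [integral_smul, hp.integral_gradGHat]
  · have e : ∀ b, G₂ D h b σ = (1 / ((queriesOf b.1).card : ℝ)) • ∑ q ∈ queriesOf b.1,
        queryDir D h q (b.2 q) σ.w (σ.ua q) (σ.ub q) (σ.uq q) (σ.s q) (σ.lam q) := fun b => rfl
    simp only [e]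
    rw [hp.integral_law_average_queries fun q β =>
      queryDir D h q β σ.w (σ.ua q) (σ.ub q) (σ.uq q) (σ.s q) (σ.lam q)]
    simp only [hp.integral_queryDir hA]

end

noncomputable section

/-! ### The inverse fourth moment of the rank estimates -/

/-- The excess of `u⁻⁴` over its value at `r`. It controls the derivatives of the outer functions of
the ranking loss, which are unbounded near `0`. -/
def excess (r u : ℝ) : ℝ := max ((u⁻¹) ^ 4 - (r⁻¹) ^ 4) 0

theorem excess_nonneg (r u : ℝ) : 0 ≤ excess r u := le_max_right _ _

theorem inv_pow_le_excess (r u : ℝ) : (u⁻¹) ^ 4 ≤ excess r u + (r⁻¹) ^ 4 := by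
  have := le_max_left ((u⁻¹) ^ 4 - (r⁻¹) ^ 4) 0
  rw [excess]
  linarith

theorem excess_eq_zero {r u : ℝ} (hr : 0 < r) (h : r ≤ u) : excess r u = 0 :=
  max_eq_right (sub_nonpos.2 (pow_le_pow_left₀ (by have := hr.trans_le h; positivity)
    (inv_anti₀ hr h) 4))

theorem excess_eq {r u : ℝ} (hu : 0 < u) (h : u ≤ r) :
    excess r u = (u⁻¹) ^ 4 - (r⁻¹) ^ 4 :=
  max_eq_left (sub_nonneg.2 (pow_le_pow_left₀ (by have := hu.trans_le h; positivity)
    (inv_anti₀ hu h) 4))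

theorem one_sub_four_mul_le_pow {γ : ℝ} (h1 : γ ≤ 1) : 1 - 4 * γ ≤ (1 - γ) ^ 4 := by
  have := one_add_mul_le_pow (a := -γ) (by linarith) 4
  push_cast at this
  linarith

/-- A step of the moving average with a non-negative input increases `u⁻⁴` by at most a factor
`1 + 8 γ`. -/
theorem inv_step_pow_le {u γ x : ℝ} (hu : 0 < u) (h0 : 0 ≤ γ) (h1 : γ ≤ 1 / 8) (hx : 0 ≤ x) :
    (((1 - γ) * u + γ * x)⁻¹) ^ 4 ≤ (1 + 8 * γ) * (u⁻¹) ^ 4 := by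
  have hγ : 0 < 1 - γ := by linarith
  have h2 : (((1 - γ) * u + γ * x)⁻¹) ^ 4 ≤ (((1 - γ) * u)⁻¹) ^ 4 := by
    refine pow_le_pow_left₀ (by positivity) (inv_anti₀ (by positivity) ?_) 4
    nlinarith
  refine h2.trans ?_
  rw [mul_inv, mul_pow]
  refine mul_le_mul_of_nonneg_right ?_ (by positivity)
  rw [inv_pow]
  have h3 := one_sub_four_mul_le_pow (γ := γ) (by linarith)
  refine (inv_anti₀ (by linarith) h3).trans ?_
  rw [inv_le_iff_one_le_mul₀ (by linarith)]
  nlinarith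

/-- Below half the threshold, a step of the moving average with input `x` decreases `u⁻⁴` by a
factor that is affine in `x`, so that the mean of the input decides. -/
theorem inv_step_pow_le_affine {u r γ x M : ℝ} (hu : 0 < u) (hr : u ≤ r / 2) (h0 : 0 ≤ γ)
    (h1 : γ ≤ 1 / 8) (hx : 0 ≤ x) (hxM : x ≤ M) (hM : γ * M ≤ r / 2) :
    (((1 - γ) * u + γ * x)⁻¹) ^ 4 ≤ ((1 - γ) ^ 4)⁻¹ * (u⁻¹) ^ 4 * (1 - γ * x / r) := by
  have hγ : 0 < 1 - γ := by linarith
  have hr0 : 0 < r := by linarith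
  have hy : 0 ≤ γ * x := mul_nonneg h0 hx
  have hyM : γ * x ≤ r / 2 := (mul_le_mul_of_nonneg_left hxM h0).trans hM
  set a := (1 - γ) * u with ha
  set y := γ * x with hyd
  have ha0 : 0 < a := by positivity
  have ha1 : a + y ≤ r := by nlinarith
  have h2 : ((1 - γ) ^ 4)⁻¹ * (u⁻¹) ^ 4 = (a⁻¹) ^ 4 := by
    rw [ha, mul_inv, mul_pow, inv_pow (1 - γ)]
  rw [h2]
  have h3 : (a + y)⁻¹ ≤ a⁻¹ * (1 - y / r) := by
    have h4 : y / r ≤ y / (a + y) := div_le_div_of_nonneg_left hy (by positivity) ha1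
    have h5 : (a + y)⁻¹ = a⁻¹ * (1 - y / (a + y)) := by
      field_simp
      ring
    rw [h5]
    exact mul_le_mul_of_nonneg_left (by linarith) (by positivity)
  have h6 : (a + y)⁻¹ ^ 3 ≤ (a⁻¹) ^ 3 :=
    pow_le_pow_left₀ (by positivity) (inv_anti₀ ha0 (by linarith)) 3
  calc (a + y)⁻¹ ^ 4 = (a + y)⁻¹ ^ 3 * (a + y)⁻¹ := by ring
    _ ≤ (a⁻¹) ^ 3 * (a⁻¹ * (1 - y / r)) := by
        refine mul_le_mul h6 h3 (by positivity) (by positivity)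
    _ = (a⁻¹) ^ 4 * (1 - y / r) := by ring

/-- The drift of the excess under the moving average with an input of mean `g ≥ 8 r`: it contracts,
up to a term that vanishes when `u` is close to `g`. -/
theorem integral_excess_le {Ω : Type*} [MeasurableSpace Ω] [Finite Ω] [MeasurableSingletonClass Ω]
    (μ : Measure Ω) [IsProbabilityMeasure μ] {x : Ω → ℝ} {u r γ M : ℝ} (hr : 0 < r) (hu : 0 < u)
    (h0 : 0 ≤ γ) (h1 : γ ≤ 1 / 8) (hx : ∀ ω, x ω ∈ Set.Icc 0 M) (hM : γ * M ≤ r / 2)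
    (hg : 8 * r ≤ ∫ ω, x ω ∂μ) :
    ∫ ω, excess r (γ * x ω + (1 - γ) * u) ∂μ ≤
      excess r u - γ * excess r u + 144 * (r⁻¹) ^ 6 * γ * (u - ∫ ω, x ω ∂μ) ^ 2 := by
  set g := ∫ ω, x ω ∂μ
  have hγ : 0 < 1 - γ := by linarith
  have hlast : 0 ≤ 144 * (r⁻¹) ^ 6 * γ * (u - g) ^ 2 := by positivity
  have hpos : ∀ ω, 0 < γ * x ω + (1 - γ) * u := fun ω => by
    have := mul_nonneg h0 (hx ω).1
    positivity
  rcases le_or_gt (2 * r) u with hc | hc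
  · have e : ∀ ω, excess r (γ * x ω + (1 - γ) * u) = 0 := fun ω => by
      refine excess_eq_zero hr ?_
      have := mul_nonneg h0 (hx ω).1
      nlinarith
    simp only [e, integral_zero, excess_eq_zero hr (by linarith : r ≤ u)]
    linarith
  rcases le_or_gt (r / 2) u with hc' | hc'
  · have hk : (u⁻¹) ^ 4 ≤ 16 * (r⁻¹) ^ 4 := by
      have := pow_le_pow_left₀ (by positivity) (inv_anti₀ (by linarith) hc') 4
      refine this.trans (le_of_eq ?_)
      field_simp
      norm_num
    have e : ∀ ω, excess r (γ * x ω + (1 - γ) * u) ≤ excess r u + 128 * γ * (r⁻¹) ^ 4 := by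
      intro ω
      have h2 := inv_step_pow_le hu h0 h1 (hx ω).1
      rw [add_comm] at h2
      have h3 := le_max_left ((u⁻¹) ^ 4 - (r⁻¹) ^ 4) 0
      refine max_le ?_ ?_
      · have h4 := mul_le_mul_of_nonneg_left hk h0
        rw [excess]
        linarith
      · have := excess_nonneg r u
        positivity
    have h5 : ∫ ω, excess r (γ * x ω + (1 - γ) * u) ∂μ ≤ excess r u + 128 * γ * (r⁻¹) ^ 4 := by
      simpa using integral_mono (μ := μ) Integrable.of_finite (integrable_const _) e
    have h6 : excess r u ≤ 16 * (r⁻¹) ^ 4 := max_le (by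
      have : 0 < (r⁻¹) ^ 4 := by positivity
      linarith) (by positivity)
    have h7 : 1 ≤ (r⁻¹) ^ 2 * (u - g) ^ 2 := by
      rw [← mul_pow]
      refine one_le_sq_iff_one_le_abs _ |>.2 ?_
      rw [abs_mul, abs_of_pos (by positivity : (0 : ℝ) < r⁻¹), abs_of_neg (by linarith),
        inv_mul_eq_div, one_le_div hr]
      linarith
    have h8 : 144 * (r⁻¹) ^ 4 * γ ≤ 144 * (r⁻¹) ^ 6 * γ * (u - g) ^ 2 := by
      have := mul_le_mul_of_nonneg_left h7 (by positivity : 0 ≤ 144 * (r⁻¹) ^ 4 * γ)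
      calc _ = 144 * (r⁻¹) ^ 4 * γ * 1 := by ring
        _ ≤ _ := this
        _ = _ := by ring
    have h9 := mul_le_mul_of_nonneg_left h6 h0
    linarith
  · have e : ∀ ω, excess r (γ * x ω + (1 - γ) * u) ≤
        ((1 - γ) ^ 4)⁻¹ * (u⁻¹) ^ 4 * (1 - γ * x ω / r) - (r⁻¹) ^ 4 := by
      intro ω
      have h2 := inv_step_pow_le_affine hu hc'.le h0 h1 (hx ω).1 (hx ω).2 hM
      rw [add_comm] at h2
      rw [excess_eq (hpos ω)]
      · linarith
      · have := mul_le_mul_of_nonneg_left (hx ω).2 h0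
        nlinarith
    have h5 : ∫ ω, excess r (γ * x ω + (1 - γ) * u) ∂μ ≤
        ((1 - γ) ^ 4)⁻¹ * (u⁻¹) ^ 4 * (1 - γ * g / r) - (r⁻¹) ^ 4 := by
      refine (integral_mono (μ := μ) Integrable.of_finite Integrable.of_finite e).trans
        (le_of_eq ?_)
      rw [integral_sub Integrable.of_finite (integrable_const _), integral_const_mul,
        integral_sub (integrable_const _) Integrable.of_finite, integral_div, integral_const_mul]
      simp [g]
    have h6 : 1 - γ * g / r ≤ 1 - 8 * γ := by
      have : 8 * γ ≤ γ * g / r := by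
        rw [le_div_iff₀ hr]
        nlinarith
      linarith
    have h7 : ((1 - γ) ^ 4)⁻¹ * (1 - 8 * γ) ≤ 1 - γ := by
      rw [inv_mul_le_iff₀ (by positivity)]
      have := one_sub_four_mul_le_pow (γ := γ) (by linarith)
      nlinarith
    have h8 : ((1 - γ) ^ 4)⁻¹ * (u⁻¹) ^ 4 * (1 - γ * g / r) ≤ (1 - γ) * (u⁻¹) ^ 4 := by
      have h9 : 0 ≤ ((1 - γ) ^ 4)⁻¹ * (u⁻¹) ^ 4 := by positivity
      refine (mul_le_mul_of_nonneg_left h6 h9).trans ?_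
      have := mul_le_mul_of_nonneg_right h7 (by positivity : 0 ≤ (u⁻¹) ^ 4)
      linarith
    rw [excess_eq hu (by linarith)]
    have h10 : 0 ≤ γ * (r⁻¹) ^ 4 := by positivity
    linarith

/-! ### Combination of the one-step estimates -/

/-- The mean decrease of the combined error. -/
theorem error_combination_le {K a k C c γ U X A L Y ζ N e U' X' A' L' Z' : ℝ} (hK : 1 ≤ K)
    (hk : 1 ≤ k) (hka : K + a ≤ k * a) (hC : K * (2 * k + 2) ≤ C) (hc0 : 0 < c) (hc1 : c ≤ 1)
    (hcC : C * c * (1 + K) ≤ a / 4) (hγ : 0 < γ) (hγC : C * γ ≤ a / 4)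
    (hγCK : C * γ * (1 + K) ≤ 1 / 4) (hU : 0 ≤ U) (hX : 0 ≤ X) (hA : 0 ≤ A) (hL : 0 ≤ L)
    (hN : 0 ≤ N) (hζ0 : 0 ≤ ζ) (hζ : ζ ≤ Y) (he : e ≤ K * (U + X + A + L + Y))
    (h1 : U' ≤ U - a * γ * U + K * γ * ζ + K * (c * γ) * (U + N + e) + K * γ ^ 2 * (1 + X))
    (h2 : X' ≤ X - a * γ * X + K * γ * U + K * γ * ζ)
    (h3 : A' ≤ A - a * γ * A + K * γ * (L + ζ) + K * (c * γ) * (A + N + e) +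
      K * γ ^ 2 * (1 + X))
    (h4 : L' ≤ L - a * γ * L + K * γ * ζ + K * (c * γ) * (L + N + e) + K * γ ^ 2 * (1 + X))
    (h5 : γ ^ 2 * Z' ≤ Y / 2 + K * γ ^ 2 * (1 + X)) :
    k * U' + X' + A' + k * L' + γ ^ 2 * Z' ≤ (k * U + X + A + k * L + Y) -
      a / 2 * γ * (U + X + A + L) - Y / 4 + C * (c * γ) * N + C * γ ^ 2 := by
  have hk0 : 0 < k := by linarith
  have hK0 : 0 < K := by linarith
  have hKk : K * 1 ≤ K * k := mul_le_mul_of_nonneg_left hk hK0.le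
  have hC0 : 0 < C := by linarith
  obtain ⟨W, hW⟩ : ∃ W, W = U + X + A + L := ⟨_, rfl⟩
  rw [← hW] at he ⊢
  have hW0 : 0 ≤ W := by rw [hW]; positivity
  have hY0 : 0 ≤ Y := hζ0.trans hζ
  have hcγ : 0 < c * γ := by positivity
  have i1 := mul_le_mul_of_nonneg_left h1 hk0.le
  have i4 := mul_le_mul_of_nonneg_left h4 hk0.le
  have j1 : γ * (K + a) * U ≤ γ * (k * a) * U :=
    mul_le_mul_of_nonneg_right (mul_le_mul_of_nonneg_left hka hγ.le) hU
  have j2 : γ * (K + a) * L ≤ γ * (k * a) * L :=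
    mul_le_mul_of_nonneg_right (mul_le_mul_of_nonneg_left hka hγ.le) hL
  have j3 : K * (2 * k + 2) * (γ * ζ) ≤ C * (γ * Y) :=
    mul_le_mul hC (mul_le_mul_of_nonneg_left hζ hγ.le) (by positivity) hC0.le
  have j4 : (c * γ) * (K * (k * U + A + k * L)) ≤ (c * γ) * (C * W) := by
    refine mul_le_mul_of_nonneg_left ?_ hcγ.le
    have q1 : k * U + A + k * L ≤ k * W := by
      have := mul_le_mul_of_nonneg_right hk hA
      have := mul_nonneg hk0.le hX
      rw [hW]
      linarith
    have q2 := mul_le_mul_of_nonneg_left q1 hK0.le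
    have q3 : K * k ≤ C := by linarith [mul_pos hK0 hk0]
    have q4 := mul_le_mul_of_nonneg_right q3 hW0
    linarith
  have j5 : (c * γ) * (K * (2 * k + 1) * (N + e)) ≤ (c * γ) * (C * (N + K * (W + Y))) := by
    refine mul_le_mul_of_nonneg_left ?_ hcγ.le
    refine (mul_le_mul_of_nonneg_left (by linarith : N + e ≤ N + K * (W + Y))
      (by positivity)).trans (mul_le_mul_of_nonneg_right (by linarith) (by positivity))
  have j6 : K * (2 * k + 2) * (γ ^ 2 * (1 + X)) ≤ C * (γ ^ 2 * (1 + W)) :=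
    mul_le_mul hC (mul_le_mul_of_nonneg_left (by linarith) (sq_nonneg γ)) (by positivity) hC0.le
  have j7 : C * c * (1 + K) * (γ * W) ≤ a / 4 * (γ * W) :=
    mul_le_mul_of_nonneg_right hcC (by positivity)
  have j8 : C * γ * (γ * W) ≤ a / 4 * (γ * W) :=
    mul_le_mul_of_nonneg_right hγC (by positivity)
  have j9 : (C * γ + C * (c * γ) * K) * Y ≤ 1 / 4 * Y := by
    refine mul_le_mul_of_nonneg_right (le_trans ?_ hγCK) hY0
    have := mul_le_mul_of_nonneg_left (mul_le_of_le_one_left hγ.le hc1)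
      (by positivity : 0 ≤ C * K)
    linarith
  calc k * U' + X' + A' + k * L' + γ ^ 2 * Z'
      ≤ (k * U + X + A + k * L + Y) + (γ * (K + a) * U - γ * (k * a) * U) +
        (γ * (K + a) * L - γ * (k * a) * L) - a * γ * (U + X + A + L) +
        K * (2 * k + 2) * (γ * ζ) + (c * γ) * (K * (k * U + A + k * L)) +
        (c * γ) * (K * (2 * k + 1) * (N + e)) + K * (2 * k + 2) * (γ ^ 2 * (1 + X)) - Y / 2 := by
        linarith
    _ ≤ (k * U + X + A + k * L + Y) - a * γ * W + C * (γ * Y) + (c * γ) * (C * W) +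
        (c * γ) * (C * (N + K * (W + Y))) + C * (γ ^ 2 * (1 + W)) - Y / 2 := by
        rw [← hW]
        linarith
    _ ≤ _ := by linarith

/-- The constants of the Lyapunov function and of the step sizes. -/
theorem exists_lyapunov_constants {K a : ℝ} (hK : 1 ≤ K) (ha : 0 < a) :
    ∃ β k C c γ₁ : ℝ, 0 < β ∧ β * C = 1 / 8 ∧ 1 ≤ k ∧ K + a ≤ k * a ∧ K * (2 * k + 2) ≤ C ∧
      0 < c ∧ c ≤ 1 ∧ C * c * (1 + K) ≤ a / 4 ∧ K ^ 2 * c ≤ β * a / 4 ∧ 0 < γ₁ ∧ γ₁ ≤ 1 ∧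
      C * γ₁ ≤ a / 4 ∧ C * γ₁ * (1 + K) ≤ 1 / 4 ∧ K * γ₁ ≤ β * a / 4 ∧
      2 * K ^ 2 * γ₁ ≤ β / 4 := by
  have ht : ∀ c b : ℝ, 0 < b → ∀ᶠ x : ℝ in 𝓝[>] 0, c * x ≤ b := by
    intro c b hb
    have h1 : Tendsto (fun x : ℝ => c * x) (𝓝[>] 0) (𝓝 (c * 0)) :=
      (Continuous.tendsto (by fun_prop) 0).mono_left nhdsWithin_le_nhds
    rw [mul_zero] at h1
    exact (h1.eventually (eventually_lt_nhds hb)).mono fun x hx => hx.le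
  have hpos : ∀ᶠ x : ℝ in 𝓝[>] 0, 0 < x := self_mem_nhdsWithin
  have hK0 : 0 < K := by linarith
  obtain ⟨k, hk, hka⟩ : ∃ k : ℝ, 1 ≤ k ∧ K + a ≤ k * a :=
    ⟨1 + K / a, le_add_of_nonneg_right (by positivity), by field_simp; linarith⟩
  obtain ⟨C, hC⟩ : ∃ C : ℝ, C = K * (2 * k + 2) := ⟨_, rfl⟩
  have hC0 : 0 < C := by rw [hC]; positivity
  obtain ⟨β, hβ0, hβ⟩ : ∃ β : ℝ, 0 < β ∧ β * C = 1 / 8 :=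
    ⟨1 / (8 * C), by positivity, by field_simp⟩
  have hβa : 0 < β * a / 4 := by positivity
  have ha4 : 0 < a / 4 := by positivity
  obtain ⟨c, c0, c1, c2, c3⟩ := (hpos.and ((ht 1 1 one_pos).and
    ((ht (C * (1 + K)) _ ha4).and (ht (K ^ 2) _ hβa)))).exists
  obtain ⟨γ, g0, g1, g2, g3, g4, g5⟩ := (hpos.and ((ht 1 1 one_pos).and
    ((ht C _ ha4).and ((ht (C * (1 + K)) (1 / 4) (by norm_num)).and ((ht K _ hβa).and
      (ht (2 * K ^ 2) (β / 4) (by positivity))))))).exists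
  exact ⟨β, k, C, c, γ, hβ0, hβ, hk, hka, hC.ge, c0, by linarith, by linarith, c3, g0,
    by linarith, g2, by linarith, g4, g5⟩

/-- If the errors of the estimates contract at rate `γ`, up to noise of order `γ²` and a drift of
order `c γ`, then a suitable combination with the objective decreases in the mean. Here `U`, `X`,
`A`, `L`, `Z` are the errors of the rank estimates, their excess, the errors of the other
estimates, those of the lower-level variables, and the squared momentum; `N` is the squared
gradient, `e` the squared bias of the direction, and primes denote the values after one step. -/
theorem exists_lyapunov {K a : ℝ} (hK : 1 ≤ K) (ha : 0 < a) :
    ∃ β k c γ₁ : ℝ, 0 < β ∧ 1 ≤ k ∧ 0 < c ∧ c ≤ 1 ∧ 0 < γ₁ ∧ γ₁ ≤ 1 ∧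
    ∀ γ : ℝ, 0 < γ → γ ≤ γ₁ → ∀ U X A L Z N e F U' X' A' L' Z' F' : ℝ,
      0 ≤ U → 0 ≤ X → 0 ≤ A → 0 ≤ L → 0 ≤ Z → 0 ≤ N →
      U' ≤ U - a * γ * U + K * γ * ((c * γ) ^ 2 * Z) + K * (c * γ) * (U + N + e) +
        K * γ ^ 2 * (1 + X) →
      X' ≤ X - a * γ * X + K * γ * U + K * γ * ((c * γ) ^ 2 * Z) →
      A' ≤ A - a * γ * A + K * γ * (L + (c * γ) ^ 2 * Z) + K * (c * γ) * (A + N + e) +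
        K * γ ^ 2 * (1 + X) →
      L' ≤ L - a * γ * L + K * γ * ((c * γ) ^ 2 * Z) + K * (c * γ) * (L + N + e) +
        K * γ ^ 2 * (1 + X) →
      Z' ≤ Z / 2 + K * (1 + X) →
      e ≤ K * (U + X + A + L + (c * γ) ^ 2 * Z) →
      F' ≤ F - c * γ / 4 * N + K * (c * γ) * (e + (c * γ) ^ 2 * Z) + K * γ ^ 2 * (1 + X) →
      F' + β * (k * U' + X' + A' + k * L' + γ ^ 2 * Z') ≤
        F + β * (k * U + X + A + k * L + γ ^ 2 * Z) - c * γ / 8 * N + (K + 1) * γ ^ 2 := by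
  obtain ⟨β, k, C, c, γ₁, hβ0, hβ, hk, hka, hC, hc0, hc1, hcC, hcβ, hγ0, hγ1, hγ2, hγ3, hγ4,
    hγ5⟩ := exists_lyapunov_constants hK ha
  refine ⟨β, k, c, γ₁, hβ0, hk, hc0, hc1, hγ0, hγ1, ?_⟩
  intro γ hγ hγγ U X A L Z N e F U' X' A' L' Z' F' hU hX hA hL hZ hN h1 h2 h3 h4 h5 h6 h7
  have hK0 : 0 < K := by linarith
  have hk0 : 0 < k := by linarith
  have hC0 : 0 < C := lt_of_lt_of_le (by positivity) hC
  have hγC : C * γ ≤ a / 4 := (mul_le_mul_of_nonneg_left hγγ hC0.le).trans hγ2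
  have hγCK : C * γ * (1 + K) ≤ 1 / 4 := (mul_le_mul_of_nonneg_right
    (mul_le_mul_of_nonneg_left hγγ hC0.le) (by linarith)).trans hγ3
  have hγK : K * γ ≤ β * a / 4 := (mul_le_mul_of_nonneg_left hγγ hK0.le).trans hγ4
  have hγK2 : 2 * K ^ 2 * γ ≤ β / 4 := (mul_le_mul_of_nonneg_left hγγ (by positivity)).trans hγ5
  have hζ0 : 0 ≤ (c * γ) ^ 2 * Z := by positivity
  have hζ1 : (c * γ) ^ 2 * Z ≤ γ ^ 2 * Z :=
    mul_le_mul_of_nonneg_right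
      (pow_le_pow_left₀ (by positivity) (mul_le_of_le_one_left hγ.le hc1) 2) hZ
  generalize hζd : (c * γ) ^ 2 * Z = ζ at *
  obtain ⟨Y, hY⟩ : ∃ Y, Y = γ ^ 2 * Z := ⟨_, rfl⟩
  rw [← hY] at hζ1 ⊢
  have hY0 : 0 ≤ Y := hζ0.trans hζ1
  have h5' : γ ^ 2 * Z' ≤ Y / 2 + K * γ ^ 2 * (1 + X) := by
    have := mul_le_mul_of_nonneg_left h5 (sq_nonneg γ)
    rw [hY]
    linarith
  have he : e ≤ K * (U + X + A + L + Y) :=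
    h6.trans (mul_le_mul_of_nonneg_left (by linarith) hK0.le)
  have hV := error_combination_le hK hk hka hC hc0 hc1 hcC hγ hγC hγCK hU hX hA hL hN hζ0 hζ1 he
    h1 h2 h3 h4 h5'
  clear h1 h2 h3 h4 h5 h5' h6
  obtain ⟨W, hW⟩ : ∃ W, W = U + X + A + L := ⟨_, rfl⟩
  rw [← hW] at he hV
  have hW0 : 0 ≤ W := by rw [hW]; positivity
  have hXW : X ≤ W := by linarith
  have hV' := mul_le_mul_of_nonneg_left hV hβ0.le
  have hcγ : 0 < c * γ := by positivity
  have e1 : β * (C * (c * γ) * N) = c * γ / 8 * N := by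
    linear_combination (c * γ * N) * hβ
  have e2 : β * (C * γ ^ 2) = γ ^ 2 / 8 := by linear_combination (γ ^ 2) * hβ
  have f1 : K * (c * γ) * (e + ζ) ≤ K * (c * γ) * (K * (W + Y) + Y) :=
    mul_le_mul_of_nonneg_left (by linarith) (by positivity)
  have f2 : K * γ ^ 2 * (1 + X) ≤ K * γ ^ 2 * (1 + W) :=
    mul_le_mul_of_nonneg_left (by linarith) (by positivity)
  have f3 : K ^ 2 * c * (γ * W) ≤ β * a / 4 * (γ * W) :=
    mul_le_mul_of_nonneg_right hcβ (by positivity)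
  have f4 : K * γ * (γ * W) ≤ β * a / 4 * (γ * W) :=
    mul_le_mul_of_nonneg_right hγK (by positivity)
  have f5 : K * (c * γ) * (K * Y + Y) ≤ β / 4 * Y := by
    have g2 : K * (K * Y + Y) ≤ 2 * K ^ 2 * Y := by
      have := mul_le_mul_of_nonneg_right hK (by positivity : 0 ≤ K * Y)
      linarith
    have g3 : (c * γ) * (K * (K * Y + Y)) ≤ γ * (2 * K ^ 2 * Y) :=
      mul_le_mul (mul_le_of_le_one_left hγ.le hc1) g2 (by positivity) hγ.le
    have g4 := mul_le_mul_of_nonneg_right hγK2 hY0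
    linarith
  have f6 : 0 ≤ γ ^ 2 := sq_nonneg γ
  clear hγC hγCK hγK hγK2 hcC hcβ hγ2 hγ3 hγ4 hγ5 hβ hC hka hV he
  linarith

end

noncomputable section

/-! ### Size and bias of the stochastic direction -/

theorem norm_smul_sum_sq_le {ι E : Type*} [Fintype ι] [NormedAddCommGroup E] [NormedSpace ℝ E]
    {c : ℝ} (h0 : 0 ≤ c) (h1 : c ≤ 1) (s : Finset ι) (x : ι → E) :
    ‖c • ∑ i ∈ s, x i‖ ^ 2 ≤ Fintype.card ι * ∑ i, ‖x i‖ ^ 2 := by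
  have h2 : ‖c • ∑ i ∈ s, x i‖ ≤ ∑ i, ‖x i‖ := by
    rw [norm_smul, Real.norm_of_nonneg h0]
    refine (mul_le_of_le_one_left (norm_nonneg _) h1).trans ((norm_sum_le _ _).trans ?_)
    exact Finset.sum_le_sum_of_subset_of_nonneg (Finset.subset_univ s) fun i _ _ => norm_nonneg _
  refine (pow_le_pow_left₀ (norm_nonneg _) h2 2).trans ?_
  have := sq_sum_le_card_mul_sum_sq (s := Finset.univ) (f := fun i => ‖x i‖)
  rwa [Finset.card_univ] at this

theorem one_div_card_mem {α : Type*} (s : Finset α) : (1 / (s.card : ℝ)) ∈ Set.Icc (0 : ℝ) 1 := by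
  refine ⟨by positivity, ?_⟩
  rcases Nat.eq_zero_or_pos s.card with h0 | h0
  · simp [h0]
  · rw [div_le_one (by exact_mod_cast h0)]
    exact_mod_cast h0

theorem norm_add_sq_le {E : Type*} [NormedAddCommGroup E] (x y : E) :
    ‖x + y‖ ^ 2 ≤ 2 * ‖x‖ ^ 2 + 2 * ‖y‖ ^ 2 := by
  have h1 := pow_le_pow_left₀ (norm_nonneg _) (norm_add_le x y) 2
  nlinarith [sq_nonneg (‖x‖ - ‖y‖)]

variable {Q : Type*} {I : Q → Type*} [Fintype Q] [∀ q, Fintype (I q)]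

/-- The excess controls the size of the derivatives of the outer functions, and their variation
between an estimate `u` and a target `g` that is well above the threshold `r`. -/
theorem exists_deriv_fPair_estimates (D : Problem Q I) {r : ℝ} (hr : 0 < r) (b : ℝ) :
    ∃ C, 0 ≤ C ∧ ∀ x : Σ q, I q, ∀ u ∈ Set.Ioc 0 b,
      (deriv (fPair D x.1 x.2) u) ^ 2 ≤ C * (1 + excess r u) ∧
      ∀ g ∈ Set.Icc (8 * r) b, (deriv (fPair D x.1 x.2) u - deriv (fPair D x.1 x.2) g) ^ 2 ≤
        C * ((u - g) ^ 2 + excess r u) := by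
  obtain ⟨C₁, h₁⟩ := exists_abs_deriv_fPair_le D b
  obtain ⟨C₂, h₂⟩ := exists_bddLip_fPair D (half_pos hr) b
  have hsq : ∀ x : Σ q, I q, ∀ u ∈ Set.Ioc 0 b,
      (deriv (fPair D x.1 x.2) u) ^ 2 ≤ C₁ ^ 2 * (u⁻¹) ^ 4 := by
    intro x u hu
    have := pow_le_pow_left₀ (abs_nonneg _) (h₁ x u hu) 2
    rw [sq_abs] at this
    linarith [this, mul_pow C₁ (u⁻¹ ^ 2) 2, pow_mul (u⁻¹) 2 2]
  refine ⟨C₂ ^ 2 + C₁ ^ 2 * (5 + (r⁻¹) ^ 4), by positivity, fun x u hu => ⟨?_, fun g hg => ?_⟩⟩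
  · refine (hsq x u hu).trans ?_
    have h3 := inv_pow_le_excess r u
    have h4 := excess_nonneg r u
    have h5 : 0 ≤ (r⁻¹) ^ 4 := by positivity
    have h6 : C₁ ^ 2 * (u⁻¹) ^ 4 ≤ C₁ ^ 2 * ((5 + (r⁻¹) ^ 4) * (1 + excess r u)) := by
      refine mul_le_mul_of_nonneg_left (h3.trans ?_) (sq_nonneg _)
      nlinarith [mul_nonneg h4 h5]
    have h7 : 0 ≤ C₂ ^ 2 * (1 + excess r u) := by positivity
    linarith
  · have h4 := excess_nonneg r u
    have hg0 : 0 < g := lt_of_lt_of_le (by positivity) hg.1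
    have h8 : 0 ≤ C₂ ^ 2 * excess r u := by positivity
    have h9 : 0 ≤ C₁ ^ 2 * (5 + (r⁻¹) ^ 4) * (u - g) ^ 2 := by positivity
    have h10 : 0 ≤ C₁ ^ 2 * (r⁻¹) ^ 4 * excess r u := by positivity
    have h11 : 0 ≤ C₂ ^ 2 * (u - g) ^ 2 := by positivity
    rcases le_or_gt (r / 2) u with hc | hc
    · have h5 := (h₂ x).2.abs_sub_le (x := u) (y := g) ⟨hc, hu.2⟩ ⟨by linarith [hg.1], hg.2⟩
      have h6 := pow_le_pow_left₀ (abs_nonneg _) h5 2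
      rw [sq_abs, Real.dist_eq, mul_pow, sq_abs] at h6
      have h12 : 0 ≤ C₁ ^ 2 * (5 + (r⁻¹) ^ 4) * excess r u := by positivity
      linarith
    · have h5 := hsq x u hu
      have h6 := hsq x g ⟨hg0, hg.2⟩
      have h7 : (g⁻¹) ^ 4 ≤ (u⁻¹) ^ 4 := pow_le_pow_left₀ (by positivity)
        (inv_anti₀ hu.1 (by linarith [hg.1])) 4
      have h12 : 16 * (r⁻¹) ^ 4 ≤ (u⁻¹) ^ 4 := by
        have := pow_le_pow_left₀ (by positivity) (inv_anti₀ hu.1 hc.le) 4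
        refine le_trans (le_of_eq ?_) this
        field_simp
        norm_num
      have h13 := excess_eq (r := r) hu.1 (by linarith)
      have h14 : (u⁻¹) ^ 4 ≤ 16 / 15 * excess r u := by linarith
      have h15 := mul_le_mul_of_nonneg_left h7 (sq_nonneg C₁)
      have h16 := mul_le_mul_of_nonneg_left h14 (sq_nonneg C₁)
      have h17 : 0 ≤ C₁ ^ 2 * excess r u := by positivity
      nlinarith [sq_nonneg (deriv (fPair D x.1 x.2) u + deriv (fPair D x.1 x.2) g)]

/-- Bounds of the estimates of a state on which the direction is controlled. There is no positive
lower bound of the rank estimates `u`, since the surrogate may vanish on a batch. -/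
structure State.Bounded {d : ℕ} (σ : State I d) (L ρ : ℝ) : Prop where
  u : ∀ q i, σ.u q i ∈ Set.Ioc 0 L
  ua : ∀ q, |σ.ua q| ≤ L
  ub : ∀ q, |σ.ub q| ≤ L
  uq : ∀ q, σ.uq q ∈ Set.Icc ρ L
  s : ∀ q, σ.s q ∈ Set.Icc ρ L
  lam : ∀ q, |σ.lam q| ≤ L

/-- The estimates of a query, as a point of a metric space. -/
def queryBox (L ρ : ℝ) : Set (ℝ × ℝ × ℝ × ℝ × ℝ) :=
  {x | |x.1| ≤ L ∧ |x.2.1| ≤ L ∧ x.2.2.1 ∈ Set.Icc ρ L ∧ x.2.2.2.1 ∈ Set.Icc ρ L ∧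
    |x.2.2.2.2| ≤ L}

/-- The contribution of a query to the direction is bounded and Lipschitz in its estimates,
uniformly in the batches and scores. -/
theorem exists_queryDir_estimates (D : Problem Q I) (Bh : ℝ) (Ch Lh Ph : ℝ≥0) (L : ℝ) {ρ : ℝ}
    (hρ : 0 < ρ) : ∃ C, 0 ≤ C ∧ ∀ {d : ℕ} {h : Score I d}, ScoreAssumption h Bh Ch Lh Ph →
      ∀ w q β, ∀ x ∈ queryBox L ρ,
        ‖queryDir D h q β w x.1 x.2.1 x.2.2.1 x.2.2.2.1 x.2.2.2.2‖ ≤ C ∧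
        ∀ y ∈ queryBox L ρ,
          ‖queryDir D h q β w x.1 x.2.1 x.2.2.1 x.2.2.2.1 x.2.2.2.2 -
            queryDir D h q β w y.1 y.2.1 y.2.2.1 y.2.2.2.1 y.2.2.2.2‖ ^ 2 ≤
          C * ((x.1 - y.1) ^ 2 + (x.2.1 - y.2.1) ^ 2 + (x.2.2.1 - y.2.2.1) ^ 2 +
            (x.2.2.2.1 - y.2.2.2.1) ^ 2 + (x.2.2.2.2 - y.2.2.2.2) ^ 2) := by
  obtain ⟨C, hC⟩ := exists_bddLip_queryDir D Bh Ch Lh Ph (max L 1) hρ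
  have hco : ∀ (f : ℝ × ℝ × ℝ × ℝ × ℝ → ℝ), (∀ x ∈ queryBox L ρ, |f x| ≤ L) →
      (∀ x y, |f x - f y| ≤ dist x y) → BddLip (queryBox L ρ) (max L 1) f := fun f h1 h2 =>
    ⟨zero_le_one.trans (le_max_right _ _), fun x hx => (h1 x hx).trans (le_max_left _ _),
      fun x _ y _ => (h2 x y).trans (le_mul_of_one_le_left dist_nonneg (le_max_right _ _))⟩
  refine ⟨max C (C ^ 2), le_max_of_le_right (sq_nonneg C), fun {d h} hA w q β => ?_⟩
  have key := hC hA (X := ℝ × ℝ × ℝ × ℝ × ℝ) (S := queryBox L ρ) (W := fun _ => w)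
    (ua := fun x => x.1) (ub := fun x => x.2.1) (uq := fun x => x.2.2.1)
    (s := fun x => x.2.2.2.1) (l := fun x => x.2.2.2.2) (.const w)
    (hco _ (fun x hx => hx.1) fun x y => by
      simp only [Prod.dist_eq, Real.dist_eq]
      exact le_max_left _ _)
    (hco _ (fun x hx => hx.2.1) fun x y => by
      simp only [Prod.dist_eq, Real.dist_eq]
      exact le_max_of_le_right (le_max_left _ _))
    (hco _ (fun x hx => abs_le.2 ⟨by linarith [hx.2.2.1.1, hx.2.2.1.2], hx.2.2.1.2⟩) fun x y => by
      simp only [Prod.dist_eq, Real.dist_eq]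
      exact le_max_of_le_right (le_max_of_le_right (le_max_left _ _)))
    (hco _ (fun x hx => abs_le.2 ⟨by linarith [hx.2.2.2.1.1, hx.2.2.2.1.2], hx.2.2.2.1.2⟩)
      fun x y => by
      simp only [Prod.dist_eq, Real.dist_eq]
      exact le_max_of_le_right (le_max_of_le_right (le_max_of_le_right (le_max_left _ _))))
    (hco _ (fun x hx => hx.2.2.2.2) fun x y => by
      simp only [Prod.dist_eq, Real.dist_eq]
      exact le_max_of_le_right (le_max_of_le_right (le_max_of_le_right (le_max_right _ _))))
    (fun x hx => hx.2.2.1.1) (fun x hx => hx.2.2.2.1.1) q β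
  refine fun x hx => ⟨(key.norm_le x hx).trans (le_max_left _ _), fun y hy => ?_⟩
  have h1 := pow_le_pow_left₀ (norm_nonneg _) (key.lip x hx y hy) 2
  refine h1.trans ?_
  rw [mul_pow]
  refine mul_le_mul (le_max_right _ _) ?_ (sq_nonneg _) (le_max_of_le_right (sq_nonneg C))
  have hmax : ∀ a b : ℝ, (max a b) ^ 2 ≤ a ^ 2 + b ^ 2 := fun a b => by
    rcases max_choice a b with e | e <;> rw [e] <;> nlinarith [sq_nonneg a, sq_nonneg b]
  simp only [Prod.dist_eq, Real.dist_eq]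
  have m1 := hmax |x.1 - y.1| (max |x.2.1 - y.2.1| (max |x.2.2.1 - y.2.2.1|
    (max |x.2.2.2.1 - y.2.2.2.1| |x.2.2.2.2 - y.2.2.2.2|)))
  have m2 := hmax |x.2.1 - y.2.1| (max |x.2.2.1 - y.2.2.1|
    (max |x.2.2.2.1 - y.2.2.2.1| |x.2.2.2.2 - y.2.2.2.2|))
  have m3 := hmax |x.2.2.1 - y.2.2.1| (max |x.2.2.2.1 - y.2.2.2.1| |x.2.2.2.2 - y.2.2.2.2|)
  have m4 := hmax |x.2.2.2.1 - y.2.2.2.1| |x.2.2.2.2 - y.2.2.2.2|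
  simp only [sq_abs] at m1 m2 m3 m4
  linarith

variable [DecidableEq Q] [∀ q, DecidableEq (I q)]

/-- The size of the stochastic direction. -/
theorem exists_norm_dir_sq_le [Nonempty Q] (D : Problem Q I) (Bh : ℝ) (Ch Lh Ph : ℝ≥0) (L : ℝ)
    {ρ r : ℝ} (hρ : 0 < ρ) (hr : 0 < r) :
    ∃ C, 0 ≤ C ∧ ∀ {d : ℕ} {h : Score I d}, ScoreAssumption h Bh Ch Lh Ph →
      ∀ σ : State I d, σ.Bounded L ρ → ∀ b, ‖dir D h b σ‖ ^ 2 ≤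
        C * (1 + ∑ x : Σ q, I q, excess r (σ.u x.1 x.2)) := by
  obtain ⟨C₁, hC₁, h₁⟩ := exists_deriv_fPair_estimates D hr L
  obtain ⟨C₂, hC₂, h₂⟩ := exists_queryDir_estimates D Bh Ch Lh Ph L hρ
  obtain ⟨C₃, h₃⟩ := exists_bddLip_gradGHat D Bh Ch Lh Ph
  set n : ℝ := (Fintype.card (Σ q, I q) : ℝ)
  refine ⟨2 * (n * (C₁ * C₃ ^ 2 * (n + 1))) +
    2 * D.C ^ 2 * (Fintype.card Q * (Fintype.card Q * C₂ ^ 2)), by positivity,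
    fun {d h} hA σ hσ b => ?_⟩
  set X := ∑ x : Σ q, I q, excess r (σ.u x.1 x.2)
  have hX : 0 ≤ X := Finset.sum_nonneg fun x _ => excess_nonneg _ _
  have hG1 : ‖G₁ D h b σ‖ ^ 2 ≤ n * (C₁ * C₃ ^ 2 * (n + 1)) * (1 + X) := by
    have h4 := norm_smul_sum_sq_le (one_div_card_mem b.1).1 (one_div_card_mem b.1).2 b.1
      fun x => deriv (fPair D x.1 x.2) (σ.u x.1 x.2) • gradGHat D h x.1 x.2 (b.2 x.1).1 σ.w
    refine h4.trans ?_
    rw [mul_assoc]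
    refine mul_le_mul_of_nonneg_left ?_ (by positivity)
    have h5 : ∀ x ∈ (Finset.univ : Finset (Σ q, I q)),
        ‖deriv (fPair D x.1 x.2) (σ.u x.1 x.2) • gradGHat D h x.1 x.2 (b.2 x.1).1 σ.w‖ ^ 2 ≤
        C₁ * C₃ ^ 2 * (1 + excess r (σ.u x.1 x.2)) := by
      intro x _
      rw [norm_smul, mul_pow, Real.norm_eq_abs, sq_abs]
      have h6 := (h₁ x _ (hσ.u x.1 x.2)).1
      have h7 := pow_le_pow_left₀ (norm_nonneg _) ((h₃ hA .id x.1 x.2 (b.2 x.1).1).norm_le σ.w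
        (Set.mem_univ _)) 2
      have h8 := mul_le_mul h6 h7 (sq_nonneg _)
        (mul_nonneg hC₁ (by linarith [excess_nonneg r (σ.u x.1 x.2)]))
      linarith
    refine (Finset.sum_le_sum h5).trans ?_
    rw [← Finset.mul_sum, Finset.sum_add_distrib, mul_assoc (C₁ * C₃ ^ 2)]
    refine mul_le_mul_of_nonneg_left ?_ (by positivity)
    simp only [Finset.sum_const, Finset.card_univ, nsmul_eq_mul, mul_one]
    have hn : 0 ≤ n := by positivity
    change n + X ≤ _
    nlinarith [mul_nonneg hn hX]
  have hG2 : ‖G₂ D h b σ‖ ^ 2 ≤ Fintype.card Q * (Fintype.card Q * C₂ ^ 2) := by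
    have h4 := norm_smul_sum_sq_le (one_div_card_mem (queriesOf b.1)).1
      (one_div_card_mem (queriesOf b.1)).2 (queriesOf b.1)
      fun q => queryDir D h q (b.2 q) σ.w (σ.ua q) (σ.ub q) (σ.uq q) (σ.s q) (σ.lam q)
    refine h4.trans (mul_le_mul_of_nonneg_left ?_ (by positivity))
    have h5 : ∀ q ∈ (Finset.univ : Finset Q), ‖queryDir D h q (b.2 q) σ.w (σ.ua q) (σ.ub q)
        (σ.uq q) (σ.s q) (σ.lam q)‖ ^ 2 ≤ C₂ ^ 2 := fun q _ =>
      pow_le_pow_left₀ (norm_nonneg _) (h₂ hA σ.w q (b.2 q)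
        (σ.ua q, σ.ub q, σ.uq q, σ.s q, σ.lam q)
        ⟨hσ.ua q, hσ.ub q, hσ.uq q, hσ.s q, hσ.lam q⟩).1 2
    simpa using Finset.sum_le_sum h5
  have h6 := norm_add_sq_le (G₁ D h b σ) (D.C • G₂ D h b σ)
  rw [norm_smul D.C, mul_pow, Real.norm_eq_abs, sq_abs] at h6
  have h7 := mul_le_mul_of_nonneg_left hG2 (sq_nonneg D.C)
  have h8 : 0 ≤ D.C ^ 2 * (Fintype.card Q * (Fintype.card Q * C₂ ^ 2)) * X := by positivity
  refine h6.trans ?_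
  linarith

/-- The squared errors of the estimates that enter the direction, relative to their targets
at `w`. -/
def estimateError {d : ℕ} (D : Problem Q I) (h : Score I d) (r : ℝ) (σ : State I d) (w : Param d) :
    ℝ :=
  ∑ x : Σ q, I q, ((σ.u x.1 x.2 - gHat D h x.1 x.2 Finset.univ w) ^ 2 +
      excess r (σ.u x.1 x.2)) +
    ∑ q, ((σ.ua q - groupTarget D h q (D.Sa q) w) ^ 2 +
      (σ.ub q - groupTarget D h q (D.Sb q) w) ^ 2 + (σ.uq q - expHat h q Finset.univ w) ^ 2 +
      (σ.s q - curvTarget D h q w) ^ 2 + (σ.lam q - lamHat D h q w) ^ 2)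

/-- The bias of the stochastic direction. -/
theorem exists_norm_bias_sq_le [Nonempty Q] (D : Problem Q I) (Bh : ℝ) (Ch Lh Ph : ℝ≥0) (L : ℝ)
    {ρ r : ℝ} (hρ : 0 < ρ) (hr : 0 < r) (hr8 : 8 * r ≤ rankBound D) :
    ∃ C, 0 ≤ C ∧ ∀ {d : ℕ} {h : Score I d}, ScoreAssumption h Bh Ch Lh Ph →
      ∀ σ : State I d, σ.Bounded L ρ →
      (∀ q i w, gHat D h q i Finset.univ w ≤ L) →
      (∀ q w, (groupTarget D h q (D.Sa q) w, groupTarget D h q (D.Sb q) w,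
        expHat h q Finset.univ w, curvTarget D h q w, lamHat D h q w) ∈ queryBox L ρ) →
      ‖fullDir D h σ.w σ.u σ.ua σ.ub σ.uq σ.s σ.lam - trueDir D h σ.w‖ ^ 2 ≤
        C * estimateError D h r σ σ.w := by
  obtain ⟨C₁, hC₁, h₁⟩ := exists_deriv_fPair_estimates D hr L
  obtain ⟨C₂, hC₂, h₂⟩ := exists_queryDir_estimates D Bh Ch Lh Ph L hρ
  obtain ⟨C₃, h₃⟩ := exists_bddLip_gradGHat D Bh Ch Lh Ph
  set n : ℝ := (Fintype.card (Σ q, I q) : ℝ)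
  refine ⟨2 * (n * (C₁ * C₃ ^ 2)) + 2 * D.C ^ 2 * (Fintype.card Q * C₂), by positivity,
    fun {d h} hA σ hσ hg ht => ?_⟩
  rw [trueDir, fullDir, fullDir, add_sub_add_comm, ← smul_sub, ← smul_sub, ← smul_sub,
    ← Finset.sum_sub_distrib, ← Finset.sum_sub_distrib]
  have hS : (0 : ℝ) ≤ 1 / (Fintype.card (Σ q, I q) : ℝ) ∧ 1 / (Fintype.card (Σ q, I q) : ℝ) ≤ 1 :=
    one_div_card_mem (Finset.univ : Finset (Σ q, I q))
  have hQ : (0 : ℝ) ≤ 1 / (Fintype.card Q : ℝ) ∧ 1 / (Fintype.card Q : ℝ) ≤ 1 :=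
    one_div_card_mem (Finset.univ : Finset Q)
  refine (norm_add_sq_le _ _).trans ?_
  rw [norm_smul D.C, mul_pow, Real.norm_eq_abs, sq_abs]
  have a1 := norm_smul_sum_sq_le hS.1 hS.2 Finset.univ fun x : Σ q, I q =>
    deriv (fPair D x.1 x.2) (σ.u x.1 x.2) • gradGHat D h x.1 x.2 Finset.univ σ.w -
      deriv (fPair D x.1 x.2) (gHat D h x.1 x.2 Finset.univ σ.w) •
        gradGHat D h x.1 x.2 Finset.univ σ.w
  have a2 := norm_smul_sum_sq_le hQ.1 hQ.2 Finset.univ fun q =>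
    queryDir D h q (fullBatch D q) σ.w (σ.ua q) (σ.ub q) (σ.uq q) (σ.s q) (σ.lam q) -
      queryDir D h q (fullBatch D q) σ.w (groupTarget D h q (D.Sa q) σ.w)
        (groupTarget D h q (D.Sb q) σ.w) (expHat h q Finset.univ σ.w) (curvTarget D h q σ.w)
        (lamHat D h q σ.w)
  have b1 : ∀ x ∈ (Finset.univ : Finset (Σ q, I q)),
      ‖deriv (fPair D x.1 x.2) (σ.u x.1 x.2) • gradGHat D h x.1 x.2 Finset.univ σ.w -
      deriv (fPair D x.1 x.2) (gHat D h x.1 x.2 Finset.univ σ.w) •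
        gradGHat D h x.1 x.2 Finset.univ σ.w‖ ^ 2 ≤ C₁ * C₃ ^ 2 *
        ((σ.u x.1 x.2 - gHat D h x.1 x.2 Finset.univ σ.w) ^ 2 + excess r (σ.u x.1 x.2)) := by
    intro x _
    rw [← sub_smul, norm_smul, mul_pow, Real.norm_eq_abs, sq_abs]
    have h6 := (h₁ x _ (hσ.u x.1 x.2)).2 (gHat D h x.1 x.2 Finset.univ σ.w)
      ⟨hr8.trans (rankBound_le x.1 x.2 σ.w), hg x.1 x.2 σ.w⟩
    have h7 := pow_le_pow_left₀ (norm_nonneg _) ((h₃ hA .id x.1 x.2 Finset.univ).norm_le σ.w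
      (Set.mem_univ _)) 2
    have h8 := mul_le_mul h6 h7 (sq_nonneg _)
      (mul_nonneg hC₁ (by have := excess_nonneg r (σ.u x.1 x.2); positivity))
    linarith
  have b2 := fun q (_ : q ∈ (Finset.univ : Finset Q)) => (h₂ hA σ.w q (fullBatch D q)
    (σ.ua q, σ.ub q, σ.uq q, σ.s q, σ.lam q)
    ⟨hσ.ua q, hσ.ub q, hσ.uq q, hσ.s q, hσ.lam q⟩).2 _ (ht q σ.w)
  have c1 := Finset.sum_le_sum b1
  have c2 := Finset.sum_le_sum b2
  rw [← Finset.mul_sum] at c1 c2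
  have d1 := a1.trans (mul_le_mul_of_nonneg_left c1 (by positivity))
  have d2 := a2.trans (mul_le_mul_of_nonneg_left c2 (by positivity))
  have d3 := mul_le_mul_of_nonneg_left d2 (sq_nonneg D.C)
  rw [estimateError]
  set S₁ := ∑ x : Σ q, I q, ((σ.u x.1 x.2 - gHat D h x.1 x.2 Finset.univ σ.w) ^ 2 +
    excess r (σ.u x.1 x.2)) with hS₁
  set S₂ := ∑ q, ((σ.ua q - groupTarget D h q (D.Sa q) σ.w) ^ 2 +
      (σ.ub q - groupTarget D h q (D.Sb q) σ.w) ^ 2 + (σ.uq q - expHat h q Finset.univ σ.w) ^ 2 +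
      (σ.s q - curvTarget D h q σ.w) ^ 2 + (σ.lam q - lamHat D h q σ.w) ^ 2) with hS₂
  have e1 : 0 ≤ S₁ := Finset.sum_nonneg fun x _ => by
    have := excess_nonneg r (σ.u x.1 x.2)
    positivity
  have e2 : 0 ≤ S₂ := Finset.sum_nonneg fun q _ => by positivity
  have e3 : 0 ≤ n * (C₁ * C₃ ^ 2) * S₂ := by positivity
  have e4 : 0 ≤ D.C ^ 2 * (Fintype.card Q * C₂) * S₁ := by positivity
  linarith

end

noncomputable section

/-! ### Tracking a moving target -/

section Tracking

variable {Ω : Type*} [MeasurableSpace Ω] [Finite Ω] [MeasurableSingletonClass Ω] (μ : Measure Ω)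
  [IsProbabilityMeasure μ] {d : ℕ} {M : ℝ} {φ : Param d → ℝ}

/-- The mean squared error after a step `x + γ * δ` of an estimate, when the argument of its target
moves by `-η • G`. Expanding the target to first order makes the mean of `G` appear, so that the
cross term is of order `η` and not `η` times the second moment of `G`. -/
theorem integral_tracking_le (hφ : Tame M φ) {x γ η : ℝ} {w : Param d} (hx : |x| ≤ M)
    (hη : 0 ≤ η) (hηγ : η ≤ γ) {δ : Ω → ℝ} (hδ : ∀ ω, |δ ω| ≤ M) (G : Ω → Param d) :
    ∫ ω, (x + γ * δ ω - φ (w - η • G ω)) ^ 2 ∂μ ≤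
      (x - φ w) ^ 2 + 2 * γ * ((x - φ w) * ∫ ω, δ ω ∂μ) +
      η * M * ((x - φ w) ^ 2 + ‖∫ ω, G ω ∂μ‖ ^ 2) +
      6 * M ^ 2 * γ ^ 2 * (1 + ∫ ω, ‖G ω‖ ^ 2 ∂μ) := by
  set e := x - φ w with he
  have hM := hφ.nonneg
  have he2 : |e| ≤ 2 * M := (abs_sub _ _).trans (by linarith [hφ.abs_le w])
  have hpt : ∀ ω, (x + γ * δ ω - φ (w - η • G ω)) ^ 2 ≤
      e ^ 2 + 2 * γ * (e * δ ω) + 2 * η * e * inner ℝ (gradient φ w) (G ω) +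
        (2 * M ^ 2 * γ ^ 2 + 6 * M ^ 2 * η ^ 2 * ‖G ω‖ ^ 2) := by
    intro ω
    have h1 := hφ.abs_sub_sub_inner_le w (w - η • G ω)
    have h2 := hφ.abs_sub_le (w - η • G ω) w
    have h3 : w - η • G ω - w = -(η • G ω) := by abel
    rw [h3, inner_neg_right, inner_smul_right, norm_neg, norm_smul, Real.norm_of_nonneg hη] at h1
    rw [h3, norm_neg, norm_smul, Real.norm_of_nonneg hη] at h2
    set y := φ (w - η • G ω) - φ w with hy
    set n := ‖G ω‖
    set g := inner ℝ (gradient φ w) (G ω)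
    have h4 : x + γ * δ ω - φ (w - η • G ω) = e + γ * δ ω - y := by
      rw [he, hy]
      ring
    rw [h4]
    have h5 : y ^ 2 ≤ (M * (η * n)) ^ 2 := sq_le_sq' (abs_le.1 h2).1 (abs_le.1 h2).2
    have h6 : (δ ω) ^ 2 ≤ M ^ 2 := sq_le_sq' (abs_le.1 (hδ ω)).1 (abs_le.1 (hδ ω)).2
    have h7 : -(2 * e * (y - -(η * g))) ≤ 2 * (2 * M * (M * (η * n) ^ 2)) := by
      have := mul_le_mul he2 h1 (abs_nonneg _) (by positivity)
      rw [← abs_mul] at this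
      linarith [neg_abs_le (e * (y - -(η * g)))]
    have h8 := mul_le_mul_of_nonneg_left h6 (sq_nonneg γ)
    nlinarith [sq_nonneg (γ * δ ω + y)]
  have hint : ∀ f : Ω → ℝ, Integrable f μ := fun f => Integrable.of_finite
  refine (integral_mono (μ := μ) (hint _) (hint _) hpt).trans ?_
  rw [integral_add (hint _) (hint _), integral_add (hint _) (hint _),
    integral_add (hint _) (hint _), integral_add (hint _) (hint _)]
  simp only [integral_const_mul, integral_inner Integrable.of_finite, integral_const,
    probReal_univ, one_smul]
  set Γ := ∫ ω, G ω ∂μ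
  set S := ∫ ω, ‖G ω‖ ^ 2 ∂μ
  have hS : 0 ≤ S := integral_nonneg fun ω => sq_nonneg _
  have h1 : |inner ℝ (gradient φ w) Γ| ≤ M * ‖Γ‖ := (abs_real_inner_le_norm _ _).trans
    (mul_le_mul_of_nonneg_right (hφ.norm_gradient_le w) (norm_nonneg _))
  have h2 : e * inner ℝ (gradient φ w) Γ ≤ |e| * (M * ‖Γ‖) := by
    refine (le_abs_self _).trans ?_
    rw [abs_mul]
    exact mul_le_mul_of_nonneg_left h1 (abs_nonneg _)
  have h3 := two_mul_le_add_sq |e| ‖Γ‖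
  rw [sq_abs] at h3
  have h4 : 2 * η * e * inner ℝ (gradient φ w) Γ ≤ η * M * (e ^ 2 + ‖Γ‖ ^ 2) := by
    have := mul_le_mul_of_nonneg_left h2 hη
    have := mul_le_mul_of_nonneg_left h3 (mul_nonneg hη hM)
    linarith
  have h5 : η ^ 2 ≤ γ ^ 2 := pow_le_pow_left₀ hη hηγ 2
  have h6 : 6 * M ^ 2 * η ^ 2 * S ≤ 6 * M ^ 2 * γ ^ 2 * S :=
    mul_le_mul_of_nonneg_right (mul_le_mul_of_nonneg_left h5 (by positivity)) hS
  have h7 : 0 ≤ M ^ 2 * γ ^ 2 := by positivity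
  linarith

/-- `integral_tracking_le` for a moving average `x` that is updated on an event of probability `π`
only, with an input of mean `m`. -/
theorem integral_moving_average_le (hφ : Tame M φ) {x γ η π m : ℝ} {w : Param d} (hx : |x| ≤ M)
    (hη : 0 ≤ η) (hηγ : η ≤ γ) {p : Ω → Prop} [DecidablePred p] {y : Ω → ℝ} (hy : ∀ ω, |y ω| ≤ M)
    (hπ : 0 ≤ π) (hm : ∫ ω, (if p ω then y ω - x else 0) ∂μ = π * (m - x)) (G : Ω → Param d) :
    ∫ ω, ((if p ω then γ * y ω + (1 - γ) * x else x) - φ (w - η • G ω)) ^ 2 ∂μ ≤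
      (x - φ w) ^ 2 + γ * π * ((m - φ w) ^ 2 - (x - φ w) ^ 2) +
      η * (2 * M) * ((x - φ w) ^ 2 + ‖∫ ω, G ω ∂μ‖ ^ 2) +
      24 * M ^ 2 * γ ^ 2 * (1 + ∫ ω, ‖G ω‖ ^ 2 ∂μ) := by
  have hM := hφ.nonneg
  have h1 := integral_tracking_le μ (hφ.mono (by linarith : M ≤ 2 * M)) (w := w)
    (hx.trans (by linarith)) hη hηγ (δ := fun ω => if p ω then y ω - x else 0) (fun ω => by
      split_ifs
      · exact (abs_sub _ _).trans (by linarith [hy ω])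
      · simpa using hM) G
  have h2 : ∀ ω, x + γ * (if p ω then y ω - x else 0) =
      if p ω then γ * y ω + (1 - γ) * x else x := fun ω => by
    split_ifs <;> ring
  simp only [h2, hm] at h1
  refine h1.trans ?_
  have h3 : 2 * ((x - φ w) * (π * (m - x))) ≤ π * ((m - φ w) ^ 2 - (x - φ w) ^ 2) := by
    nlinarith [mul_nonneg hπ (sq_nonneg (m - x))]
  have h4 := mul_le_mul_of_nonneg_left h3 (hη.trans hηγ)
  linarith

end Tracking

end

noncomputable section

/-! ### Shadow points and the setting of one iteration -/

variable {Q : Type*} {I : Q → Type*} [Fintype Q] [∀ q, Fintype (I q)] [DecidableEq Q]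
  [∀ q, DecidableEq (I q)] {d : ℕ}

/-- The point whose increments are multiples of the stochastic direction, if the momentum rate is
`1 / 2`. -/
def State.shadow (σ : State I d) (η : ℝ) : Param d := σ.w - η • σ.z

/-- Step sizes of the algorithm: one rate for all moving averages of scalars, momentum `1 / 2`, and
step lengths proportional to the rate. -/
def stepSizes (c₀ c₁ γ : ℝ) (hγ : 0 < γ ∧ γ ≤ 1) (h₀ : 0 ≤ c₀) (h₁ : 0 < c₁) : StepParams where
  γ₀ := γ
  γ₁ := γ
  γ₂ := γ
  γ₃ := γ
  γ₄ := γ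
  γ₅ := 1 / 2
  η₀ := c₀ * γ
  η₁ := c₁ * γ
  γ₀_mem := ⟨hγ.1.le, hγ.2⟩
  γ₁_mem := ⟨hγ.1.le, hγ.2⟩
  γ₂_mem := ⟨hγ.1.le, hγ.2⟩
  γ₃_mem := ⟨hγ.1.le, hγ.2⟩
  γ₄_mem := ⟨hγ.1.le, hγ.2⟩
  γ₅_mem := by norm_num
  η₀_nonneg := mul_nonneg h₀ hγ.1.le
  η₁_pos := mul_pos h₁ hγ.1

/-- The ratio of the step length of the lower level to the rate of its moving averages. It is chosen
so that its product with the curvature, which is at most `τ₂ + τ₁⁻¹`, is at most `1 / 4`. -/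
def Problem.lowerRate (D : Problem Q I) : ℝ := (4 * (D.τ₂ + D.τ₁⁻¹))⁻¹

theorem Problem.lowerRate_pos (D : Problem Q I) : 0 < D.lowerRate := by
  have := D.τ₁_pos
  have := D.τ₂_pos
  unfold Problem.lowerRate
  positivity

theorem Problem.lowerRate_mul_le (D : Problem Q I) {m : ℝ} (hm : m ≤ D.τ₂ + D.τ₁⁻¹) :
    D.lowerRate * m ≤ 1 / 4 := by
  have := D.τ₁_pos
  have := D.τ₂_pos
  rw [Problem.lowerRate, inv_mul_le_iff₀ (by positivity)]
  linarith

/-- A combination of the lower-level estimates that moves by a multiple of the stochastic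
derivative of the lower-level objective. -/
def State.lowerShadow (σ : State I d) (c₀ γ : ℝ) (q : Q) : ℝ := σ.lam q - c₀ * ((1 - γ) * σ.v q)

/-- The region that the iterates do not leave. -/
structure State.Confined (σ : State I d) (c₀ γ L ρ V P : ℝ) : Prop extends σ.Bounded L ρ where
  v : ∀ q, |σ.v q| ≤ V
  lowerShadow : ∀ q, |σ.lowerShadow c₀ γ q| ≤ P

/-- Bounds, by a single constant `M`, of the functions that enter an iteration, for estimates in the
region given by `L`, `ρ`, `V`, `P` and the threshold `r` of the excess. -/
structure Control (D : Problem Q I) (h : Score I d) (L ρ r V P M : ℝ) : Prop where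
  one_le : 1 ≤ M
  box_le : L ≤ M
  shadow_le : P ≤ M
  vel_le : D.lowerRate * V ≤ M
  tame_lamHat : ∀ q, Tame M (lamHat D h q)
  tame_groupTarget : ∀ q B, Tame M (groupTarget D h q B)
  tame_gHat : ∀ q i B, Tame M (gHat D h q i B)
  tame_expHat : ∀ q B, Tame M (expHat h q B)
  tame_curvTarget : ∀ q, Tame M (curvTarget D h q)
  tame_objective : Tame M (objective D h)
  abs_groupHat_le : ∀ q B w l, |l| ≤ L → |groupHat D h q B w l| ≤ M
  abs_groupHat_sub_le : ∀ q B w l l', |l| ≤ L → |l'| ≤ L →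
    |groupHat D h q B w l - groupHat D h q B w l'| ≤ M * |l - l'|
  curv_le : D.τ₂ + D.τ₁⁻¹ ≤ M
  abs_curv_sub_le : ∀ q w l l', |l| ≤ L → |l'| ≤ L →
    |deriv (deriv (lowerBatch D h q Finset.univ w)) l -
      deriv (deriv (lowerBatch D h q Finset.univ w)) l'| ≤ M * |l - l'|
  abs_deriv_le : ∀ q B w l, |l| ≤ L → D.lowerRate * |deriv (lowerBatch D h q B w) l| ≤ M
  abs_lamHat_le : ∀ q w, |lamHat D h q w| ≤ L
  norm_dir_sq_le : ∀ σ : State I d, σ.Bounded L ρ → ∀ b, ‖dir D h b σ‖ ^ 2 ≤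
    M * (1 + ∑ x : Σ q, I q, excess r (σ.u x.1 x.2))
  norm_bias_sq_le : ∀ σ : State I d, σ.Bounded L ρ →
    ‖fullDir D h σ.w σ.u σ.ua σ.ub σ.uq σ.s σ.lam - trueDir D h σ.w‖ ^ 2 ≤
      M * estimateError D h r σ σ.w

section OneStep

variable {D : Problem Q I} {p : SamplingLaws Q I} {h : Score I d} {L ρ r V P M c₁ γ a : ℝ}
  {σ : State I d}

theorem sq_sub_shadow_le {φ : Param d → ℝ} (hφ : Tame M φ) (σ : State I d) (η : ℝ) :
    (φ σ.w - φ (σ.shadow η)) ^ 2 ≤ M ^ 2 * (η ^ 2 * ‖σ.z‖ ^ 2) := by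
  have h1 := hφ.abs_sub_le σ.w (σ.shadow η)
  have h2 : σ.w - σ.shadow η = η • σ.z := by
    rw [State.shadow]
    abel
  rw [h2, norm_smul, Real.norm_eq_abs] at h1
  have h3 := pow_le_pow_left₀ (abs_nonneg _) h1 2
  rw [sq_abs, mul_pow, mul_pow, sq_abs] at h3
  exact h3

/-- The form of the one-step bounds: contraction at rate `a γ` of the squared error `e`, up to the
drift `t` of the target, the displacement of the shadow point, and noise. -/
theorem moving_average_bound {e t m π η S N : ℝ} (hM : 1 ≤ M) (ha : a ≤ π) (hπ : π ≤ 1)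
    (hγ : 0 ≤ γ) (hη : 0 ≤ η) (he : 0 ≤ e) (hm0 : 0 ≤ m) (hm : m ≤ 32 * M ^ 4 * t)
    (hN : 0 ≤ N) (hS : 0 ≤ S) :
    e + γ * π * (m - e) + η * (2 * M) * (e + N) + 24 * M ^ 2 * γ ^ 2 * (1 + S) ≤
      e - a * γ * e + 32 * M ^ 4 * (γ * t + η * (e + N) + γ ^ 2 * (1 + S)) := by
  have h1 : γ * π * m ≤ 32 * M ^ 4 * (γ * t) := by
    have h2 := mul_le_mul_of_nonneg_left hm hγ
    have h3 : γ * m * π ≤ γ * m * 1 := mul_le_mul_of_nonneg_left hπ (mul_nonneg hγ hm0)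
    linarith
  have h4 : a * γ * e ≤ γ * π * e := by
    have := mul_le_mul_of_nonneg_right ha (mul_nonneg hγ he)
    linarith
  have hM2 : M ^ 2 ≤ M ^ 4 := pow_le_pow_right₀ hM (by norm_num)
  have hM1 : M ≤ M ^ 4 := le_self_pow₀ hM (by norm_num)
  have h5 : η * (2 * M) * (e + N) ≤ 32 * M ^ 4 * (η * (e + N)) := by
    have h6 : 2 * M ≤ 32 * M ^ 4 := by linarith
    have := mul_le_mul_of_nonneg_right h6 (mul_nonneg hη (add_nonneg he hN))
    linarith
  have h7 : 24 * M ^ 2 * γ ^ 2 * (1 + S) ≤ 32 * M ^ 4 * (γ ^ 2 * (1 + S)) := by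
    have h6 : 24 * M ^ 2 ≤ 32 * M ^ 4 := by linarith
    have := mul_le_mul_of_nonneg_right h6 (by positivity : 0 ≤ γ ^ 2 * (1 + S))
    linarith
  linarith

/-- With momentum rate `1 / 2`, the shadow point moves by the stochastic direction of the current
iteration alone. -/
theorem shadow_step (hγ : 0 < γ ∧ γ ≤ 1) (h₁ : 0 < c₁) (b : Batch Q I) :
    (step D h (stepSizes D.lowerRate c₁ γ hγ D.lowerRate_pos.le h₁) b σ).shadow (c₁ * γ) =
      σ.shadow (c₁ * γ) - (c₁ * γ) • dir D h b σ := by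
  simp only [State.shadow, step, stepSizes, dir]
  module

/-- The lower shadow moves by the stochastic derivative of the current iteration alone. -/
theorem lowerShadow_step (hγ : 0 < γ ∧ γ ≤ 1) (h₁ : 0 < c₁) (b : Batch Q I) (q : Q) :
    (step D h (stepSizes D.lowerRate c₁ γ hγ D.lowerRate_pos.le h₁) b σ).lowerShadow
      D.lowerRate γ q = σ.lowerShadow D.lowerRate γ q + γ * (if q ∈ queriesOf b.1 then
        -(D.lowerRate * deriv (lowerBatch D h q (b.2 q).1 σ.w) (σ.lam q)) else 0) := by
  simp only [State.lowerShadow, step, stepSizes]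
  split_ifs <;> ring

/-- The squared error of the lower-level estimates of a query. -/
def State.lowerError (D : Problem Q I) (h : Score I d) (σ : State I d) (γ : ℝ) (q : Q)
    (w : Param d) : ℝ :=
  (σ.lowerShadow D.lowerRate γ q - lamHat D h q w) ^ 2 + (D.lowerRate * σ.v q) ^ 2

theorem sq_lam_sub_lamHat_le (hc : Control D h L ρ r V P M) (hγ : 0 < γ ∧ γ ≤ 1) (q : Q) (η : ℝ) :
    (σ.lam q - lamHat D h q σ.w) ^ 2 ≤
      3 * M ^ 2 * (σ.lowerError D h γ q (σ.shadow η) + η ^ 2 * ‖σ.z‖ ^ 2) := by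
  have h1 := sq_sub_shadow_le (hc.tame_lamHat q) σ η
  have hM := one_le_pow₀ hc.one_le (n := 2)
  set y := lamHat D h q σ.w
  set y' := lamHat D h q (σ.shadow η)
  set b := D.lowerRate * σ.v q with hb
  set δ := σ.lowerShadow D.lowerRate γ q - y' with hδ
  have h2 : σ.lam q - y = δ + (1 - γ) * b + (y' - y) := by
    rw [hδ, hb, State.lowerShadow]
    ring
  have h3 : ((1 - γ) * b) ^ 2 ≤ b ^ 2 := by
    rw [mul_pow]
    refine mul_le_of_le_one_left (sq_nonneg b) (pow_le_one₀ (by linarith [hγ.2]) ?_)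
    linarith [hγ.1]
  have h4 : (σ.lam q - y) ^ 2 ≤ 3 * (δ ^ 2 + b ^ 2 + (y - y') ^ 2) := by
    rw [h2]
    nlinarith [sq_nonneg (δ - (1 - γ) * b), sq_nonneg (δ - (y' - y)),
      sq_nonneg ((1 - γ) * b - (y' - y))]
  have h5 : δ ^ 2 + b ^ 2 ≤ M ^ 2 * (δ ^ 2 + b ^ 2) :=
    le_mul_of_one_le_left (by positivity) hM
  rw [State.lowerError]
  linarith

/-- The error made by an average that is taken at the lower-level iterate and at `w`, instead of at
the lower-level solution and the shadow point. -/
theorem sq_moving_target_le {φ : Param d → ℝ} (hφ : Tame M φ) {M' y t η : ℝ} (hM : 1 ≤ M)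
    (hy : |y - φ σ.w| ≤ M * |t|) (ht : t ^ 2 ≤ 3 * M ^ 2 * (M' + η ^ 2 * ‖σ.z‖ ^ 2))
    (hM' : 0 ≤ M') :
    (y - φ (σ.shadow η)) ^ 2 ≤ 32 * M ^ 4 * (M' + η ^ 2 * ‖σ.z‖ ^ 2) := by
  have h1 := sq_sub_shadow_le hφ σ η
  have h2 := pow_le_pow_left₀ (abs_nonneg _) hy 2
  rw [sq_abs, mul_pow, sq_abs] at h2
  have h4 := add_sq_le (a := y - φ σ.w) (b := φ σ.w - φ (σ.shadow η))
  rw [sub_add_sub_cancel] at h4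
  have h5 := mul_le_mul_of_nonneg_left ht (sq_nonneg M)
  have hM2 : M ^ 2 ≤ M ^ 4 := pow_le_pow_right₀ hM (by norm_num)
  have h6 : 0 ≤ η ^ 2 * ‖σ.z‖ ^ 2 := by positivity
  have h7 := mul_le_mul_of_nonneg_right hM2 h6
  have h8 : 0 ≤ M ^ 4 * M' := by positivity
  have h9 : 0 ≤ M ^ 4 * (η ^ 2 * ‖σ.z‖ ^ 2) := by positivity
  have h10 : M ^ 2 * (3 * M ^ 2 * (M' + η ^ 2 * ‖σ.z‖ ^ 2)) =
      3 * (M ^ 4 * M' + M ^ 4 * (η ^ 2 * ‖σ.z‖ ^ 2)) := by ring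
  linarith

variable (D h p σ) in
/-- The mean of the direction. -/
def meanDir : Param d := ∫ b, dir D h b σ ∂p.law

variable (D h p σ) in
/-- The second moment of the direction. -/
def dirMoment : ℝ := ∫ b, ‖dir D h b σ‖ ^ 2 ∂p.law

theorem dirMoment_nonneg : 0 ≤ dirMoment D p h σ := integral_nonneg fun _ => sq_nonneg _

/-- The one-step bound of the error of an estimate that is updated whenever the query `q` is
sampled. -/
theorem integral_sq_query_le (hp : p.Unbiased D) (hM : 1 ≤ M) (hγ : 0 < γ ∧ γ ≤ 1) (h₁ : 0 < c₁)
    (hc₁ : c₁ ≤ 1) (ha0 : 0 ≤ a) {q : Q} (ha : a ≤ p.queryProb q) {φ : Param d → ℝ}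
    (hφ : Tame M φ) {x m t : ℝ} (hx : |x| ≤ M)
    {y : Finset (I q) × Finset (I q) × Finset (I q) → ℝ} (hy : ∀ β, |y β| ≤ M)
    (hm : ∫ β, y β ∂p.queryLaw q = m)
    (hmt : (m - φ (σ.shadow (c₁ * γ))) ^ 2 ≤ 32 * M ^ 4 * t) :
    ∫ b, ((if q ∈ queriesOf b.1 then γ * y (b.2 q) + (1 - γ) * x else x) -
        φ (σ.shadow (c₁ * γ) - (c₁ * γ) • dir D h b σ)) ^ 2 ∂p.law ≤
      (x - φ (σ.shadow (c₁ * γ))) ^ 2 - a * γ * (x - φ (σ.shadow (c₁ * γ))) ^ 2 +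
      32 * M ^ 4 * (γ * t + (c₁ * γ) * ((x - φ (σ.shadow (c₁ * γ))) ^ 2 +
        ‖meanDir D p h σ‖ ^ 2) + γ ^ 2 * (1 + dirMoment D p h σ)) := by
  have hη : 0 ≤ c₁ * γ := mul_nonneg h₁.le hγ.1.le
  have h1 := integral_moving_average_le p.law hφ hx hη (mul_le_of_le_one_left hγ.1.le hc₁)
    (p := fun b : Batch Q I => q ∈ queriesOf b.1) (y := fun b => y (b.2 q)) (fun b => hy _)
    (w := σ.shadow (c₁ * γ)) (π := p.queryProb q) (m := m) (ha0.trans ha) (by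
      rw [p.integral_law_query q fun β => y β - x,
        integral_sub Integrable.of_finite Integrable.of_finite, hm]
      simp) (fun b => dir D h b σ)
  exact h1.trans (moving_average_bound hM ha (hp.queryProb_mem q).2 hγ.1.le hη (sq_nonneg _)
    (sq_nonneg _) hmt (sq_nonneg _) dirMoment_nonneg)

/-- The one-step bound of the error of an estimate that is updated whenever the pair `⟨q, i⟩` is
sampled. -/
theorem integral_sq_pair_le (hp : p.Unbiased D) (hM : 1 ≤ M) (hγ : 0 < γ ∧ γ ≤ 1) (h₁ : 0 < c₁)
    (hc₁ : c₁ ≤ 1) (ha0 : 0 ≤ a) {q : Q} {i : I q} (ha : a ≤ p.pairProb ⟨q, i⟩)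
    {φ : Param d → ℝ} (hφ : Tame M φ) {x m t : ℝ} (hx : |x| ≤ M)
    {y : Finset (I q) × Finset (I q) × Finset (I q) → ℝ} (hy : ∀ β, |y β| ≤ M)
    (hm : ∫ β, y β ∂p.queryLaw q = m)
    (hmt : (m - φ (σ.shadow (c₁ * γ))) ^ 2 ≤ 32 * M ^ 4 * t) :
    ∫ b, ((if (⟨q, i⟩ : Σ q, I q) ∈ b.1 then γ * y (b.2 q) + (1 - γ) * x else x) -
        φ (σ.shadow (c₁ * γ) - (c₁ * γ) • dir D h b σ)) ^ 2 ∂p.law ≤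
      (x - φ (σ.shadow (c₁ * γ))) ^ 2 - a * γ * (x - φ (σ.shadow (c₁ * γ))) ^ 2 +
      32 * M ^ 4 * (γ * t + (c₁ * γ) * ((x - φ (σ.shadow (c₁ * γ))) ^ 2 +
        ‖meanDir D p h σ‖ ^ 2) + γ ^ 2 * (1 + dirMoment D p h σ)) := by
  have hη : 0 ≤ c₁ * γ := mul_nonneg h₁.le hγ.1.le
  have h1 := integral_moving_average_le p.law hφ hx hη (mul_le_of_le_one_left hγ.1.le hc₁)
    (p := fun b : Batch Q I => (⟨q, i⟩ : Σ q, I q) ∈ b.1) (y := fun b => y (b.2 q))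
    (fun b => hy _) (w := σ.shadow (c₁ * γ)) (π := p.pairProb ⟨q, i⟩) (m := m) (ha0.trans ha) (by
      rw [p.integral_law_pair q i fun β => y β - x,
        integral_sub Integrable.of_finite Integrable.of_finite, hm]
      simp) (fun b => dir D h b σ)
  exact h1.trans (moving_average_bound hM ha (hp.pairProb_mem ⟨q, i⟩).2 hγ.1.le hη
    (sq_nonneg _) (sq_nonneg _) hmt (sq_nonneg _) dirMoment_nonneg)

/-- The drift of the lower-level estimates: heavy-ball momentum on a quadratic of curvature
`k / c₀`, in the coordinates in which the momentum decouples up to the rate `γ`. -/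
theorem lower_drift_le {k x b e : ℝ} (hγ : 0 ≤ γ) (hγ8 : γ ≤ 1 / 8) (hk0 : 0 ≤ k)
    (hk : k ≤ 1 / 4) :
    2 * (x * -(k * (x + (1 - γ) * b + e))) + 2 * (b * (k * (x + (1 - γ) * b + e) - b)) ≤
      -k * (x ^ 2 + b ^ 2) + e ^ 2 := by
  have h1 : γ * (x * b) ≤ 1 / 16 * (x ^ 2 + b ^ 2) := by
    nlinarith [mul_nonneg hγ (sq_nonneg (x - b)),
      mul_nonneg (sub_nonneg.2 hγ8) (add_nonneg (sq_nonneg x) (sq_nonneg b))]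
  have h2 : e * (b - x) ≤ 2 * e ^ 2 + 1 / 4 * (x ^ 2 + b ^ 2) := by
    nlinarith [sq_nonneg (4 * e - (b - x)), sq_nonneg (x + b)]
  have h3 := mul_le_mul_of_nonneg_left h1 hk0
  have h4 := mul_le_mul_of_nonneg_left h2 hk0
  have h5 : k * (4 * e ^ 2) ≤ e ^ 2 := by nlinarith [sq_nonneg e]
  have h6 : 0 ≤ k * γ * b ^ 2 := by positivity
  have h7 : k * b ^ 2 ≤ 1 / 4 * b ^ 2 := mul_le_mul_of_nonneg_right hk (sq_nonneg b)
  nlinarith [sq_nonneg x, sq_nonneg b, mul_nonneg hk0 (sq_nonneg x)]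

end OneStep

end

noncomputable section

/-! ### One-step bounds of the lower-level errors -/

variable {Q : Type*} {I : Q → Type*} [Fintype Q] [∀ q, Fintype (I q)] [DecidableEq Q]
  [∀ q, DecidableEq (I q)] {d : ℕ} {D : Problem Q I} {p : SamplingLaws Q I} {h : Score I d}
  {L ρ r V P M c₁ γ a : ℝ} {σ : State I d}

/-- The one-step bound of the error of the lower-level estimates of a query. Both components are
instances of `integral_tracking_le`, the second one with target `0`, and `lower_drift_le` bounds the
sum of the cross terms. -/
theorem integral_lowerError_le (hp : p.Unbiased D) (hc : Control D h L ρ r V P M)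
    (hσ : σ.Confined D.lowerRate γ L ρ V P) (hγ : 0 < γ ∧ γ ≤ 1) (hγ8 : γ ≤ 1 / 8) (h₁ : 0 < c₁)
    (hc₁ : c₁ ≤ 1) {q : Q} (ha : a ≤ p.queryProb q * (D.lowerRate * D.τ₂)) :
    ∫ b, (step D h (stepSizes D.lowerRate c₁ γ hγ D.lowerRate_pos.le h₁) b σ).lowerError D h γ q
        ((step D h (stepSizes D.lowerRate c₁ γ hγ D.lowerRate_pos.le h₁) b σ).shadow
          (c₁ * γ)) ∂p.law ≤
      σ.lowerError D h γ q (σ.shadow (c₁ * γ)) -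
        a * γ * σ.lowerError D h γ q (σ.shadow (c₁ * γ)) +
      32 * M ^ 4 * (γ * ((c₁ * γ) ^ 2 * ‖σ.z‖ ^ 2) +
        (c₁ * γ) * (σ.lowerError D h γ q (σ.shadow (c₁ * γ)) + ‖meanDir D p h σ‖ ^ 2) +
        γ ^ 2 * (1 + dirMoment D p h σ)) := by
  have hc0 := D.lowerRate_pos
  have hM := hc.one_le
  have hη : 0 ≤ c₁ * γ := mul_nonneg h₁.le hγ.1.le
  have hηγ : c₁ * γ ≤ γ := mul_le_of_le_one_left hγ.1.le hc₁
  set w := σ.shadow (c₁ * γ) with hw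
  set x := σ.lowerShadow D.lowerRate γ q - lamHat D h q w with hx
  set b := D.lowerRate * σ.v q with hb
  set e := lamHat D h q w - lamHat D h q σ.w with he
  obtain ⟨m, hm, hme⟩ := exists_deriv_lower_eq D (h := h) q σ.w (σ.lam q)
  have hlam : σ.lam q - lamHat D h q σ.w = x + (1 - γ) * b + e := by
    rw [hx, hb, he, State.lowerShadow]
    ring
  set k := D.lowerRate * m with hk
  have hk0 : 0 ≤ k := mul_nonneg hc0.le (D.τ₂_pos.le.trans hm.1)
  have hk4 : k ≤ 1 / 4 := D.lowerRate_mul_le hm.2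
  set g : Finset (I q) × Finset (I q) × Finset (I q) → ℝ :=
    fun β => D.lowerRate * deriv (lowerBatch D h q β.1 σ.w) (σ.lam q) with hg
  have hgM : ∀ β, |g β| ≤ M := fun β => by
    rw [hg, abs_mul, abs_of_pos hc0]
    exact hc.abs_deriv_le q _ σ.w _ (hσ.lam q)
  have hgi : ∫ β, g β ∂p.queryLaw q = k * (x + (1 - γ) * b + e) := by
    rw [hg, integral_const_mul, hp.integral_deriv_lowerBatch, hme, hlam, hk, mul_assoc]
  have hbM : |b| ≤ M := by
    rw [hb, abs_mul, abs_of_pos hc0]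
    exact (mul_le_mul_of_nonneg_left (hσ.v q) hc0.le).trans hc.vel_le
  have e1 : ∀ β, (step D h (stepSizes D.lowerRate c₁ γ hγ D.lowerRate_pos.le h₁) β σ).lowerError
      D h γ q ((step D h (stepSizes D.lowerRate c₁ γ hγ D.lowerRate_pos.le h₁) β σ).shadow
        (c₁ * γ)) = (σ.lowerShadow D.lowerRate γ q +
        γ * (if q ∈ queriesOf β.1 then -g (β.2 q) else 0) -
          lamHat D h q (w - (c₁ * γ) • dir D h β σ)) ^ 2 +
        (b + γ * (if q ∈ queriesOf β.1 then g (β.2 q) - b else 0) -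
          (fun _ : Param d => (0 : ℝ)) (w - (c₁ * γ) • dir D h β σ)) ^ 2 := by
    intro β
    rw [State.lowerError, shadow_step, lowerShadow_step]
    congr 2
    simp only [step, stepSizes, hb, hg, sub_zero]
    split_ifs <;> ring
  simp only [e1]
  rw [integral_add (p.integrable_law _) (p.integrable_law _)]
  have t1 := integral_tracking_le p.law (hc.tame_lamHat q) (w := w)
    ((hσ.lowerShadow q).trans hc.shadow_le) hη hηγ
    (δ := fun β : Batch Q I => if q ∈ queriesOf β.1 then -g (β.2 q) else 0) (fun β => by
      split_ifs
      · rw [abs_neg]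
        exact hgM _
      · simp only [abs_zero]
        linarith) (fun β => dir D h β σ)
  have t2 := integral_tracking_le p.law
    (Tame.const (d := d) (c := 0) (by simp only [abs_zero]; linarith : |(0 : ℝ)| ≤ 2 * M)) (w := w)
    (by linarith : |b| ≤ 2 * M) hη hηγ
    (δ := fun β : Batch Q I => if q ∈ queriesOf β.1 then g (β.2 q) - b else 0) (fun β => by
      split_ifs
      · exact (abs_sub _ _).trans (by linarith [hgM (β.2 q)])
      · simp only [abs_zero]
        linarith) (fun β => dir D h β σ)
  rw [p.integral_law_query q fun β => -g β, integral_neg, hgi] at t1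
  rw [p.integral_law_query q fun β => g β - b,
    integral_sub Integrable.of_finite Integrable.of_finite, hgi] at t2
  simp only [integral_const, probReal_univ, smul_eq_mul, one_mul, sub_zero] at t1 t2 ⊢
  have hπ := hp.queryProb_mem q
  set π := p.queryProb q
  have hπ0 : 0 ≤ π := le_trans (by positivity) hπ.1
  have hdrift := mul_le_mul_of_nonneg_left
    (lower_drift_le (x := x) (b := b) (e := e) hγ.1.le hγ8 hk0 hk4) (mul_nonneg hγ.1.le hπ0)
  have hE : σ.lowerError D h γ q w = x ^ 2 + b ^ 2 := rfl
  rw [hE]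
  have hζ := sq_sub_shadow_le (hc.tame_lamHat q) σ (c₁ * γ)
  rw [← hw, ← neg_sub, neg_sq, ← he] at hζ
  change _ ≤ x ^ 2 + 2 * γ * (x * (π * _)) + _ + _ at t1
  rw [← hx] at t1
  set N := ‖meanDir D p h σ‖ ^ 2 with hN
  have hN' : ‖∫ β, dir D h β σ ∂p.law‖ ^ 2 = N := rfl
  have hS' : ∫ β, ‖dir D h β σ‖ ^ 2 ∂p.law = dirMoment D p h σ := rfl
  rw [hN', hS'] at t1 t2
  have hS : 0 ≤ dirMoment D p h σ := dirMoment_nonneg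
  have hN0 : 0 ≤ N := sq_nonneg _
  set S := dirMoment D p h σ
  set ζ := (c₁ * γ) ^ 2 * ‖σ.z‖ ^ 2
  have hζ0 : 0 ≤ ζ := by positivity
  have hM2 : M ^ 2 ≤ M ^ 4 := pow_le_pow_right₀ hM (by norm_num)
  have hM1 : M ≤ M ^ 4 := le_self_pow₀ hM (by norm_num)
  have hE0 : 0 ≤ x ^ 2 + b ^ 2 := by positivity
  have c1 : a * γ * (x ^ 2 + b ^ 2) ≤ γ * π * (k * (x ^ 2 + b ^ 2)) := by
    have h2 : D.lowerRate * D.τ₂ ≤ k := mul_le_mul_of_nonneg_left hm.1 hc0.le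
    have h3 := mul_le_mul_of_nonneg_right (ha.trans (mul_le_mul_of_nonneg_left h2 hπ0))
      (mul_nonneg hγ.1.le hE0)
    linarith
  have c2 : γ * π * e ^ 2 ≤ 32 * M ^ 4 * (γ * ζ) := by
    have h2 : γ * π * e ^ 2 ≤ γ * e ^ 2 := mul_le_mul_of_nonneg_right
      (mul_le_of_le_one_right hγ.1.le hπ.2) (sq_nonneg e)
    have h3 : e ^ 2 ≤ 32 * M ^ 4 * ζ :=
      hζ.trans (mul_le_mul_of_nonneg_right (by linarith) hζ0)
    have := mul_le_mul_of_nonneg_left h3 hγ.1.le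
    linarith
  have c3 : c₁ * γ * M * (x ^ 2 + N) + c₁ * γ * (2 * M) * (b ^ 2 + N) ≤
      32 * M ^ 4 * (c₁ * γ * (x ^ 2 + b ^ 2 + N)) := by
    have h2 : 3 * M ≤ 32 * M ^ 4 := by linarith
    have := mul_le_mul_of_nonneg_right h2 (mul_nonneg hη (add_nonneg hE0 hN0))
    have := mul_nonneg (mul_nonneg hη (by linarith : 0 ≤ M)) (sq_nonneg x)
    have := mul_nonneg (mul_nonneg hη (by linarith : 0 ≤ M)) (sq_nonneg b)
    linarith
  have c4 : 6 * M ^ 2 * γ ^ 2 * (1 + S) + 6 * (2 * M) ^ 2 * γ ^ 2 * (1 + S) ≤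
      32 * M ^ 4 * (γ ^ 2 * (1 + S)) := by
    have h2 : 30 * M ^ 2 ≤ 32 * M ^ 4 := by linarith
    have := mul_le_mul_of_nonneg_right h2 (by positivity : 0 ≤ γ ^ 2 * (1 + S))
    linarith
  have c5 : 2 * γ * (x * (π * -(k * (x + (1 - γ) * b + e)))) +
      2 * γ * (b * (π * (k * (x + (1 - γ) * b + e) - b))) =
      γ * π * (2 * (x * -(k * (x + (1 - γ) * b + e))) +
        2 * (b * (k * (x + (1 - γ) * b + e) - b))) := by ring
  linarith

/-- Summation of the one-step bounds. -/
theorem sum_step_le {ι : Type*} [Fintype ι] {e e' t : ι → ℝ} {n η G S N X T : ℝ}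
    (he : ∀ i, e' i ≤ e i - a * γ * e i + 32 * M ^ 4 * (γ * t i + η * (e i + G) +
      γ ^ 2 * (1 + S))) (hG : G ≤ 2 * N) (hS : 1 + S ≤ 2 * M * (1 + X))
    (hn : (Fintype.card ι : ℝ) ≤ n) (hn1 : 1 ≤ n) (hM : 1 ≤ M) (ht : ∑ i, t i ≤ n * T)
    (he0 : ∀ i, 0 ≤ e i) (hγ : 0 ≤ γ) (hη : 0 ≤ η) (hN : 0 ≤ N) (hX : 0 ≤ X) (hT : 0 ≤ T) :
    ∑ i, e' i ≤ ∑ i, e i - a * γ * ∑ i, e i +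
      64 * M ^ 5 * n * (γ * T + η * (∑ i, e i + N) + γ ^ 2 * (1 + X)) := by
  refine (Finset.sum_le_sum fun i _ => he i).trans ?_
  simp only [Finset.sum_add_distrib, Finset.sum_sub_distrib, ← Finset.mul_sum, Finset.sum_const,
    Finset.card_univ, nsmul_eq_mul]
  set E := ∑ i, e i
  have hE : 0 ≤ E := Finset.sum_nonneg fun i _ => he0 i
  set ν : ℝ := (Fintype.card ι : ℝ)
  have hν : 0 ≤ ν := by positivity
  have hM0 : 0 ≤ M ^ 4 := by positivity
  have h45 : M ^ 4 ≤ M ^ 5 := pow_le_pow_right₀ hM (by norm_num)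
  have hMn : 32 * M ^ 4 * n ≤ 64 * M ^ 5 * n :=
    mul_le_mul_of_nonneg_right (by linarith) (by linarith)
  have h1 : 32 * M ^ 4 * (γ * ∑ i, t i) ≤ 64 * M ^ 5 * n * (γ * T) := by
    have := mul_le_mul_of_nonneg_left (mul_le_mul_of_nonneg_left ht hγ)
      (by positivity : 0 ≤ 32 * M ^ 4)
    have := mul_le_mul_of_nonneg_right hMn (mul_nonneg hγ hT)
    linarith
  have h2 : 32 * M ^ 4 * (η * (E + ν * G)) ≤ 64 * M ^ 5 * n * (η * (E + N)) := by
    have h3 : ν * G ≤ n * (2 * N) :=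
      (mul_le_mul_of_nonneg_left hG hν).trans (mul_le_mul_of_nonneg_right hn (by linarith))
    have h4 : E ≤ n * E := le_mul_of_one_le_left hE hn1
    have h5 : E + ν * G ≤ 2 * n * (E + N) := by linarith
    have := mul_le_mul_of_nonneg_left (mul_le_mul_of_nonneg_left h5 hη)
      (by positivity : 0 ≤ 32 * M ^ 4)
    have h6 : 64 * M ^ 4 * n ≤ 64 * M ^ 5 * n :=
      mul_le_mul_of_nonneg_right (by linarith) (by linarith)
    have := mul_le_mul_of_nonneg_right h6 (mul_nonneg hη (add_nonneg hE hN))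
    linarith
  have h3 : 32 * M ^ 4 * (ν * (γ ^ 2 * (1 + S))) ≤ 64 * M ^ 5 * n * (γ ^ 2 * (1 + X)) := by
    have h4 : ν * (1 + S) ≤ n * (2 * M * (1 + X)) :=
      (mul_le_mul_of_nonneg_left hS hν).trans (mul_le_mul_of_nonneg_right hn (by positivity))
    have := mul_le_mul_of_nonneg_left h4 (by positivity : 0 ≤ 32 * M ^ 4 * γ ^ 2)
    linarith
  simp only [mul_add (32 * M ^ 4)] at *
  linarith

end

noncomputable section

/-! ### One-step bounds of the combined errors -/

variable {Q : Type*} {I : Q → Type*} [Fintype Q] [∀ q, Fintype (I q)] [DecidableEq Q]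
  [∀ q, DecidableEq (I q)] {d : ℕ}

/-- The squared errors of the estimates whose targets do not involve the lower level. -/
def State.rankError (D : Problem Q I) (h : Score I d) (σ : State I d) (w : Param d) : ℝ :=
  ∑ x : Σ q, I q, (σ.u x.1 x.2 - gHat D h x.1 x.2 Finset.univ w) ^ 2 +
    ∑ q, (σ.uq q - expHat h q Finset.univ w) ^ 2

/-- The squared errors of the estimates whose targets involve the lower-level solution. -/
def State.groupError (D : Problem Q I) (h : Score I d) (σ : State I d) (w : Param d) : ℝ :=
  ∑ q, (σ.ua q - groupTarget D h q (D.Sa q) w) ^ 2 +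
    ∑ q, (σ.ub q - groupTarget D h q (D.Sb q) w) ^ 2 + ∑ q, (σ.s q - curvTarget D h q w) ^ 2

/-- The total excess of the rank estimates. -/
def State.excessSum (r : ℝ) (σ : State I d) : ℝ := ∑ x : Σ q, I q, excess r (σ.u x.1 x.2)

/-- The squared bias of the direction. -/
def biasSq (D : Problem Q I) (h : Score I d) (σ : State I d) : ℝ :=
  ‖fullDir D h σ.w σ.u σ.ua σ.ub σ.uq σ.s σ.lam - trueDir D h σ.w‖ ^ 2

variable {D : Problem Q I} {p : SamplingLaws Q I} {h : Score I d}
  {Bh : ℝ} {Ch Lh Ph : ℝ≥0} {L ρ r V P M c₁ γ a n : ℝ} {σ : State I d} {θ : StepParams}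

theorem State.rankError_nonneg (σ : State I d) (w : Param d) : 0 ≤ σ.rankError D h w := by
  unfold State.rankError
  positivity

theorem State.groupError_nonneg (σ : State I d) (w : Param d) : 0 ≤ σ.groupError D h w := by
  unfold State.groupError
  positivity

theorem State.excessSum_nonneg (σ : State I d) : 0 ≤ σ.excessSum r :=
  Finset.sum_nonneg fun _ _ => excess_nonneg _ _

theorem State.lowerError_nonneg (σ : State I d) (q : Q) (w : Param d) :
    0 ≤ σ.lowerError D h γ q w := by
  unfold State.lowerError
  positivity

theorem biasSq_nonneg : 0 ≤ biasSq D h σ := sq_nonneg _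

theorem norm_meanDir_sq_le [Nonempty Q] (hp : p.Unbiased D) (hA : ScoreAssumption h Bh Ch Lh Ph) :
    ‖meanDir D p h σ‖ ^ 2 ≤ 2 * (‖gradient (objective D h) σ.w‖ ^ 2 + biasSq D h σ) := by
  rw [meanDir, hp.integral_dir hA, gradient_objective hA, biasSq]
  have := norm_add_sq_le (trueDir D h σ.w)
    (fullDir D h σ.w σ.u σ.ua σ.ub σ.uq σ.s σ.lam - trueDir D h σ.w)
  rw [add_sub_cancel] at this
  linarith

theorem dirMoment_le (hc : Control D h L ρ r V P M) (hσ : σ.Bounded L ρ) :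
    dirMoment D p h σ ≤ M * (1 + σ.excessSum r) := by
  have := integral_mono (μ := p.law) (p.integrable_law _) (p.integrable_law _)
    (hc.norm_dir_sq_le σ hσ)
  simp only [integral_const, probReal_univ, one_smul] at this
  exact this

theorem one_add_dirMoment_le (hc : Control D h L ρ r V P M) (hσ : σ.Bounded L ρ) :
    1 + dirMoment D p h σ ≤ 2 * M * (1 + σ.excessSum r) := by
  have h1 := dirMoment_le (p := p) hc hσ
  have h2 := mul_le_mul_of_nonneg_right hc.one_le
    (add_nonneg zero_le_one (σ.excessSum_nonneg (r := r)))
  have h3 := σ.excessSum_nonneg (r := r)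
  linarith

/-- The setting of the one-step bounds: the step sizes with rate `γ`, a state in the confined
region, and a contraction factor `a` that is a lower bound of the sampling probabilities and, for
the lower level, of their products with the step ratio and the strong convexity constant. The
threshold `r` of the excess is at most an eighth of the lower bound of the targets of the rank
estimates, and `n` bounds the numbers of pairs and of queries. -/
structure OneStep (D : Problem Q I) (p : SamplingLaws Q I) (h : Score I d) (Bh : ℝ) (Ch Lh Ph : ℝ≥0)
    (L ρ r V P M c₁ γ a n : ℝ) (θ : StepParams) (σ : State I d) : Prop where
  unbiased : p.Unbiased D
  score : ScoreAssumption h Bh Ch Lh Ph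
  control : Control D h L ρ r V P M
  confined : σ.Confined D.lowerRate γ L ρ V P
  rate : 0 < γ ∧ γ ≤ 1
  rate_le : γ ≤ 1 / 8
  ratio_pos : 0 < c₁
  ratio_le : c₁ ≤ 1
  params : θ = stepSizes D.lowerRate c₁ γ rate D.lowerRate_pos.le ratio_pos
  low_nonneg : 0 ≤ ρ
  r_pos : 0 < r
  r_le : 8 * r ≤ rankBound D
  rate_mul_le : γ * M ≤ r / 2
  contraction_pos : 0 < a
  pair : ∀ x, a ≤ p.pairProb x
  query : ∀ q, a ≤ p.queryProb q
  lower : ∀ q, a ≤ p.queryProb q * (D.lowerRate * D.τ₂)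
  one_le : 1 ≤ n
  card_pair : (Fintype.card (Σ q, I q) : ℝ) ≤ n
  card_query : (Fintype.card Q : ℝ) ≤ n

namespace OneStep

theorem integral_rankError_le [Nonempty Q]
    (H : OneStep D p h Bh Ch Lh Ph L ρ r V P M c₁ γ a n θ σ) :
    ∫ b, (step D h θ b σ).rankError D h ((step D h θ b σ).shadow (c₁ * γ)) ∂p.law ≤
      σ.rankError D h (σ.shadow (c₁ * γ)) - a * γ * σ.rankError D h (σ.shadow (c₁ * γ)) +
      2 * (64 * M ^ 5 * n) * (γ * ((c₁ * γ) ^ 2 * ‖σ.z‖ ^ 2) +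
        (c₁ * γ) * (σ.rankError D h (σ.shadow (c₁ * γ)) +
          (‖gradient (objective D h) σ.w‖ ^ 2 + biasSq D h σ)) +
        γ ^ 2 * (1 + σ.excessSum r)) := by
  obtain ⟨hp, hA, hc, hσ, hγ, hγ8, h₁, hc₁, rfl, hρ, hr, hr8, hγM, ha, hpair, hquery, -, hn, hn1,
    hn2⟩ := H
  simp only [State.rankError, shadow_step]
  rw [integral_add (p.integrable_law _) (p.integrable_law _),
    integral_finsetSum _ fun _ _ => p.integrable_law _,
    integral_finsetSum _ fun _ _ => p.integrable_law _]
  have hM := hc.one_le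
  have hM24 : M ^ 2 ≤ 32 * M ^ 4 := by
    have : M ^ 2 ≤ M ^ 4 := pow_le_pow_right₀ hM (by norm_num)
    nlinarith [sq_nonneg M]
  have hη : 0 ≤ c₁ * γ := mul_nonneg h₁.le hγ.1.le
  set w := σ.shadow (c₁ * γ) with hw
  have hζ0 : 0 ≤ (c₁ * γ) ^ 2 * ‖σ.z‖ ^ 2 := by positivity
  have hG := norm_meanDir_sq_le (σ := σ) hp hA
  have hS := one_add_dirMoment_le (p := p) hc hσ.toBounded
  have hX := σ.excessSum_nonneg (r := r)
  have hN : 0 ≤ ‖gradient (objective D h) σ.w‖ ^ 2 + biasSq D h σ :=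
    add_nonneg (sq_nonneg _) biasSq_nonneg
  have s1 := sum_step_le (fun x : Σ q, I q => integral_sq_pair_le (D := D) (σ := σ) (q := x.1)
    (i := x.2) hp hM hγ h₁ hc₁ ha.le (hpair x) (hc.tame_gHat x.1 x.2 Finset.univ)
    (x := σ.u x.1 x.2) (by
      have := hσ.u x.1 x.2
      rw [abs_of_pos this.1]
      exact this.2.trans hc.box_le)
    (y := fun β => gHat D h x.1 x.2 β.1 σ.w) (fun β => (hc.tame_gHat x.1 x.2 β.1).abs_le _)
    (hp.integral_gHat x.1 x.2 σ.w)
    ((sq_sub_shadow_le (hc.tame_gHat x.1 x.2 _) σ _).trans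
      (mul_le_mul_of_nonneg_right hM24 hζ0))) hG hS hn1 hn hM
    (by simpa using mul_le_mul_of_nonneg_right hn1 hζ0) (fun _ => sq_nonneg _) hγ.1.le hη hN hX hζ0
  have s2 := sum_step_le (fun q : Q => integral_sq_query_le (D := D) (σ := σ) (q := q) hp hM hγ h₁
    hc₁ ha.le (hquery q) (hc.tame_expHat q Finset.univ) (x := σ.uq q) (by
      have := hσ.uq q
      rw [abs_of_nonneg (hρ.trans this.1)]
      exact this.2.trans hc.box_le)
    (y := fun β => expHat h q β.1 σ.w) (fun β => (hc.tame_expHat q β.1).abs_le _)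
    (hp.integral_expHat q σ.w)
    ((sq_sub_shadow_le (hc.tame_expHat q _) σ _).trans
      (mul_le_mul_of_nonneg_right hM24 hζ0))) hG hS hn2 hn hM
    (by simpa using mul_le_mul_of_nonneg_right hn2 hζ0) (fun _ => sq_nonneg _) hγ.1.le hη hN hX hζ0
  rw [← hw] at s1 s2
  have h3 := add_le_add s1 s2
  refine h3.trans (le_of_sub_nonneg ?_)
  set E₁ := ∑ x : Σ q, I q, (σ.u x.1 x.2 - gHat D h x.1 x.2 Finset.univ w) ^ 2
  set E₂ := ∑ q, (σ.uq q - expHat h q Finset.univ w) ^ 2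
  have hE₁ : 0 ≤ E₁ := Finset.sum_nonneg fun _ _ => sq_nonneg _
  have hE₂ : 0 ≤ E₂ := Finset.sum_nonneg fun _ _ => sq_nonneg _
  have : 0 ≤ 64 * M ^ 5 * n * (c₁ * γ * (E₁ + E₂)) := by positivity
  linarith

theorem integral_groupError_le [Nonempty Q]
    (H : OneStep D p h Bh Ch Lh Ph L ρ r V P M c₁ γ a n θ σ) :
    ∫ b, (step D h θ b σ).groupError D h ((step D h θ b σ).shadow (c₁ * γ)) ∂p.law ≤
      σ.groupError D h (σ.shadow (c₁ * γ)) - a * γ * σ.groupError D h (σ.shadow (c₁ * γ)) +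
      3 * (64 * M ^ 5 * n) * (γ * (∑ q, σ.lowerError D h γ q (σ.shadow (c₁ * γ)) +
          (c₁ * γ) ^ 2 * ‖σ.z‖ ^ 2) +
        (c₁ * γ) * (σ.groupError D h (σ.shadow (c₁ * γ)) +
          (‖gradient (objective D h) σ.w‖ ^ 2 + biasSq D h σ)) +
        γ ^ 2 * (1 + σ.excessSum r)) := by
  obtain ⟨hp, hA, hc, hσ, hγ, hγ8, h₁, hc₁, rfl, hρ, hr, hr8, hγM, ha, -, hquery, -, hn, hn1,
    hn2⟩ := H
  have hs : ∀ b q, (step D h (stepSizes D.lowerRate c₁ γ hγ D.lowerRate_pos.le h₁) b σ).s q =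
      if q ∈ queriesOf b.1 then γ * deriv (deriv (lowerBatch D h q (b.2 q).1 σ.w)) (σ.lam q) +
        (1 - γ) * σ.s q else σ.s q := fun b q => by
    simp only [step, stepSizes]
    rw [add_comm]
  simp only [State.groupError, shadow_step, hs]
  rw [integral_add (p.integrable_law _) (p.integrable_law _),
    integral_add (p.integrable_law _) (p.integrable_law _),
    integral_finsetSum _ fun _ _ => p.integrable_law _,
    integral_finsetSum _ fun _ _ => p.integrable_law _,
    integral_finsetSum _ fun _ _ => p.integrable_law _]
  have hM := hc.one_le
  have hη : 0 ≤ c₁ * γ := mul_nonneg h₁.le hγ.1.le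
  set w := σ.shadow (c₁ * γ) with hw
  have hζ0 : 0 ≤ (c₁ * γ) ^ 2 * ‖σ.z‖ ^ 2 := by positivity
  have hG := norm_meanDir_sq_le (σ := σ) hp hA
  have hS := one_add_dirMoment_le (p := p) hc hσ.toBounded
  have hX := σ.excessSum_nonneg (r := r)
  have hN : 0 ≤ ‖gradient (objective D h) σ.w‖ ^ 2 + biasSq D h σ :=
    add_nonneg (sq_nonneg _) biasSq_nonneg
  have hL0 : ∀ q, 0 ≤ σ.lowerError D h γ q w := fun q => σ.lowerError_nonneg q w
  set Λ := ∑ q, σ.lowerError D h γ q w with hΛ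
  have hΛ0 : 0 ≤ Λ := Finset.sum_nonneg fun q _ => hL0 q
  have hT : ∑ q, (σ.lowerError D h γ q w + (c₁ * γ) ^ 2 * ‖σ.z‖ ^ 2) ≤
      n * (Λ + (c₁ * γ) ^ 2 * ‖σ.z‖ ^ 2) := by
    rw [Finset.sum_add_distrib, ← hΛ, mul_add]
    refine add_le_add (le_mul_of_one_le_left hΛ0 hn) ?_
    simpa using mul_le_mul_of_nonneg_right hn2 hζ0
  have hT0 : 0 ≤ Λ + (c₁ * γ) ^ 2 * ‖σ.z‖ ^ 2 := add_nonneg hΛ0 hζ0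
  have hlam := fun q => sq_lam_sub_lamHat_le (σ := σ) hc hγ q (c₁ * γ)
  have s1 := sum_step_le (fun q : Q => integral_sq_query_le (D := D) (σ := σ) (q := q) hp hM hγ h₁
    hc₁ ha.le (hquery q) (hc.tame_groupTarget q (D.Sa q)) (x := σ.ua q)
    ((hσ.ua q).trans hc.box_le)
    (y := fun β => groupHat D h q β.2.1 σ.w (σ.lam q))
    (fun β => hc.abs_groupHat_le q _ _ _ (hσ.lam q))
    (hp.integral_groupHat_minority q σ.w (σ.lam q))
    (sq_moving_target_le (hc.tame_groupTarget q (D.Sa q)) hM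
      (hc.abs_groupHat_sub_le q _ σ.w _ _ (hσ.lam q) (hc.abs_lamHat_le q σ.w)) (hlam q) (hL0 q)))
    hG hS hn2 hn hM hT (fun _ => sq_nonneg _) hγ.1.le hη hN hX hT0
  have s2 := sum_step_le (fun q : Q => integral_sq_query_le (D := D) (σ := σ) (q := q) hp hM hγ h₁
    hc₁ ha.le (hquery q) (hc.tame_groupTarget q (D.Sb q)) (x := σ.ub q)
    ((hσ.ub q).trans hc.box_le)
    (y := fun β => groupHat D h q β.2.2 σ.w (σ.lam q))
    (fun β => hc.abs_groupHat_le q _ _ _ (hσ.lam q))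
    (hp.integral_groupHat_majority q σ.w (σ.lam q))
    (sq_moving_target_le (hc.tame_groupTarget q (D.Sb q)) hM
      (hc.abs_groupHat_sub_le q _ σ.w _ _ (hσ.lam q) (hc.abs_lamHat_le q σ.w)) (hlam q) (hL0 q)))
    hG hS hn2 hn hM hT (fun _ => sq_nonneg _) hγ.1.le hη hN hX hT0
  have s3 := sum_step_le (fun q : Q => integral_sq_query_le (D := D) (σ := σ) (q := q) hp hM hγ h₁
    hc₁ ha.le (hquery q) (hc.tame_curvTarget q) (x := σ.s q) (by
      have := hσ.s q
      rw [abs_of_nonneg (hρ.trans this.1)]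
      exact this.2.trans hc.box_le)
    (y := fun β => deriv (deriv (lowerBatch D h q β.1 σ.w)) (σ.lam q))
    (fun β => by
      have := deriv_deriv_lowerBatch_mem D (h := h) q β.1 σ.w (σ.lam q)
      rw [abs_of_nonneg (D.τ₂_pos.le.trans this.1)]
      exact this.2.trans hc.curv_le)
    (hp.integral_deriv_deriv_lowerBatch q σ.w (σ.lam q))
    (sq_moving_target_le (hc.tame_curvTarget q) hM
      (hc.abs_curv_sub_le q σ.w _ _ (hσ.lam q) (hc.abs_lamHat_le q σ.w)) (hlam q) (hL0 q)))
    hG hS hn2 hn hM hT (fun _ => sq_nonneg _) hγ.1.le hη hN hX hT0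
  rw [← hw] at s1 s2 s3
  have h3 := add_le_add (add_le_add s1 s2) s3
  refine h3.trans (le_of_sub_nonneg ?_)
  set E₁ := ∑ q, (σ.ua q - groupTarget D h q (D.Sa q) w) ^ 2
  set E₂ := ∑ q, (σ.ub q - groupTarget D h q (D.Sb q) w) ^ 2
  set E₃ := ∑ q, (σ.s q - curvTarget D h q w) ^ 2
  have hE₁ : 0 ≤ E₁ := Finset.sum_nonneg fun _ _ => sq_nonneg _
  have hE₂ : 0 ≤ E₂ := Finset.sum_nonneg fun _ _ => sq_nonneg _
  have hE₃ : 0 ≤ E₃ := Finset.sum_nonneg fun _ _ => sq_nonneg _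
  have : 0 ≤ 64 * M ^ 5 * n * (c₁ * γ * (E₁ + E₂ + E₃)) := by positivity
  linarith

theorem integral_lowerError_sum_le [Nonempty Q]
    (H : OneStep D p h Bh Ch Lh Ph L ρ r V P M c₁ γ a n θ σ) :
    ∫ b, ∑ q, (step D h θ b σ).lowerError D h γ q ((step D h θ b σ).shadow (c₁ * γ)) ∂p.law ≤
      ∑ q, σ.lowerError D h γ q (σ.shadow (c₁ * γ)) -
        a * γ * ∑ q, σ.lowerError D h γ q (σ.shadow (c₁ * γ)) +
      64 * M ^ 5 * n * (γ * ((c₁ * γ) ^ 2 * ‖σ.z‖ ^ 2) +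
        (c₁ * γ) * (∑ q, σ.lowerError D h γ q (σ.shadow (c₁ * γ)) +
          (‖gradient (objective D h) σ.w‖ ^ 2 + biasSq D h σ)) +
        γ ^ 2 * (1 + σ.excessSum r)) := by
  obtain ⟨hp, hA, hc, hσ, hγ, hγ8, h₁, hc₁, rfl, hρ, hr, hr8, hγM, ha, -, -, hlower, hn, hn1,
    hn2⟩ := H
  rw [integral_finsetSum _ fun _ _ => p.integrable_law _]
  have hζ0 : 0 ≤ (c₁ * γ) ^ 2 * ‖σ.z‖ ^ 2 := by positivity
  exact sum_step_le (fun q => integral_lowerError_le hp hc hσ hγ hγ8 h₁ hc₁ (hlower q))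
    (norm_meanDir_sq_le hp hA) (one_add_dirMoment_le hc hσ.toBounded) hn2 hn hc.one_le
    (by simpa using mul_le_mul_of_nonneg_right hn2 hζ0) (fun q => σ.lowerError_nonneg q _)
    hγ.1.le (mul_nonneg h₁.le hγ.1.le) (add_nonneg (sq_nonneg _) biasSq_nonneg) σ.excessSum_nonneg
    hζ0

theorem integral_excessSum_le [Nonempty Q]
    (H : OneStep D p h Bh Ch Lh Ph L ρ r V P M c₁ γ a n θ σ) :
    ∫ b, (step D h θ b σ).excessSum r ∂p.law ≤ σ.excessSum r - a * γ * σ.excessSum r +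
      288 * (r⁻¹) ^ 6 * M ^ 2 * n * (γ * σ.rankError D h (σ.shadow (c₁ * γ)) +
        γ * ((c₁ * γ) ^ 2 * ‖σ.z‖ ^ 2)) := by
  obtain ⟨hp, hA, hc, hσ, hγ, hγ8, h₁, hc₁, rfl, hρ, hr, hr8, hγM, ha, hpair, -, -, hn, hn1,
    hn2⟩ := H
  set w := σ.shadow (c₁ * γ) with hw
  set ζ := (c₁ * γ) ^ 2 * ‖σ.z‖ ^ 2 with hζ
  have hζ0 : 0 ≤ ζ := by positivity
  have hM := hc.one_le
  have hr6 : 0 ≤ 144 * (r⁻¹) ^ 6 * γ := mul_nonneg (by positivity) hγ.1.le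
  have key : ∀ x : Σ q, I q, ∫ b, excess r
      ((step D h (stepSizes D.lowerRate c₁ γ hγ D.lowerRate_pos.le h₁) b σ).u x.1 x.2) ∂p.law ≤
      excess r (σ.u x.1 x.2) - a * γ * excess r (σ.u x.1 x.2) + 144 * (r⁻¹) ^ 6 * γ *
        (2 * (σ.u x.1 x.2 - gHat D h x.1 x.2 Finset.univ w) ^ 2 + 2 * (M ^ 2 * ζ)) := by
    rintro ⟨q, i⟩
    set u := σ.u q i with hu
    have e1 : ∀ b, excess r
        ((step D h (stepSizes D.lowerRate c₁ γ hγ D.lowerRate_pos.le h₁) b σ).u q i) =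
        excess r u + if (⟨q, i⟩ : Σ q, I q) ∈ b.1 then
          excess r (γ * gHat D h q i (b.2 q).1 σ.w + (1 - γ) * u) - excess r u else 0 := fun b => by
      simp only [step, stepSizes]
      split_ifs <;> ring
    simp only [e1]
    rw [integral_add (p.integrable_law _) (p.integrable_law _), p.integral_law_pair q i fun β =>
      excess r (γ * gHat D h q i β.1 σ.w + (1 - γ) * u) - excess r u,
      integral_sub Integrable.of_finite Integrable.of_finite]
    simp only [integral_const, probReal_univ, smul_eq_mul, one_mul]
    have h2 := integral_excess_le (p.queryLaw q) (x := fun β => gHat D h q i β.1 σ.w) hr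
      (hσ.u q i).1 hγ.1.le hγ8
      (fun β => ⟨gHat_nonneg q i _ _, (abs_le.1 ((hc.tame_gHat q i β.1).abs_le σ.w)).2⟩) hγM
      (by rw [hp.integral_gHat]; exact hr8.trans (rankBound_le q i σ.w))
    rw [hp.integral_gHat, ← hu] at h2
    have h3 := sq_sub_shadow_le (hc.tame_gHat q i Finset.univ) σ (c₁ * γ)
    rw [← hw, ← hζ] at h3
    have h4 := add_sq_le (a := u - gHat D h q i Finset.univ w)
      (b := -(gHat D h q i Finset.univ σ.w - gHat D h q i Finset.univ w))
    have h5 : u - gHat D h q i Finset.univ w + -(gHat D h q i Finset.univ σ.w -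
      gHat D h q i Finset.univ w) = u - gHat D h q i Finset.univ σ.w := by ring
    rw [h5, neg_sq] at h4
    have hπ := hp.pairProb_mem ⟨q, i⟩
    have hx := excess_nonneg r u
    set π := p.pairProb ⟨q, i⟩
    have hπ0 : 0 ≤ π := le_trans (by positivity) hπ.1
    have h6 := mul_le_mul_of_nonneg_left (sub_le_sub_right h2 (excess r u)) hπ0
    have h7 : a * (γ * excess r u) ≤ π * (γ * excess r u) :=
      mul_le_mul_of_nonneg_right (hpair ⟨q, i⟩) (mul_nonneg hγ.1.le hx)
    have h8 : π * (144 * (r⁻¹) ^ 6 * γ * (u - gHat D h q i Finset.univ σ.w) ^ 2) ≤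
        144 * (r⁻¹) ^ 6 * γ * (u - gHat D h q i Finset.univ σ.w) ^ 2 :=
      mul_le_of_le_one_left (mul_nonneg hr6 (sq_nonneg _)) hπ.2
    have h9 := mul_le_mul_of_nonneg_left
      (h4.trans (by linarith : _ ≤ 2 * (u - gHat D h q i Finset.univ w) ^ 2 + 2 * (M ^ 2 * ζ))) hr6
    linarith
  simp only [State.excessSum]
  rw [integral_finsetSum _ fun _ _ => p.integrable_law _]
  refine (Finset.sum_le_sum fun x _ => key x).trans ?_
  simp only [Finset.sum_add_distrib, Finset.sum_sub_distrib, ← Finset.mul_sum, Finset.sum_const,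
    Finset.card_univ, nsmul_eq_mul]
  rw [State.rankError]
  set E₁ := ∑ x : Σ q, I q, (σ.u x.1 x.2 - gHat D h x.1 x.2 Finset.univ w) ^ 2
  set E₂ := ∑ q, (σ.uq q - expHat h q Finset.univ w) ^ 2
  have hE₁ : 0 ≤ E₁ := Finset.sum_nonneg fun _ _ => sq_nonneg _
  have hE₂ : 0 ≤ E₂ := Finset.sum_nonneg fun _ _ => sq_nonneg _
  have hM2 : 1 ≤ M ^ 2 := one_le_pow₀ hM
  have h1 : E₁ ≤ M ^ 2 * n * (E₁ + E₂) :=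
    (by linarith : E₁ ≤ E₁ + E₂).trans (le_mul_of_one_le_left (by positivity)
      (one_le_mul_of_one_le_of_one_le hM2 hn))
  have h2 := mul_le_mul_of_nonneg_right hn1 (by positivity : 0 ≤ 2 * (M ^ 2 * ζ))
  have h3 := mul_le_mul_of_nonneg_left
    (by linarith : 2 * E₁ + (Fintype.card (Σ q, I q) : ℝ) * (2 * (M ^ 2 * ζ)) ≤
      2 * (M ^ 2 * n * (E₁ + E₂)) + n * (2 * (M ^ 2 * ζ))) hr6
  linarith

theorem integral_norm_z_sq_le [Nonempty Q]
    (H : OneStep D p h Bh Ch Lh Ph L ρ r V P M c₁ γ a n θ σ) :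
    ∫ b, ‖(step D h θ b σ).z‖ ^ 2 ∂p.law ≤ ‖σ.z‖ ^ 2 / 2 + M * (1 + σ.excessSum r) := by
  have hS := dirMoment_le (p := p) H.control H.confined.toBounded
  have hS0 : 0 ≤ dirMoment D p h σ := dirMoment_nonneg
  have h1 : ∀ b, ‖(step D h θ b σ).z‖ ^ 2 ≤ ‖σ.z‖ ^ 2 / 2 + ‖dir D h b σ‖ ^ 2 / 2 := by
    intro b
    have e : (step D h θ b σ).z = (1 / 2 : ℝ) • (σ.z + dir D h b σ) := by
      rw [H.params]
      simp only [step, stepSizes, dir]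
      norm_num
    rw [e, norm_smul, mul_pow]
    have := norm_add_sq_le σ.z (dir D h b σ)
    norm_num
    linarith
  refine (integral_mono (p.integrable_law _) (p.integrable_law _) h1).trans ?_
  rw [integral_add (p.integrable_law _) (p.integrable_law _)]
  simp only [integral_div, integral_const, probReal_univ, smul_eq_mul, one_mul]
  change _ + dirMoment D p h σ / 2 ≤ _
  linarith

/-- The bias of the direction at `w` in terms of the errors at the shadow point. -/
theorem biasSq_le [Nonempty Q]
    (H : OneStep D p h Bh Ch Lh Ph L ρ r V P M c₁ γ a n θ σ) :
    biasSq D h σ ≤ 20 * M ^ 3 * n * (σ.rankError D h (σ.shadow (c₁ * γ)) + σ.excessSum r +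
      σ.groupError D h (σ.shadow (c₁ * γ)) + ∑ q, σ.lowerError D h γ q (σ.shadow (c₁ * γ)) +
      (c₁ * γ) ^ 2 * ‖σ.z‖ ^ 2) := by
  obtain ⟨hp, hA, hc, hσ, hγ, hγ8, h₁, hc₁, rfl, hρ, hr, hr8, hγM, ha, hpair, -, -, hn, hn1,
    hn2⟩ := H
  refine (hc.norm_bias_sq_le σ hσ.toBounded).trans ?_
  set w := σ.shadow (c₁ * γ) with hw
  set ζ := (c₁ * γ) ^ 2 * ‖σ.z‖ ^ 2 with hζ
  have hζ0 : 0 ≤ ζ := by positivity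
  have hM := hc.one_le
  have hM2 : 1 ≤ M ^ 2 := one_le_pow₀ hM
  have key : ∀ {φ : Param d → ℝ}, Tame M φ → ∀ x : ℝ,
      (x - φ σ.w) ^ 2 ≤ 2 * (x - φ w) ^ 2 + 2 * (M ^ 2 * ζ) := by
    intro φ hφ x
    have h3 := sq_sub_shadow_le hφ σ (c₁ * γ)
    have h4 := add_sq_le (a := x - φ w) (b := -(φ σ.w - φ w))
    have h5 : x - φ w + -(φ σ.w - φ w) = x - φ σ.w := by ring
    rw [h5, neg_sq] at h4
    linarith
  have t1 := Finset.sum_le_sum fun (x : Σ q, I q) (_ : x ∈ Finset.univ) =>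
    add_le_add (key (hc.tame_gHat x.1 x.2 Finset.univ) (σ.u x.1 x.2)) (le_refl
      (excess r (σ.u x.1 x.2)))
  have t2 := Finset.sum_le_sum fun (q : Q) (_ : q ∈ Finset.univ) => add_le_add (add_le_add
    (add_le_add (add_le_add (key (hc.tame_groupTarget q (D.Sa q)) (σ.ua q))
      (key (hc.tame_groupTarget q (D.Sb q)) (σ.ub q)))
      (key (hc.tame_expHat q Finset.univ) (σ.uq q))) (key (hc.tame_curvTarget q) (σ.s q)))
      (sq_lam_sub_lamHat_le (σ := σ) hc hγ q (c₁ * γ))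
  have t3 := add_le_add t1 t2
  rw [← hw, ← hζ] at t3
  simp only [Finset.sum_add_distrib, ← Finset.mul_sum, Finset.sum_const,
    Finset.card_univ, nsmul_eq_mul] at t3
  rw [estimateError, mul_assoc 20, mul_right_comm]
  simp only [State.rankError, State.groupError, State.excessSum]
  simp only [Finset.sum_add_distrib]
  set E₁ := ∑ x : Σ q, I q, (σ.u x.1 x.2 - gHat D h x.1 x.2 Finset.univ w) ^ 2
  set E₂ := ∑ q, (σ.uq q - expHat h q Finset.univ w) ^ 2
  set E₃ := ∑ q, (σ.ua q - groupTarget D h q (D.Sa q) w) ^ 2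
  set E₄ := ∑ q, (σ.ub q - groupTarget D h q (D.Sb q) w) ^ 2
  set E₅ := ∑ q, (σ.s q - curvTarget D h q w) ^ 2
  set Λ := ∑ q, σ.lowerError D h γ q w
  set X := ∑ x : Σ q, I q, excess r (σ.u x.1 x.2)
  have hE₁ : 0 ≤ E₁ := Finset.sum_nonneg fun _ _ => sq_nonneg _
  have hE₂ : 0 ≤ E₂ := Finset.sum_nonneg fun _ _ => sq_nonneg _
  have hE₃ : 0 ≤ E₃ := Finset.sum_nonneg fun _ _ => sq_nonneg _
  have hE₄ : 0 ≤ E₄ := Finset.sum_nonneg fun _ _ => sq_nonneg _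
  have hE₅ : 0 ≤ E₅ := Finset.sum_nonneg fun _ _ => sq_nonneg _
  have hΛ : 0 ≤ Λ := Finset.sum_nonneg fun _ _ => State.lowerError_nonneg _ _ _
  have hX : 0 ≤ X := Finset.sum_nonneg fun _ _ => excess_nonneg _ _
  set Y := E₁ + E₂ + X + (E₃ + E₄ + E₅) + Λ with hY
  have hY0 : 0 ≤ Y := by positivity
  have h1 := mul_le_mul_of_nonneg_right hn1 (mul_nonneg (sq_nonneg M) hζ0)
  have h2 := mul_le_mul_of_nonneg_right hn2 (mul_nonneg (sq_nonneg M) hζ0)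
  have h3 : Y ≤ M ^ 2 * n * Y := le_mul_of_one_le_left hY0
    (one_le_mul_of_one_le_of_one_le hM2 hn)
  have h4 : M ^ 2 * Λ ≤ M ^ 2 * n * Λ := by
    have := mul_le_mul_of_nonneg_left hn (mul_nonneg (sq_nonneg M) hΛ)
    linarith
  have h5 : M ^ 2 * n * Λ ≤ M ^ 2 * n * Y :=
    mul_le_mul_of_nonneg_left (by linarith) (by positivity)
  have h6 : 0 ≤ n * (M ^ 2 * ζ) := by positivity
  have := mul_le_mul_of_nonneg_left (t3.trans
    (by linarith : _ ≤ 20 * (M ^ 2 * n * (Y + ζ)))) (by linarith : 0 ≤ M)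
  linarith

/-- The descent lemma at the shadow point. With `⟪a, b⟫ = (‖a‖² + ‖b‖² - ‖a - b‖²) / 2` for the
gradient and the mean direction, the squared mean direction absorbs the displacement of the shadow
point. -/
theorem integral_objective_le [Nonempty Q]
    (H : OneStep D p h Bh Ch Lh Ph L ρ r V P M c₁ γ a n θ σ) :
    ∫ b, objective D h ((step D h θ b σ).shadow (c₁ * γ)) ∂p.law ≤
      objective D h (σ.shadow (c₁ * γ)) - c₁ * γ / 2 * ‖gradient (objective D h) σ.w‖ ^ 2 +
      M ^ 2 * (c₁ * γ) * (biasSq D h σ + (c₁ * γ) ^ 2 * ‖σ.z‖ ^ 2) +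
      M ^ 2 * γ ^ 2 * (1 + σ.excessSum r) := by
  have hS := dirMoment_le (p := p) H.control H.confined.toBounded
  have hG : meanDir D p h σ = fullDir D h σ.w σ.u σ.ua σ.ub σ.uq σ.s σ.lam :=
    H.unbiased.integral_dir H.score σ
  obtain ⟨hp, hA, hc, hσ, hγ, hγ8, h₁, hc₁, rfl, hρ, hr, hr8, hγM, ha, hpair, -, -, hn, hn1,
    hn2⟩ := H
  have hM := hc.one_le
  have hη : 0 ≤ c₁ * γ := mul_nonneg h₁.le hγ.1.le
  have hηγ : c₁ * γ ≤ γ := mul_le_of_le_one_left hγ.1.le hc₁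
  simp only [shadow_step]
  set η := c₁ * γ
  set w := σ.shadow η with hw
  have hF := hc.tame_objective
  set F := objective D h
  have hpt : ∀ b, F (w - η • dir D h b σ) ≤
      F w - η * inner ℝ (gradient F w) (dir D h b σ) + M * η ^ 2 * ‖dir D h b σ‖ ^ 2 := by
    intro b
    have h1 := (abs_le.1 (hF.abs_sub_sub_inner_le w (w - η • dir D h b σ))).2
    have h3 : w - η • dir D h b σ - w = -(η • dir D h b σ) := by abel
    rw [h3, inner_neg_right, inner_smul_right, norm_neg, norm_smul, Real.norm_of_nonneg hη,
      mul_pow] at h1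
    linarith
  refine (integral_mono (p.integrable_law _) (p.integrable_law _) hpt).trans ?_
  rw [integral_add (p.integrable_law _) (p.integrable_law _),
    integral_sub (p.integrable_law _) (p.integrable_law _)]
  simp only [integral_const_mul, integral_inner (p.integrable_law _), integral_const,
    probReal_univ, smul_eq_mul, one_mul]
  change F w - η * inner ℝ (gradient F w) (meanDir D p h σ) +
    M * η ^ 2 * dirMoment D p h σ ≤ _
  have hgF : gradient F σ.w = trueDir D h σ.w := gradient_objective hA σ.w
  have hb : biasSq D h σ = ‖meanDir D p h σ - gradient F σ.w‖ ^ 2 := by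
    rw [biasSq, hG, hgF]
  rw [hb]
  set Γ := meanDir D p h σ
  set S := dirMoment D p h σ
  set X := σ.excessSum r
  have hX : 0 ≤ X := State.excessSum_nonneg σ
  have hS0 : 0 ≤ S := dirMoment_nonneg
  have h1 : ‖Γ - gradient F σ.w‖ ^ 2 =
      ‖Γ‖ ^ 2 - 2 * inner ℝ (gradient F σ.w) Γ + ‖gradient F σ.w‖ ^ 2 := by
    rw [norm_sub_sq_real, real_inner_comm]
  have h2 : inner ℝ (gradient F σ.w - gradient F w) Γ ≤
      M * (η * ‖σ.z‖) * ‖Γ‖ := by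
    refine (real_inner_le_norm _ _).trans (mul_le_mul_of_nonneg_right ?_ (norm_nonneg _))
    have := hF.norm_gradient_sub_le σ.w w
    have e : σ.w - w = η • σ.z := by
      rw [hw, State.shadow]
      abel
    rwa [e, norm_smul, Real.norm_of_nonneg hη] at this
  rw [inner_sub_left] at h2
  have h3 := two_mul_le_add_sq (M * (η * ‖σ.z‖)) ‖Γ‖
  have h4 : -inner ℝ (gradient F w) Γ ≤ -(1 / 2) * ‖gradient F σ.w‖ ^ 2 +
      1 / 2 * ‖Γ - gradient F σ.w‖ ^ 2 + 1 / 2 * (M * (η * ‖σ.z‖)) ^ 2 := by linarith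
  have h5 := mul_le_mul_of_nonneg_left h4 hη
  have hM2 : 1 ≤ M ^ 2 := one_le_pow₀ hM
  have h6 : η * (1 / 2 * ‖Γ - gradient F σ.w‖ ^ 2) ≤ M ^ 2 * η * ‖Γ - gradient F σ.w‖ ^ 2 := by
    have := mul_le_mul_of_nonneg_right (by linarith : 1 / 2 ≤ M ^ 2)
      (mul_nonneg hη (sq_nonneg ‖Γ - gradient F σ.w‖))
    linarith
  have h7 : 0 ≤ M ^ 2 * η * (η ^ 2 * ‖σ.z‖ ^ 2) := by positivity
  have h8 : M * η ^ 2 * S ≤ M ^ 2 * γ ^ 2 * (1 + X) := by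
    have h9 : η ^ 2 ≤ γ ^ 2 := pow_le_pow_left₀ hη hηγ 2
    have h10 := mul_le_mul h9 hS hS0 (sq_nonneg γ)
    have := mul_le_mul_of_nonneg_left h10 (by linarith : 0 ≤ M)
    linarith
  linarith

end OneStep

end

noncomputable section

/-! ### The Lyapunov function -/

variable {Q : Type*} {I : Q → Type*} [Fintype Q] [∀ q, Fintype (I q)] [DecidableEq Q]
  [∀ q, DecidableEq (I q)] {d : ℕ}

/-- The Lyapunov function of the algorithm: the objective at the shadow point and the weighted
errors of all estimates. -/
def potential (D : Problem Q I) (h : Score I d) (r β k c₁ γ : ℝ) (σ : State I d) : ℝ :=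
  objective D h (σ.shadow (c₁ * γ)) + β * (k * σ.rankError D h (σ.shadow (c₁ * γ)) +
    σ.excessSum r + σ.groupError D h (σ.shadow (c₁ * γ)) +
    k * ∑ q, σ.lowerError D h γ q (σ.shadow (c₁ * γ)) + γ ^ 2 * ‖σ.z‖ ^ 2)

/-- The potential decreases in the mean by a multiple of the squared gradient, up to `γ ^ 2`. -/
theorem exists_potential_descent [Nonempty Q] (D : Problem Q I) (p : SamplingLaws Q I)
    {M r n a : ℝ} (hM : 1 ≤ M) (hr : 0 < r) (hn : 1 ≤ n)
    (ha : 0 < a) : ∃ β k c₁ γ₁ K : ℝ, 0 < β ∧ 1 ≤ k ∧ 0 < c₁ ∧ c₁ ≤ 1 ∧ 0 < γ₁ ∧ γ₁ ≤ 1 ∧ 0 ≤ K ∧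
    ∀ {L ρ V P : ℝ} {Bh : ℝ} {Ch Lh Ph : ℝ≥0} {γ : ℝ} {d : ℕ} {h : Score I d}
      {θ : StepParams} {σ : State I d}, γ ≤ γ₁ →
      OneStep D p h Bh Ch Lh Ph L ρ r V P M c₁ γ a n θ σ →
      ∫ b, potential D h r β k c₁ γ (step D h θ b σ) ∂p.law ≤ potential D h r β k c₁ γ σ -
        c₁ * γ / 8 * ‖gradient (objective D h) σ.w‖ ^ 2 + K * γ ^ 2 := by
  set K : ℝ := 192 * M ^ 5 * n + 288 * (r⁻¹) ^ 6 * M ^ 2 * n + 20 * M ^ 3 * n + M ^ 2 + M with hK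
  have hM2 : 1 ≤ M ^ 2 := one_le_pow₀ hM
  have k1 : 0 ≤ 64 * M ^ 5 * n := by positivity
  have k2 : 0 ≤ 288 * (r⁻¹) ^ 6 * M ^ 2 * n := by positivity
  have k3 : 0 ≤ 20 * M ^ 3 * n := by positivity
  have hK1 : 1 ≤ K := by linarith
  obtain ⟨β, k, c, γ₁, hβ, hk, hc0, hc1, hγ0, hγ1, key⟩ := exists_lyapunov hK1 ha
  refine ⟨β, k, c, γ₁, K + 1, hβ, hk, hc0, hc1, hγ0, hγ1, by linarith, ?_⟩
  intro L ρ V P Bh Ch Lh Ph γ d h θ σ hγ H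
  have hγp := H.rate.1
  have b1 := H.integral_rankError_le
  have b2 := H.integral_excessSum_le
  have b3 := H.integral_groupError_le
  have b4 := H.integral_lowerError_sum_le
  have b5 := H.integral_norm_z_sq_le
  have b6 := H.biasSq_le
  have b7 := H.integral_objective_le
  have hU := σ.rankError_nonneg (D := D) (h := h) (σ.shadow (c * γ))
  have hX := σ.excessSum_nonneg (r := r)
  have hA := σ.groupError_nonneg (D := D) (h := h) (σ.shadow (c * γ))
  have hL : 0 ≤ ∑ q, σ.lowerError D h γ q (σ.shadow (c * γ)) :=
    Finset.sum_nonneg fun q _ => σ.lowerError_nonneg q _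
  have hZ := sq_nonneg ‖σ.z‖
  have hN := sq_nonneg ‖gradient (objective D h) σ.w‖
  have he := biasSq_nonneg (D := D) (h := h) (σ := σ)
  have hη : 0 ≤ c * γ := mul_nonneg hc0.le hγp.le
  have hint := fun f : Batch Q I → ℝ => p.integrable_law f
  simp only [potential]
  rw [integral_add (hint _) (hint _), integral_const_mul, integral_add (hint _) (hint _),
    integral_add (hint _) (hint _), integral_add (hint _) (hint _), integral_add (hint _) (hint _),
    integral_const_mul, integral_const_mul, integral_const_mul]
  have hζ : 0 ≤ (c * γ) ^ 2 * ‖σ.z‖ ^ 2 := by positivity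
  -- Each block has its own constant; all of them are at most `K`.
  have wk : ∀ {x y κ : ℝ}, 0 ≤ y → κ ≤ K → x ≤ κ * y → x ≤ K * y := fun hy hκ hx =>
    hx.trans (mul_le_mul_of_nonneg_right hκ hy)
  generalize σ.rankError D h (σ.shadow (c * γ)) = U at *
  generalize σ.excessSum r = X at *
  generalize σ.groupError D h (σ.shadow (c * γ)) = A at *
  generalize ∑ q, σ.lowerError D h γ q (σ.shadow (c * γ)) = Λ at *
  generalize ‖gradient (objective D h) σ.w‖ ^ 2 = N at *
  generalize biasSq D h σ = e at *
  generalize hζd : (c * γ) ^ 2 * ‖σ.z‖ ^ 2 = ζ at *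
  have hγ2 : 0 ≤ γ ^ 2 * (1 + X) := by positivity
  have hrest : ∀ E, 0 ≤ E → 0 ≤ c * γ * (E + (N + e)) := fun E hE =>
    mul_nonneg hη (by positivity)
  refine key γ hγp hγ U X A Λ (‖σ.z‖ ^ 2) N e _ _ _ _ _ _ _ hU hX hA hL hZ hN ?_ ?_ ?_ ?_ ?_ ?_ ?_
  · have := wk (x := _ - (U - a * γ * U)) (y := γ * ζ + c * γ * (U + (N + e)) + γ ^ 2 * (1 + X))
      (add_nonneg (add_nonneg (mul_nonneg hγp.le hζ) (hrest U hU)) hγ2)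
      (by linarith : 2 * (64 * M ^ 5 * n) ≤ K) (sub_le_iff_le_add'.2 b1)
    rw [hζd]
    linarith
  · have := wk (x := _ - (X - a * γ * X)) (y := γ * U + γ * ζ)
      (add_nonneg (mul_nonneg hγp.le hU) (mul_nonneg hγp.le hζ))
      (by linarith : 288 * (r⁻¹) ^ 6 * M ^ 2 * n ≤ K) (sub_le_iff_le_add'.2 b2)
    rw [hζd]
    linarith
  · have := wk (x := _ - (A - a * γ * A))
      (y := γ * (Λ + ζ) + c * γ * (A + (N + e)) + γ ^ 2 * (1 + X))
      (add_nonneg (add_nonneg (mul_nonneg hγp.le (add_nonneg hL hζ)) (hrest A hA)) hγ2)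
      (by linarith : 3 * (64 * M ^ 5 * n) ≤ K) (sub_le_iff_le_add'.2 b3)
    rw [hζd]
    linarith
  · have := wk (x := _ - (Λ - a * γ * Λ)) (y := γ * ζ + c * γ * (Λ + (N + e)) + γ ^ 2 * (1 + X))
      (add_nonneg (add_nonneg (mul_nonneg hγp.le hζ) (hrest Λ hL)) hγ2)
      (by linarith : 64 * M ^ 5 * n ≤ K) (sub_le_iff_le_add'.2 b4)
    rw [hζd]
    linarith
  · have := wk (by linarith : 0 ≤ 1 + X) (by linarith : M ≤ K) (sub_le_iff_le_add'.2 b5)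
    linarith
  · rw [hζd]
    exact wk (by positivity) (by linarith) b6
  · have := mul_le_mul_of_nonneg_right (by linarith : M ^ 2 ≤ K)
      (mul_nonneg hη (add_nonneg he hζ))
    have := mul_le_mul_of_nonneg_right (by linarith : M ^ 2 ≤ K) hγ2
    have := mul_nonneg hη hN
    rw [hζd]
    linarith

end

noncomputable section

/-! ### The iterates stay in a bounded region -/

variable {Q : Type*} {I : Q → Type*} [∀ q, Fintype (I q)]

/-- Uniform bounds of the mini-batch estimates while the threshold is bounded. -/
theorem exists_estimate_bound (D : Problem Q I) (Bh : ℝ) (Ch Lh Ph : ℝ≥0) (l₀ : ℝ) :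
    ∃ C, ∀ {d : ℕ} {h : Score I d}, ScoreAssumption h Bh Ch Lh Ph →
      (∀ q i B w, gHat D h q i B w ≤ C) ∧ (∀ q B w, expHat h q B w ≤ C) ∧
      (∀ q B w l, |l| ≤ l₀ → |groupHat D h q B w l| ≤ C) ∧
      (∀ q B w l l', |l| ≤ l₀ → |l'| ≤ l₀ →
        |groupHat D h q B w l - groupHat D h q B w l'| ≤ C * |l - l'|) ∧
      (∀ q B w l l', |l| ≤ l₀ → |l'| ≤ l₀ →
        |deriv (deriv (lowerBatch D h q B w)) l - deriv (deriv (lowerBatch D h q B w)) l'| ≤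
          C * |l - l'|) := by
  obtain ⟨C₁, h₁⟩ := exists_tame_gHat D Bh Ch Lh Ph
  obtain ⟨C₂, h₂⟩ := exists_tame_expHat Bh Ch Lh Ph D
  obtain ⟨C₃, h₃⟩ := exists_bddLip_groupHat D Bh Ch Lh Ph (max l₀ 1)
  obtain ⟨C₄, h₄⟩ := exists_bddLip_deriv_deriv_lowerBatch D Bh Ch Lh Ph (max l₀ 1)
  obtain ⟨C, hC₁, hC₂, hC₃, hC₄⟩ := ((eventually_ge_atTop C₁).and ((eventually_ge_atTop C₂).and
    ((eventually_ge_atTop C₃).and (eventually_ge_atTop C₄)))).exists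
  refine ⟨C, fun {d h} hA => ?_⟩
  have hid : BddLip {l : ℝ | |l| ≤ l₀} (max l₀ 1) fun l => l :=
    ⟨zero_le_one.trans (le_max_right _ _), fun l hl => le_max_of_le_left hl, fun l _ l' _ => by
      rw [← dist_eq_norm]
      exact le_mul_of_one_le_left dist_nonneg (le_max_right _ _)⟩
  have g₃ := fun q B (w : Param d) => (h₃ hA (.const w) hid q B).mono hC₃
  have g₄ := fun q B (w : Param d) => (h₄ hA (.const w) hid q B).mono hC₄
  refine ⟨fun q i B w => (abs_le.1 ((h₁ hA q i B).abs_le w)).2.trans hC₁,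
    fun q B w => (abs_le.1 ((h₂ hA q B).abs_le w)).2.trans hC₂,
    fun q B w l hl => (g₃ q B w).abs_le hl, fun q B w l l' hl hl' => ?_,
    fun q B w l l' hl hl' => ?_⟩
  · rw [← Real.dist_eq l]
    exact (g₃ q B w).abs_sub_le hl hl'
  · rw [← Real.dist_eq l]
    exact (g₄ q B w).abs_sub_le hl hl'

variable [Fintype Q] [DecidableEq Q] [∀ q, DecidableEq (I q)]

/-- One constant serves in all bounds of an iteration, for all admissible scores. -/
theorem exists_control [Nonempty Q] (D : Problem Q I) (Bh : ℝ) (Ch Lh Ph : ℝ≥0) {L ρ r : ℝ}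
    (V P : ℝ) (hρ : 0 < ρ) (hr : 0 < r) (hr8 : 8 * r ≤ rankBound D)
    (hT : ∀ {d : ℕ} {h : Score I d}, ScoreAssumption h Bh Ch Lh Ph →
      (∀ q i w, gHat D h q i Finset.univ w ≤ L) ∧
      (∀ q w, (groupTarget D h q (D.Sa q) w, groupTarget D h q (D.Sb q) w,
        expHat h q Finset.univ w, curvTarget D h q w, lamHat D h q w) ∈ queryBox L ρ)) :
    ∃ M, 1 ≤ M ∧ ∀ {d : ℕ} {h : Score I d}, ScoreAssumption h Bh Ch Lh Ph →
      Control D h L ρ r V P M := by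
  obtain ⟨C₁, h₁⟩ := exists_tame_lamHat D Bh Ch Lh Ph
  obtain ⟨C₂, h₂⟩ := exists_tame_groupTarget D Bh Ch Lh Ph
  obtain ⟨C₃, h₃⟩ := exists_tame_gHat D Bh Ch Lh Ph
  obtain ⟨C₄, h₄⟩ := exists_tame_expHat Bh Ch Lh Ph D
  obtain ⟨C₅, h₅⟩ := exists_tame_curvTarget D Bh Ch Lh Ph
  obtain ⟨C₆, h₆⟩ := exists_tame_objective D Bh Ch Lh Ph
  obtain ⟨C₇, h₇⟩ := exists_estimate_bound D Bh Ch Lh Ph L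
  obtain ⟨C₈, -, h₈⟩ := exists_norm_dir_sq_le D Bh Ch Lh Ph L hρ hr
  obtain ⟨C₉, -, h₉⟩ := exists_norm_bias_sq_le D Bh Ch Lh Ph L hρ hr hr8
  have e := fun x : ℝ => eventually_ge_atTop x
  obtain ⟨M, m1, m2, m3, m4, m5, m6, n1, n2, n3, n4, n5, n6, n7, n8, n9⟩ :=
    ((e 1).and ((e L).and ((e P).and ((e (D.lowerRate * V)).and ((e (D.τ₂ + D.τ₁⁻¹)).and
      ((e (D.lowerRate * (D.τ₂ * L + (D.K + 2)))).and ((e C₁).and ((e C₂).and ((e C₃).and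
        ((e C₄).and ((e C₅).and ((e C₆).and ((e C₇).and ((e C₈).and (e C₉))))))))))))))).exists
  refine ⟨M, m1, fun {d h} hA => ?_⟩
  obtain ⟨t1, t2⟩ := hT hA
  exact {
    one_le := m1
    box_le := m2
    shadow_le := m3
    vel_le := m4
    tame_lamHat := fun q => (h₁ hA q).mono n1
    tame_groupTarget := fun q B => (h₂ hA q B).mono n2
    tame_gHat := fun q i B => (h₃ hA q i B).mono n3
    tame_expHat := fun q B => (h₄ hA q B).mono n4
    tame_curvTarget := fun q => (h₅ hA q).mono n5
    tame_objective := (h₆ hA).mono n6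
    abs_groupHat_le := fun q B w l hl => ((h₇ hA).2.2.1 q B w l hl).trans n7
    abs_groupHat_sub_le := fun q B w l l' hl hl' => ((h₇ hA).2.2.2.1 q B w l l' hl hl').trans
      (mul_le_mul_of_nonneg_right n7 (abs_nonneg _))
    curv_le := m5
    abs_curv_sub_le := fun q w l l' hl hl' => ((h₇ hA).2.2.2.2 q _ w l l' hl hl').trans
      (mul_le_mul_of_nonneg_right n7 (abs_nonneg _))
    abs_deriv_le := fun q B w l hl => by
      refine le_trans (mul_le_mul_of_nonneg_left ?_ D.lowerRate_pos.le) m6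
      have g1 := abs_deriv_lowerBatch_sub_le D (h := h) q B w l
      have g2 := abs_sub_abs_le_abs_sub (deriv (lowerBatch D h q B w) l) (D.τ₂ * l)
      rw [abs_mul, abs_of_pos D.τ₂_pos] at g2
      have := mul_le_mul_of_nonneg_left hl D.τ₂_pos.le
      linarith
    abs_lamHat_le := fun q w => (t2 q w).2.2.2.2
    norm_dir_sq_le := fun σ hσ b => (h₈ hA σ hσ b).trans (mul_le_mul_of_nonneg_right n8
      (add_nonneg zero_le_one (Finset.sum_nonneg fun _ _ => excess_nonneg _ _)))
    norm_bias_sq_le := fun σ hσ => (h₉ hA σ hσ t1 t2).trans (mul_le_mul_of_nonneg_right n9 (by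
      unfold estimateError
      exact add_nonneg (Finset.sum_nonneg fun _ _ => add_nonneg (sq_nonneg _) (excess_nonneg _ _))
        (by positivity))) }

theorem average_mem_Icc_of_mem {x y a b γ : ℝ} (hγ : 0 ≤ γ ∧ γ ≤ 1) (hx : x ∈ Set.Icc a b)
    (hy : y ∈ Set.Icc a b) : γ * x + (1 - γ) * y ∈ Set.Icc a b := by
  have := convex_Icc a b hx hy hγ.1 (sub_nonneg.2 hγ.2) (by ring)
  simpa using this

/-- The heavy-ball iteration of the lower level stays in a box: here `l` is the iterate, `v` the
momentum, `g` the stochastic derivative, and `l - c * ((1 - γ) * v)` the shadow of `l`. -/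
theorem heavy_ball_confined {τ c m γ l v g V P : ℝ} (hτ : 0 < τ) (hc : 0 < c) (hcτ : c * τ ≤ 1 / 4)
    (hP : 2 * m ≤ τ * P) (hV : V = 4 / 3 * (τ * P + m)) (hγ : 0 ≤ γ ∧ γ ≤ 1)
    (hg : |g - τ * l| ≤ m) (hv : |v| ≤ V) (hl : |l - c * ((1 - γ) * v)| ≤ P) :
    |(1 - γ) * v + γ * g| ≤ V ∧ |l - c * ((1 - γ) * v) + γ * -(c * g)| ≤ P := by
  obtain ⟨p, hp⟩ : ∃ p, p = l - c * ((1 - γ) * v) := ⟨_, rfl⟩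
  rw [← hp] at hl ⊢
  have hle : l = p + c * ((1 - γ) * v) := by linarith
  have hγ' : 0 ≤ 1 - γ := by linarith
  have hP0 : 0 ≤ P := (abs_nonneg _).trans hl
  have hV0 : 0 ≤ V := (abs_nonneg _).trans hv
  have hv1 : |(1 - γ) * v| ≤ V := by
    rw [abs_mul, abs_of_nonneg hγ']
    exact (mul_le_of_le_one_left (abs_nonneg v) (by linarith)).trans hv
  have hcv : τ * (c * V) ≤ 1 / 4 * V := by
    have := mul_le_mul_of_nonneg_right hcτ hV0
    linarith
  have h1 : |g - τ * p| ≤ m + τ * (c * V) := by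
    have h2 : |τ * (c * ((1 - γ) * v))| ≤ τ * (c * V) := by
      rw [abs_mul, abs_mul c, abs_of_pos hτ, abs_of_pos hc]
      exact mul_le_mul_of_nonneg_left (mul_le_mul_of_nonneg_left hv1 hc.le) hτ.le
    have h3 := abs_add_le (g - τ * l) (τ * (c * ((1 - γ) * v)))
    have h4 : g - τ * l + τ * (c * ((1 - γ) * v)) = g - τ * p := by
      rw [hle]
      ring
    rw [h4] at h3
    linarith
  obtain ⟨h2, h3⟩ := abs_le.1 h1
  obtain ⟨p1, p2⟩ := abs_le.1 hl
  obtain ⟨v1, v2⟩ := abs_le.1 hv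
  have hτp1 := mul_le_mul_of_nonneg_left p1 hτ.le
  have hτp2 := mul_le_mul_of_nonneg_left p2 hτ.le
  constructor
  · rw [add_comm]
    exact abs_le.2 (average_mem_Icc_of_mem hγ ⟨by linarith, by linarith⟩ ⟨v1, v2⟩)
  · have h5 : p + γ * -(c * g) = γ * (p - c * g) + (1 - γ) * p := by ring
    rw [h5]
    have h6 : c * |g - τ * p| ≤ c * (τ * P) :=
      mul_le_mul_of_nonneg_left (h1.trans (by linarith)) hc.le
    have h7 := mul_le_mul_of_nonneg_left h2 hc.le
    have h8 : c * (m + τ * (c * V)) ≤ c * (τ * P) :=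
      mul_le_mul_of_nonneg_left (by linarith) hc.le
    have h9 := mul_le_mul_of_nonneg_left h3 hc.le
    have h10 := mul_le_mul_of_nonneg_left p1 (by linarith : 0 ≤ 1 - c * τ)
    have h11 := mul_le_mul_of_nonneg_left p2 (by linarith : 0 ≤ 1 - c * τ)
    refine abs_le.2 (average_mem_Icc_of_mem hγ ⟨?_, ?_⟩ ⟨p1, p2⟩) <;> linarith

/-- A region, the same for all admissible scores, that contains the initial states and the targets
of the estimates and that an iteration does not leave. The bounds do not depend on the rate `γ < 1`;
`γ = 1` is excluded, as then a rank estimate could become `0`. -/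
theorem exists_region (D : Problem Q I) (Bh : ℝ) (Ch Lh Ph : ℝ≥0) {R : ℝ} (hR : 0 < R) :
    ∃ L ρ V P : ℝ, 0 < ρ ∧ ∀ {d : ℕ} {h : Score I d}, ScoreAssumption h Bh Ch Lh Ph →
      ((∀ q i w, gHat D h q i Finset.univ w ≤ L) ∧
        (∀ q w, (groupTarget D h q (D.Sa q) w, groupTarget D h q (D.Sb q) w,
          expHat h q Finset.univ w, curvTarget D h q w, lamHat D h q w) ∈ queryBox L ρ)) ∧
      ∀ {γ : ℝ} (hγ : 0 < γ ∧ γ ≤ 1), γ < 1 →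
        (∀ σ : State I d, σ.InitBounded R → σ.Confined D.lowerRate γ L ρ V P) ∧
        ∀ {c₁ : ℝ} (h₁ : 0 < c₁), ∀ σ : State I d, σ.Confined D.lowerRate γ L ρ V P →
          ∀ b : Batch Q I, (∀ q, (b.2 q).1.Nonempty) →
          (step D h (stepSizes D.lowerRate c₁ γ hγ D.lowerRate_pos.le h₁) b σ).Confined
            D.lowerRate γ L ρ V P := by
  have hτ := D.τ₂_pos
  have hτ₁ := D.τ₁_pos
  have hc := D.lowerRate_pos
  set c := D.lowerRate with hcd
  set m : ℝ := D.K + 2 with hm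
  have hm0 : 0 ≤ m := by positivity
  obtain ⟨P, hP1, hP2, hP3⟩ : ∃ P, R + c * R ≤ P ∧ 2 * m ≤ D.τ₂ * P ∧ R ≤ D.τ₂ * P := by
    refine ⟨R + c * R + (2 * m + R) / D.τ₂, le_add_of_nonneg_right (by positivity), ?_, ?_⟩ <;>
    · rw [mul_add D.τ₂ (R + c * R), mul_div_cancel₀ _ hτ.ne']
      have : 0 ≤ D.τ₂ * (R + c * R) := by positivity
      linarith
  have hP0 : 0 ≤ P := le_trans (by positivity) hP1
  obtain ⟨V, hV⟩ : ∃ V, V = 4 / 3 * (D.τ₂ * P + m) := ⟨_, rfl⟩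
  have hV0 : 0 ≤ V := by
    rw [hV]
    positivity
  have hRV : R ≤ V := by linarith
  obtain ⟨C, hC⟩ := exists_estimate_bound D Bh Ch Lh Ph (P + c * V)
  have e := fun x : ℝ => eventually_ge_atTop x
  obtain ⟨L, l1, l2, l3, l4⟩ := ((e R).and ((e (P + c * V)).and ((e C).and
    (e (D.τ₂ + D.τ₁⁻¹))))).exists
  set ρ := min (1 / R) (min (Real.exp (-|Bh|)) D.τ₂) with hρ
  have r1 : ρ ≤ 1 / R := min_le_left _ _
  have r2 : ρ ≤ Real.exp (-|Bh|) := (min_le_right _ _).trans (min_le_left _ _)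
  have r3 : ρ ≤ D.τ₂ := (min_le_right _ _).trans (min_le_right _ _)
  refine ⟨L, ρ, V, P, lt_min (by positivity) (lt_min (Real.exp_pos _) hτ), fun {d h} hA => ?_⟩
  obtain ⟨b1, b2, b3, -, -⟩ := hC hA
  have hlam : ∀ q w, |lamHat D h q w| ≤ P + c * V := fun q w => by
    refine (abs_lamHat_le D q w).trans ?_
    rw [div_le_iff₀ hτ]
    have : 0 ≤ c * V * D.τ₂ := by positivity
    linarith
  have hlow : ∀ {γ : ℝ}, 0 < γ ∧ γ ≤ 1 → ∀ {l v : ℝ}, |v| ≤ V → |l - c * ((1 - γ) * v)| ≤ P →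
      |l| ≤ P + c * V := by
    intro γ hγ l v hv hl
    have h1 : |c * ((1 - γ) * v)| ≤ c * V := by
      rw [abs_mul, abs_mul, abs_of_pos hc, abs_of_nonneg (by linarith [hγ.2] : 0 ≤ 1 - γ)]
      exact mul_le_mul_of_nonneg_left
        ((mul_le_of_le_one_left (abs_nonneg v) (by linarith [hγ.1])).trans hv) hc.le
    have h2 := abs_add_le (l - c * ((1 - γ) * v)) (c * ((1 - γ) * v))
    rw [sub_add_cancel] at h2
    linarith
  refine ⟨⟨fun q i w => (b1 q i _ w).trans l3, fun q w => ⟨(b3 q _ w _ (hlam q w)).trans l3,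
    (b3 q _ w _ (hlam q w)).trans l3, ⟨r2.trans (expHat_univ_ge D hA q w), (b2 q _ w).trans l3⟩,
    ⟨r3.trans (curvTarget_mem q w).1, (curvTarget_mem q w).2.trans l4⟩,
    (hlam q w).trans l2⟩⟩, fun {γ} hγ hγ1 => ⟨fun σ hσ => ?_, fun {c₁} h₁ σ hσ b hb => ?_⟩⟩
  · have hsh : ∀ q, |σ.lowerShadow c γ q| ≤ P := fun q => by
      have h1 : |c * ((1 - γ) * σ.v q)| ≤ c * R := by
        rw [abs_mul, abs_mul, abs_of_pos hc, abs_of_nonneg (by linarith : 0 ≤ 1 - γ)]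
        exact mul_le_mul_of_nonneg_left
          ((mul_le_of_le_one_left (abs_nonneg _) (by linarith [hγ.1])).trans (hσ.v q)) hc.le
      exact (abs_sub _ _).trans (by linarith [hσ.lam q])
    exact {
      u := fun q i => ⟨lt_of_lt_of_le (by positivity) (hσ.u q i).1, (hσ.u q i).2.trans l1⟩
      ua := fun q => (hσ.ua q).trans l1
      ub := fun q => (hσ.ub q).trans l1
      uq := fun q => ⟨r1.trans (hσ.uq q).1, (hσ.uq q).2.trans l1⟩
      s := fun q => ⟨r1.trans (hσ.s q).1, (hσ.s q).2.trans l1⟩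
      lam := fun q => (hσ.lam q).trans l1
      v := fun q => (hσ.v q).trans hRV
      lowerShadow := hsh }
  · have hγ' : 0 ≤ γ ∧ γ ≤ 1 := ⟨hγ.1.le, hγ.2⟩
    have hlamσ : ∀ q, |σ.lam q| ≤ P + c * V := fun q => hlow hγ (hσ.v q) (hσ.lowerShadow q)
    have hbox := fun q => heavy_ball_confined hτ hc (D.lowerRate_mul_le (by
      have := inv_pos.2 hτ₁
      linarith)) hP2 hV hγ'
      (abs_deriv_lowerBatch_sub_le D (h := h) q (b.2 q).1 σ.w (σ.lam q)) (hσ.v q)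
      (hσ.lowerShadow q)
    have hv : ∀ q, |(step D h (stepSizes c c₁ γ hγ D.lowerRate_pos.le h₁) b σ).v q| ≤ V := by
      intro q
      simp only [step, stepSizes]
      split_ifs
      · exact (hbox q).1
      · exact hσ.v q
    have hsh : ∀ q, |(step D h (stepSizes c c₁ γ hγ D.lowerRate_pos.le h₁) b σ).lowerShadow
        c γ q| ≤ P := by
      intro q
      rw [lowerShadow_step]
      split_ifs
      · exact (hbox q).2
      · simpa using hσ.lowerShadow q
    refine {
      u := fun q i => ?_
      ua := fun q => ?_
      ub := fun q => ?_
      uq := fun q => ?_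
      s := fun q => ?_
      lam := fun q => (hlow hγ (hv q) (hsh q)).trans l2
      v := hv
      lowerShadow := hsh } <;> simp only [step, stepSizes] <;> split_ifs
    · have h2 := hσ.u q i
      have h3 := gHat_nonneg (D := D) (h := h) q i (b.2 q).1 σ.w
      refine ⟨by have := mul_nonneg hγ'.1 h3; have := mul_pos (sub_pos.2 hγ1) h2.1; linarith, ?_⟩
      exact (average_mem_Icc_of_mem hγ' ⟨h3, (b1 q i _ _).trans l3⟩ ⟨h2.1.le, h2.2⟩).2
    · exact hσ.u q i
    · exact abs_le.2 (average_mem_Icc_of_mem hγ' (abs_le.1 ((b3 q _ _ _ (hlamσ q)).trans l3))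
        (abs_le.1 (hσ.ua q)))
    · exact hσ.ua q
    · exact abs_le.2 (average_mem_Icc_of_mem hγ' (abs_le.1 ((b3 q _ _ _ (hlamσ q)).trans l3))
        (abs_le.1 (hσ.ub q)))
    · exact hσ.ub q
    · exact average_mem_Icc_of_mem hγ' ⟨r2.trans (expHat_ge hA q (hb q) _), (b2 q _ _).trans l3⟩
        (hσ.uq q)
    · exact hσ.uq q
    · rw [add_comm]
      have h2 := deriv_deriv_lowerBatch_mem D (h := h) q (b.2 q).1 σ.w (σ.lam q)
      exact average_mem_Icc_of_mem hγ' ⟨r3.trans h2.1, h2.2.trans l4⟩ (hσ.s q)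
    · exact hσ.s q

end

noncomputable section

/-! ### Descent with uniform constants -/

variable {Q : Type*} {I : Q → Type*} [Fintype Q] [∀ q, Fintype (I q)] [DecidableEq Q]
  [∀ q, DecidableEq (I q)]

theorem sum_le_mul_of_card_le {ι : Type*} [Fintype ι] {f : ι → ℝ} {m n : ℝ}
    (hι : (Fintype.card ι : ℝ) ≤ n) (hm : 0 ≤ m) (hf : ∀ i, f i ≤ m) : ∑ i, f i ≤ n * m := by
  refine (Finset.sum_le_sum fun i _ => hf i).trans ?_
  simpa using mul_le_mul_of_nonneg_right hι hm

theorem excess_le_of_inv_le {r u R : ℝ} (hR : 0 < R) (hu : 1 / R ≤ u) : excess r u ≤ R ^ 4 := by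
  have hu0 : 0 < u := lt_of_lt_of_le (by positivity) hu
  have h1 : u⁻¹ ≤ R := by
    rw [one_div] at hu
    exact inv_le_of_inv_le₀ hR hu
  have h2 : (u⁻¹) ^ 4 ≤ R ^ 4 := pow_le_pow_left₀ (by positivity) h1 4
  have h3 : 0 ≤ (r⁻¹) ^ 4 := by positivity
  exact max_le (by linarith) (by positivity)

/-- The initial potential is bounded independently of the scores and of `γ`. -/
theorem State.InitBounded.potential_le {d : ℕ} {D : Problem Q I} {h : Score I d}
    {L ρ r V P M R β k c₁ γ n : ℝ} {σ : State I d} (hσ : σ.InitBounded R)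
    (hc : Control D h L ρ r V P M) (hσc : σ.Confined D.lowerRate γ L ρ V P) (hρ : 0 ≤ ρ)
    (hR : 0 < R) (hβ : 0 ≤ β) (hk : 1 ≤ k) (hγ : 0 < γ ∧ γ ≤ 1)
    (hn1 : (Fintype.card (Σ q, I q) : ℝ) ≤ n) (hn2 : (Fintype.card Q : ℝ) ≤ n) :
    potential D h r β k c₁ γ σ ≤
      M + β * (13 * k * n * (4 * M ^ 2) + n * R ^ 4 + R ^ 2) := by
  have hM := hc.one_le
  set w := σ.shadow (c₁ * γ)
  have key : ∀ {φ : Param d → ℝ}, Tame M φ → ∀ x : ℝ, |x| ≤ M → (x - φ w) ^ 2 ≤ 4 * M ^ 2 := by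
    intro φ hφ x hx
    have h1 := (abs_sub x (φ w)).trans (add_le_add hx (hφ.abs_le w))
    have h2 := pow_le_pow_left₀ (abs_nonneg _) h1 2
    rw [sq_abs] at h2
    linarith
  have hM2 : 0 ≤ 4 * M ^ 2 := by positivity
  have hn : 0 ≤ n := le_trans (by positivity) hn2
  have e1 := sum_le_mul_of_card_le hn1 hM2 fun x : Σ q, I q =>
    key (hc.tame_gHat x.1 x.2 Finset.univ) (σ.u x.1 x.2) (by
      rw [abs_of_pos (hσc.u x.1 x.2).1]
      exact (hσc.u x.1 x.2).2.trans hc.box_le)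
  have hpos : ∀ {y : ℝ}, y ∈ Set.Icc ρ L → |y| ≤ M := fun hy => by
    rw [abs_of_nonneg (hρ.trans hy.1)]
    exact hy.2.trans hc.box_le
  have e2 := sum_le_mul_of_card_le hn2 hM2 fun q =>
    key (hc.tame_expHat q Finset.univ) (σ.uq q) (hpos (hσc.uq q))
  have e3 := sum_le_mul_of_card_le hn2 hM2 fun q => key (hc.tame_groupTarget q (D.Sa q)) (σ.ua q)
    ((hσc.ua q).trans hc.box_le)
  have e4 := sum_le_mul_of_card_le hn2 hM2 fun q => key (hc.tame_groupTarget q (D.Sb q)) (σ.ub q)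
    ((hσc.ub q).trans hc.box_le)
  have e5 := sum_le_mul_of_card_le hn2 hM2 fun q =>
    key (hc.tame_curvTarget q) (σ.s q) (hpos (hσc.s q))
  have e6 : ∑ q, σ.lowerError D h γ q w ≤ n * (2 * (4 * M ^ 2)) := by
    refine sum_le_mul_of_card_le hn2 (by positivity) fun q => ?_
    have h1 := key (hc.tame_lamHat q) _ ((hσc.lowerShadow q).trans hc.shadow_le)
    have h2 : |D.lowerRate * σ.v q| ≤ M := by
      rw [abs_mul, abs_of_pos D.lowerRate_pos]
      exact (mul_le_mul_of_nonneg_left (hσc.v q) D.lowerRate_pos.le).trans hc.vel_le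
    have h3 := pow_le_pow_left₀ (abs_nonneg _) h2 2
    rw [sq_abs] at h3
    rw [State.lowerError]
    linarith [sq_nonneg M]
  have e7 := sum_le_mul_of_card_le hn1 (by positivity) fun x : Σ q, I q =>
    excess_le_of_inv_le (r := r) hR (hσ.u x.1 x.2).1
  have e8 : γ ^ 2 * ‖σ.z‖ ^ 2 ≤ R ^ 2 :=
    (mul_le_of_le_one_left (sq_nonneg _) (pow_le_one₀ hγ.1.le hγ.2)).trans
      (pow_le_pow_left₀ (norm_nonneg _) hσ.z 2)
  have e9 := (abs_le.1 (hc.tame_objective.abs_le w)).2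
  rw [potential]
  refine add_le_add e9 (mul_le_mul_of_nonneg_left ?_ hβ)
  rw [State.rankError, State.groupError, State.excessSum]
  have f1 := mul_le_mul_of_nonneg_left (add_le_add e1 e2) (by linarith : 0 ≤ k)
  have f2 := mul_le_mul_of_nonneg_left e6 (by linarith : 0 ≤ k)
  have f3 : n * (4 * M ^ 2) ≤ k * (n * (4 * M ^ 2)) :=
    le_mul_of_one_le_left (mul_nonneg hn hM2) hk
  have f4 : 0 ≤ k * (n * (4 * M ^ 2)) := le_trans (mul_nonneg hn hM2) f3
  linarith

theorem neg_le_potential {d : ℕ} {D : Problem Q I} {h : Score I d}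
    {L ρ r V P M β k c₁ γ : ℝ} (hc : Control D h L ρ r V P M) (hβ : 0 ≤ β) (hk : 0 ≤ k)
    (σ : State I d) : -M ≤ potential D h r β k c₁ γ σ := by
  have h1 := (abs_le.1 (hc.tame_objective.abs_le (σ.shadow (c₁ * γ)))).1
  refine h1.trans (le_add_of_nonneg_right (mul_nonneg hβ ?_))
  have h2 := σ.rankError_nonneg (D := D) (h := h) (σ.shadow (c₁ * γ))
  have h3 := σ.excessSum_nonneg (r := r)
  have h4 := σ.groupError_nonneg (D := D) (h := h) (σ.shadow (c₁ * γ))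
  have h5 : 0 ≤ ∑ q, σ.lowerError D h γ q (σ.shadow (c₁ * γ)) :=
    Finset.sum_nonneg fun q _ => σ.lowerError_nonneg q _
  positivity

/-- A potential with constants that do not depend on the scores: on an invariant set of states it
is bounded below, it decreases in the mean in every iteration, and it is bounded initially. -/
theorem exists_uniform_descent [Nonempty Q] (D : Problem Q I) (p : SamplingLaws Q I)
    (hp : p.Unbiased D) (Bh : ℝ) (Ch Lh Ph : ℝ≥0) {R : ℝ} (hR : 0 < R) :
    ∃ B c K γ₁ : ℝ, 0 < B ∧ 0 < c ∧ 0 ≤ K ∧ 0 < γ₁ ∧ ∀ γ : ℝ, 0 < γ → γ ≤ γ₁ →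
      ∃ θ : StepParams, ∀ {d : ℕ} {h : Score I d}, ScoreAssumption h Bh Ch Lh Ph →
        Tame B (objective D h) ∧ ∃ (Φ : State I d → ℝ) (S : Set (State I d)),
          (∀ σ, σ.InitBounded R → σ ∈ S ∧ Φ σ ≤ B) ∧ (∀ σ, -B ≤ Φ σ) ∧
          (∀ σ ∈ S, ∀ b : Batch Q I, (∀ q, (b.2 q).1.Nonempty) → step D h θ b σ ∈ S) ∧
          ∀ σ ∈ S, ∫ b, Φ (step D h θ b σ) ∂p.law ≤
            Φ σ - c * γ * ‖gradient (objective D h) σ.w‖ ^ 2 + K * γ ^ 2 := by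
  have hτ := D.τ₂_pos
  have hrb := rankBound_pos (D := D)
  obtain ⟨L, ρ, V, P, hρ, hreg⟩ := exists_region D Bh Ch Lh Ph hR
  have hr : 0 < rankBound D / 8 := by positivity
  have hr8 : 8 * (rankBound D / 8) ≤ rankBound D := by linarith
  obtain ⟨M, hM, hcon⟩ := exists_control D Bh Ch Lh Ph V P hρ hr hr8 fun hA => (hreg hA).1
  set r := rankBound D / 8
  set n : ℝ := 1 + Fintype.card (Σ q, I q) + Fintype.card Q with hn
  have hcs := D.card_sigma_pos
  have hcq : (0 : ℝ) < Fintype.card Q := by exact_mod_cast Fintype.card_pos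
  have hn0 : 0 < n := by positivity
  have hn1 : 1 ≤ n := by linarith
  have hk4 : D.lowerRate * D.τ₂ ≤ 1 / 4 := D.lowerRate_mul_le (by
    have := inv_pos.2 D.τ₁_pos
    linarith)
  have hk0 : 0 < D.lowerRate * D.τ₂ := mul_pos D.lowerRate_pos hτ
  set a := 1 / n * (D.lowerRate * D.τ₂) with had
  have ha : 0 < a := by positivity
  have ha1 : a ≤ 1 / n := mul_le_of_le_one_right (by positivity) (by linarith)
  have hpair : ∀ x, a ≤ p.pairProb x := fun x => (ha1.trans
    (one_div_le_one_div_of_le hcs (by linarith))).trans (hp.pairProb_mem x).1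
  have hq : ∀ q, 1 / n ≤ p.queryProb q := fun q =>
    (one_div_le_one_div_of_le hcq (by linarith)).trans (hp.queryProb_mem q).1
  obtain ⟨β, k, c₁, γ₁, K, hβ, hk, hc0, hc1, hγ0, hγ1, hK, hdesc⟩ :=
    exists_potential_descent D p hM hr hn1 ha
  set B := M + β * (13 * k * n * (4 * M ^ 2) + n * R ^ 4 + R ^ 2) with hB
  have hMB : M ≤ B := le_add_of_nonneg_right (by positivity)
  refine ⟨B, c₁ / 8, K, min γ₁ (min (1 / 8) (r / (2 * M))), by linarith, by positivity, hK,
    lt_min hγ0 (lt_min (by norm_num) (by positivity)), fun γ hγp hγle => ?_⟩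
  have g1 : γ ≤ γ₁ := hγle.trans (min_le_left _ _)
  have g2 : γ ≤ 1 / 8 := hγle.trans ((min_le_right _ _).trans (min_le_left _ _))
  have g3 : γ ≤ r / (2 * M) := hγle.trans ((min_le_right _ _).trans (min_le_right _ _))
  have g4 : γ * M ≤ r / 2 := by
    rw [le_div_iff₀ (by positivity)] at g3
    linarith
  have hγ : 0 < γ ∧ γ ≤ 1 := ⟨hγp, by linarith⟩
  refine ⟨stepSizes D.lowerRate c₁ γ hγ D.lowerRate_pos.le hc0, fun {d h} hA => ?_⟩
  have hc := hcon hA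
  obtain ⟨hinit, hstep⟩ := (hreg hA).2 hγ (by linarith)
  refine ⟨hc.tame_objective.mono hMB, potential D h r β k c₁ γ,
    {σ | σ.Confined D.lowerRate γ L ρ V P}, fun σ hσ => ⟨hinit σ hσ, ?_⟩, fun σ => ?_,
    fun σ hσ b hb => hstep hc0 σ hσ b hb, fun σ hσ => ?_⟩
  · exact hσ.potential_le hc (hinit σ hσ) hρ.le hR hβ.le hk hγ (by linarith) (by linarith)
  · linarith [neg_le_potential (r := r) (c₁ := c₁) (γ := γ) hc hβ.le (zero_le_one.trans hk) σ]
  · have H : OneStep D p h Bh Ch Lh Ph L ρ r V P M c₁ γ a n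
        (stepSizes D.lowerRate c₁ γ hγ D.lowerRate_pos.le hc0) σ :=
      { unbiased := hp
        score := hA
        control := hc
        confined := hσ
        rate := hγ
        rate_le := g2
        ratio_pos := hc0
        ratio_le := hc1
        params := rfl
        low_nonneg := hρ.le
        r_pos := hr
        r_le := hr8
        rate_mul_le := g4
        contraction_pos := ha
        pair := hpair
        query := fun q => ha1.trans (hq q)
        lower := fun q => mul_le_mul_of_nonneg_right (hq q) hk0.le
        one_le := hn1
        card_pair := by linarith
        card_query := by linarith }
    have := hdesc g1 H
    linarith

end

noncomputable section

/-! ### The random iterates -/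

variable {Q : Type*} {I : Q → Type*} [Fintype Q] [∀ q, Fintype (I q)] [DecidableEq Q]
  [∀ q, DecidableEq (I q)] {D : Problem Q I} {p : SamplingLaws Q I} {d : ℕ} {h : Score I d}
  {θ : StepParams} {σ₀ : State I d}

theorem run_congr {b b' : ℕ → Batch Q I} {t : ℕ} (hb : ∀ i < t, b i = b' i) :
    run D h θ σ₀ b t = run D h θ σ₀ b' t := by
  induction t with
  | zero => rfl
  | succ t ih => rw [run, run, hb t t.lt_succ_self, ih fun i hi => hb i (hi.trans t.lt_succ_self)]

/-- The state after `t` iterations is a function of the first `t` batches. -/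
theorem exists_run_eq (D : Problem Q I) (h : Score I d) (θ : StepParams) (σ₀ : State I d) (t : ℕ) :
    ∃ F : (Finset.range t → Batch Q I) → State I d,
      ∀ b : ℕ → Batch Q I, run D h θ σ₀ b t = F fun i => b i := by
  refine ⟨fun y => run D h θ σ₀ (fun i => if hi : i ∈ Finset.range t then y ⟨i, hi⟩
    else (∅, fun _ => (∅, ∅, ∅))) t, fun b => run_congr fun i hi => ?_⟩
  rw [dif_pos (Finset.mem_range.2 hi)]

variable {Ω : Type*} [MeasurableSpace Ω] {P : Measure Ω} [IsProbabilityMeasure P]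
  {ξ : ℕ → Ω → Batch Q I}

theorem measurable_run (hξ : ∀ t, Measurable (ξ t)) (g : State I d → ℝ) (t : ℕ) :
    Measurable fun ω => g (run D h θ σ₀ (fun t => ξ t ω) t) := by
  obtain ⟨F, hF⟩ := exists_run_eq D h θ σ₀ t
  simp only [hF]
  exact (measurable_of_finite fun y => g (F y)).comp (measurable_pi_lambda _ fun i => hξ i)

theorem integrable_run (hξ : ∀ t, Measurable (ξ t)) (g : State I d → ℝ) (t : ℕ) :
    Integrable (fun ω => g (run D h θ σ₀ (fun t => ξ t ω) t)) P := by
  obtain ⟨F, hF⟩ := exists_run_eq D h θ σ₀ t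
  simp only [hF]
  have hX : Measurable fun ω => fun i : Finset.range t => ξ i ω :=
    measurable_pi_lambda _ fun i => hξ i
  have := Measure.isProbabilityMeasure_map hX.aemeasurable (μ := P)
  exact (Integrable.of_finite (μ := P.map fun ω => fun i : Finset.range t => ξ i ω)
    (f := fun y => g (F y))).comp_measurable hX

/-- The next batch is independent of the current state. -/
theorem integral_run_batch (hξ : ∀ t, Measurable (ξ t)) (hi : iIndepFun ξ P)
    (hl : ∀ t, P.map (ξ t) = p.law) (g : State I d → Batch Q I → ℝ) (t : ℕ) :
    ∫ ω, g (run D h θ σ₀ (fun t => ξ t ω) t) (ξ t ω) ∂P =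
      ∫ ω, ∫ b, g (run D h θ σ₀ (fun t => ξ t ω) t) b ∂p.law ∂P := by
  obtain ⟨F, hF⟩ := exists_run_eq D h θ σ₀ t
  simp only [hF]
  set X : Ω → Finset.range t → Batch Q I := fun ω i => ξ i ω with hX
  have hXm : Measurable X := measurable_pi_lambda _ fun i => hξ i
  have h1 : IndepFun X (ξ t) P :=
    (hi.indepFun_finset (Finset.range t) {t} (by simp) hξ).comp measurable_id
      (measurable_pi_apply (⟨t, Finset.mem_singleton_self t⟩ : ({t} : Finset ℕ)))
  have h2 := (indepFun_iff_map_prod_eq_prod_map_map hXm.aemeasurable (hξ t).aemeasurable).1 h1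
  rw [hl t] at h2
  have := Measure.isProbabilityMeasure_map hXm.aemeasurable (μ := P)
  have h3 := integral_map (hXm.prodMk (hξ t)).aemeasurable (μ := P)
    (f := fun z => g (F z.1) z.2) (measurable_of_finite _).aestronglyMeasurable
  rw [h2, integral_prod _ Integrable.of_finite, integral_map hXm.aemeasurable
    (measurable_of_finite _).aestronglyMeasurable] at h3
  exact h3.symm

/-- Unbiased sampling of the items excludes empty batches almost surely. -/
theorem SamplingLaws.Unbiased.ae_nonempty (hp : p.Unbiased D) :
    ∀ᵐ b ∂p.law, ∀ q, (b.2 q).1.Nonempty := by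
  refine ae_all_iff.2 fun q => ?_
  have h1 : ∀ᵐ B ∂(p.items q).toMeasure, B.Nonempty := by
    rw [ae_iff, PMF.toMeasure_apply_eq_zero_iff _ (Set.toFinite _).measurableSet]
    exact Set.disjoint_left.2 fun B hB hn => hn ((hp.items q).support B hB).1
  have h2 : ∀ᵐ β ∂p.queryLaw q, β.1.Nonempty := Measure.quasiMeasurePreserving_fst.ae h1
  have h3 : ∀ᵐ b ∂Measure.pi p.queryLaw, (b q).1.Nonempty :=
    (Measure.quasiMeasurePreserving_eval _ q).ae h2
  exact Measure.quasiMeasurePreserving_snd.ae h3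

/-- Summation of the mean decrease of a potential along the iterates. -/
theorem sum_integral_run_le (hp : p.Unbiased D) (hξ : ∀ t, Measurable (ξ t)) (hi : iIndepFun ξ P)
    (hl : ∀ t, P.map (ξ t) = p.law) {S : Set (State I d)} {Φ N : State I d → ℝ} {κ : ℝ}
    (h0 : σ₀ ∈ S)
    (hS : ∀ σ ∈ S, ∀ b : Batch Q I, (∀ q, (b.2 q).1.Nonempty) → step D h θ b σ ∈ S)
    (hΦ : ∀ σ ∈ S, ∫ b, Φ (step D h θ b σ) ∂p.law ≤ Φ σ - N σ + κ) (T : ℕ) :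
    ∫ ω, Φ (run D h θ σ₀ (fun t => ξ t ω) T) ∂P +
      ∑ t ∈ Finset.range T, ∫ ω, N (run D h θ σ₀ (fun t => ξ t ω) t) ∂P ≤ Φ σ₀ + T * κ := by
  have hb : ∀ᵐ ω ∂P, ∀ t q, ((ξ t ω).2 q).1.Nonempty := ae_all_iff.2 fun t =>
    ae_of_ae_map (p := fun b : Batch Q I => ∀ q, (b.2 q).1.Nonempty) (hξ t).aemeasurable
      (by rw [hl t]; exact hp.ae_nonempty)
  have hmem : ∀ᵐ ω ∂P, ∀ t, run D h θ σ₀ (fun t => ξ t ω) t ∈ S := by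
    filter_upwards [hb] with ω hω t
    induction t with
    | zero => exact h0
    | succ t ih => exact hS _ ih _ (hω t)
  induction T with
  | zero => simp [run]
  | succ T ih =>
    have h1 : ∫ ω, Φ (run D h θ σ₀ (fun t => ξ t ω) (T + 1)) ∂P ≤
        ∫ ω, (Φ (run D h θ σ₀ (fun t => ξ t ω) T) -
          N (run D h θ σ₀ (fun t => ξ t ω) T) + κ) ∂P := by
      simp only [run]
      rw [integral_run_batch hξ hi hl (fun σ b => Φ (step D h θ b σ)) T]
      refine integral_mono_ae (integrable_run hξ (fun σ => ∫ b, Φ (step D h θ b σ) ∂p.law) T)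
        (((integrable_run hξ Φ T).sub (integrable_run hξ N T)).add (integrable_const κ)) ?_
      filter_upwards [hmem] with ω hω using hΦ _ (hω T)
    have h2 : Integrable (fun ω => Φ (run D h θ σ₀ (fun t => ξ t ω) T) -
        N (run D h θ σ₀ (fun t => ξ t ω) T)) P :=
      (integrable_run hξ Φ T).sub (integrable_run hξ N T)
    rw [integral_add h2 (integrable_const κ),
      integral_sub (integrable_run hξ Φ T) (integrable_run hξ N T)] at h1
    simp only [integral_const, probReal_univ, smul_eq_mul, one_mul] at h1
    rw [Finset.sum_range_succ]
    push_cast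
    linarith

theorem integral_uniformOn_prod {T : ℕ} (hT : 1 ≤ T) {f : ℕ × Ω → ℝ}
    (hf : Integrable f ((uniformOn (Set.Icc 1 T)).prod P)) :
    ∫ x, f x ∂((uniformOn (Set.Icc 1 T)).prod P) =
      (T : ℝ)⁻¹ * ∑ t ∈ Finset.Icc 1 T, ∫ ω, f (t, ω) ∂P := by
  have := isProbabilityMeasure_uniformOn (Set.finite_Icc 1 T) (Set.nonempty_Icc.2 hT)
  have hc : IntegrableOn (fun t => ∫ ω, f (t, ω) ∂P) (Finset.Icc 1 T) Measure.count := by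
    rw [← Set.biUnion_of_singleton (Finset.Icc 1 T : Set ℕ)]
    exact integrableOn_finset_iUnion.2 fun t _ => integrableOn_singleton (by simp) (by simp)
  rw [integral_prod _ hf, uniformOn, ProbabilityTheory.cond, integral_smul_measure,
    ← Finset.coe_Icc, setIntegral_finset _ hc, Measure.count_apply_finset]
  simp [Measure.real]

end

end KSORED

theorem theorem1 {Q : Type*} [Fintype Q] [DecidableEq Q] [Nonempty Q]
    {I : Q → Type*} [∀ q, Fintype (I q)] [∀ q, DecidableEq (I q)]
    (D : KSORED.Problem Q I) (p : KSORED.SamplingLaws Q I) (hp : p.Unbiased D)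
    (Bh : ℝ) (Ch Lh Ph : ℝ≥0) (R : ℝ) (hR : 0 < R) :
    ∃ A : ℝ, 0 < A ∧ ∀ ε : ℝ, 0 < ε → ∃ θ : KSORED.StepParams,
      ∀ (d : ℕ) (h : KSORED.Score I d), KSORED.ScoreAssumption h Bh Ch Lh Ph →
        Differentiable ℝ (KSORED.objective D h) ∧
        ∀ σ₀ : KSORED.State I d, σ₀.InitBounded R →
        ∀ {Ω : Type*} [MeasurableSpace Ω] (P : Measure Ω) [IsProbabilityMeasure P]
          (ξ : ℕ → Ω → KSORED.Batch Q I),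
          (∀ t, Measurable (ξ t)) → iIndepFun ξ P → (∀ t, P.map (ξ t) = p.law) →
        ∀ T : ℕ, A / ε ^ 4 ≤ T →
          Integrable (fun x : ℕ × Ω => ‖gradient (KSORED.objective D h)
              (KSORED.run D h θ σ₀ (fun t => ξ t x.2) x.1).w‖ ^ 2)
            ((uniformOn (Set.Icc 1 T)).prod P) ∧
          ∫ x : ℕ × Ω, ‖gradient (KSORED.objective D h)
              (KSORED.run D h θ σ₀ (fun t => ξ t x.2) x.1).w‖ ^ 2
            ∂((uniformOn (Set.Icc 1 T)).prod P) ≤ ε ^ 2 := by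
  obtain ⟨B, c, K, γ₁, hB, hc, hK, hγ₁, hdesc⟩ :=
    KSORED.exists_uniform_descent D p hp Bh Ch Lh Ph hR
  set m : ℝ := 4 * (K + 1) / c with hm
  have hm0 : 0 < m := by positivity
  refine ⟨(8 * B / (c * γ₁)) ^ 2 + 8 * B * m / c, by positivity, fun ε hε => ?_⟩
  obtain ⟨θ, hθ⟩ := hdesc (min γ₁ (ε ^ 2 / m)) (lt_min hγ₁ (by positivity)) (min_le_left _ _)
  set γ := min γ₁ (ε ^ 2 / m) with hγ
  have hγ0 : 0 < γ := lt_min hγ₁ (by positivity)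
  refine ⟨θ, fun d h hA => ?_⟩
  obtain ⟨htame, Φ, S, hinit, hlow, hstep, hdrop⟩ := hθ hA
  refine ⟨htame.differentiable, fun σ₀ hσ₀ Ω _ P _ ξ hξ hi hl T hT => ?_⟩
  have hT0 : (0 : ℝ) < T := lt_of_lt_of_le (by positivity) hT
  have hT1 : 1 ≤ T := by exact_mod_cast hT0
  have hT1' : (1 : ℝ) ≤ T := by exact_mod_cast hT1
  set N : KSORED.State I d → ℝ := fun σ => ‖gradient (KSORED.objective D h) σ.w‖ ^ 2 with hN
  have := isProbabilityMeasure_uniformOn (Set.finite_Icc 1 T) (Set.nonempty_Icc.2 hT1)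
  have hint : Integrable (fun x : ℕ × Ω => N (KSORED.run D h θ σ₀ (fun t => ξ t x.2) x.1))
      ((uniformOn (Set.Icc 1 T)).prod P) := by
    refine Integrable.of_bound (measurable_from_prod_countable_right fun t =>
      KSORED.measurable_run hξ N t).aestronglyMeasurable (B ^ 2) (Eventually.of_forall fun x => ?_)
    rw [hN, Real.norm_of_nonneg (sq_nonneg _)]
    exact pow_le_pow_left₀ (norm_nonneg _) (htame.norm_gradient_le _) 2
  refine ⟨hint, ?_⟩
  rw [KSORED.integral_uniformOn_prod hT1 hint]
  obtain ⟨hS, hΦ₀⟩ := hinit σ₀ hσ₀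
  have key := KSORED.sum_integral_run_le (N := fun σ => c * γ * N σ) hp hξ hi hl hS hstep
    hdrop (T + 1)
  have hΦ : -B ≤ ∫ ω, Φ (KSORED.run D h θ σ₀ (fun t => ξ t ω) (T + 1)) ∂P := by
    have := integral_mono (μ := P)
      (g := fun ω => Φ (KSORED.run D h θ σ₀ (fun t => ξ t ω) (T + 1))) (integrable_const (-B))
      (KSORED.integrable_run hξ Φ (T + 1)) fun ω => hlow _
    simpa using this
  simp only [integral_const_mul, ← Finset.mul_sum] at key
  have hsub : ∑ t ∈ Finset.Icc 1 T, ∫ ω, N (KSORED.run D h θ σ₀ (fun t => ξ t ω) t) ∂P ≤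
      ∑ t ∈ Finset.range (T + 1), ∫ ω, N (KSORED.run D h θ σ₀ (fun t => ξ t ω) t) ∂P :=
    Finset.sum_le_sum_of_subset_of_nonneg
      (fun t ht => Finset.mem_range.2 (Nat.lt_succ_of_le (Finset.mem_Icc.1 ht).2))
      fun t _ _ => integral_nonneg fun ω => sq_nonneg _
  set Y := ∑ t ∈ Finset.Icc 1 T, ∫ ω, N (KSORED.run D h θ σ₀ (fun t => ξ t ω) t) ∂P
  have hY := mul_le_mul_of_nonneg_left hsub (mul_nonneg hc.le hγ0.le)
  push_cast at key
  have h1 : c * γ * Y ≤ 2 * B + 2 * T * (K * γ ^ 2) := by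
    have : 0 ≤ K * γ ^ 2 * (T - 1) := mul_nonneg (by positivity) (by linarith)
    linarith
  have hγε : γ * m ≤ ε ^ 2 := by
    rw [← le_div_iff₀ hm0]
    exact min_le_right _ _
  have h2 : 2 * K * γ ≤ c * (ε ^ 2 / 2) := by
    rw [hm, mul_div_assoc', div_le_iff₀ hc] at hγε
    nlinarith
  have h3 : 4 * B ≤ T * (c * γ * ε ^ 2) := by
    rw [div_le_iff₀ (by positivity)] at hT
    have a1 : 0 ≤ (8 * B / (c * γ₁)) ^ 2 := sq_nonneg _
    have a2 : 0 ≤ 8 * B * m / c := by positivity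
    rcases min_choice γ₁ (ε ^ 2 / m) with e | e
    · -- As `1 ≤ T`, the bound of `T * ε ^ 4` by a square gives one of `T * ε ^ 2` by its root.
      rw [← hγ] at e
      have h4 : (8 * B / (c * γ₁)) ^ 2 ≤ (T * ε ^ 2) ^ 2 := by
        have : T * ε ^ 4 ≤ T * (T * ε ^ 4) := le_mul_of_one_le_left (by positivity) hT1'
        linarith
      have h5 := abs_le_of_sq_le_sq' h4 (by positivity)
      have h6 := h5.2
      rw [div_le_iff₀ (by positivity)] at h6
      rw [e]
      linarith
    · rw [← hγ] at e
      have h4 : 8 * B * m / c ≤ T * ε ^ 4 := by linarith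
      rw [div_le_iff₀ hc] at h4
      have h5 : c * γ * ε ^ 2 = c * ε ^ 4 / m := by
        rw [e]
        ring
      rw [h5, mul_div_assoc', le_div_iff₀ hm0]
      nlinarith [mul_pos hB hm0]
  rw [inv_mul_le_iff₀ hT0]
  have h4 : c * γ * Y ≤ c * γ * (T * ε ^ 2) := by
    have := mul_le_mul_of_nonneg_left h2 (mul_nonneg hT0.le hγ0.le)
    linarith
  exact le_of_mul_le_mul_left h4 (by positivity)
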